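/- **Theorem.** Let $n\ge 1$, let $P_1\in\mathbb C^{n\times n}$ be Hermitian and invertible, and let $n_-$ be the number of negative eigenvalues of $P_1$ (counted with multiplicity); assume $n_-\ge 1$. Let $\mathcal H\colon[0,\infty)\to\mathbb C^{n\times n}$ be continuously differentiable with Hermitian positive definite values. Let $\Delta,S\colon[0,\infty)\to\mathbb C^{n\times n}$ be continuously differentiable, with $\Delta(\xi)$ diagonal, $S(\xi)$ invertible and $$P_1\mathcal H(\xi)=S(\xi)^{-1}\Delta(\xi)S(\xi)\qquad(\xi\ge 0).$$ Put $|\Delta|=(\Delta^\star\Delta)^{1/2}$. For a continuous $w\colon[0,\infty)\to\mathbb C^{n\times n}$ with Hermitian positive definite values, let $L^2_w(0,\infty)$ be the Hilbert space of (classes of) measurable $x\colon[0,\infty)\to\mathbb C^n$ with $\|x\|^2=\int_0^\infty x(\xi)^\star w(\xi)x(\xi)\,d\xi<\infty$, with scalar product $\langle x,y\rangle=\int_0^\infty x^\star w\,y\,d\xi$. Let $W_B\in\mathbb C^{n_-\times n}$. Let $U_2$ be the submatrix of $W_B\mathcal H(0)S(0)^{-1}$ formed by the columns whose index $i$ satisfies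 $\Delta_{ii}(0)<0$ (if the coordinates are ordered such that $\Delta=\operatorname{diag}(\Lambda,\Theta)$ with $\Lambda>0$ and $\Theta<0$, this is the right block in $W_B\mathcal H(0)S(0)^{-1}=[U_1\;\;U_2]$; there are exactly $n_-$ such columns). Let $Z^-(0)\subseteq\mathbb C^n$ be the span of the eigenvectors of $P_1\mathcal H(0)$ that correspond to negative eigenvalues. Assume that (a) $\Delta$ is bounded on $[0,\infty)$; (b) $x\mapsto Sx$ is an isomorphism of Banach spaces $L^2_{\mathcal H}(0,\infty)\to L^2_{|\Delta|}(0,\infty)$; (c) $g\mapsto S(S^{-1})'\Delta g$ is a bounded operator $L^2_{|\Delta|}(0,\infty)\to L^2_{|\Delta|}(0,\infty)$; (d) $x\mapsto S'P_1\mathcal Hx$ is well-defined as a map $L^2_{\mathcal H}(0,\infty)\to L^2_{|\Delta|}(0,\infty)$; (e) $\operatorname{rank}W_B=n_-$. Let $A_{\mathcal H}$ be the operator in $L^2_{\mathcal H}(0,\infty)$ given by $A_{\mathcal H}x=P_1(\mathcal Hx)'$ on $$D(A_{\mathcal H})=\{x\in L^2_{\mathcal H}(0,\infty):\ \mathcal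 Hx\in AC_{\rm loc}[0,\infty),\ P_1(\mathcal Hx)'\in L^2_{\mathcal H}(0,\infty),\ W_B(\mathcal Hx)(0)=0\},$$ where $\mathcal Hx\in AC_{\rm loc}[0,\infty)$ means that $\mathcal Hx$ has a representative that is absolutely continuous on every compact interval $[a,b]\subseteq[0,\infty)$, and $(\mathcal Hx)'$ and $(\mathcal Hx)(0)$ are the almost everywhere derivative and the value at $0$ of this representative. Then the following are equivalent. (i) $A_{\mathcal H}$ generates a $C_0$-semigroup on $L^2_{\mathcal H}(0,\infty)$. (ii) The matrix $U_2$ is invertible. (iii) $W_B\mathcal H(0)Z^-(0)=\mathbb C^{n_-}$. Moreover, if multiplication by $P_1$ maps $L^2_{\mathcal H}(0,\infty)$ into itself, then the condition $P_1(\mathcal Hx)'\in L^2_{\mathcal H}(0,\infty)$ in $D(A_{\mathcal H})$ may be replaced by $(\mathcal Hx)'\in L^2_{\mathcal H}(0,\infty)$ without changing $D(A_{\mathcal H})$. -/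

import Mathlib

open MeasureTheory Set Filter Topology
open scoped ComplexOrder

noncomputable section

namespace PHS

/-- Lebesgue measure on the half-axis `[0,∞)`. -/
abbrev halfLine : Measure ℝ := volume.restrict (Ici (0 : ℝ))

/-- A matrix-valued function on `[0,∞)` (values at negative arguments are irrelevant) is
continuously differentiable, with the one-sided derivative at `0`. -/
def IsC1 {m k : Type*} (M : ℝ → Matrix m k ℂ) : Prop :=
  ∀ i j, ContDiffOn ℝ 1 (fun ξ => M ξ i j) (Ici 0)

/-- The entrywise derivative of a matrix-valued function on `[0,∞)`. -/
def matDeriv {m k : Type*} (M : ℝ → Matrix m k ℂ) (ξ : ℝ) : Matrix m k ℂ :=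
  Matrix.of fun i j => derivWithin (fun ζ => M ζ i j) (Ici 0) ξ

/-- Locally absolutely continuous functions on `[0,∞)`: absolutely continuous on every compact
interval `[a,b] ⊆ [0,∞)`. -/
def LocAC {E : Type*} [PseudoMetricSpace E] (u : ℝ → E) : Prop :=
  ∀ a b : ℝ, 0 ≤ a → a ≤ b → AbsolutelyContinuousOnInterval u a b

/-! ### The weighted space `L²_w(0,∞)` -/

/-- An admissible weight: continuous with positive definite Hermitian values on `[0,∞)`. -/
structure IsWeight {n : ℕ} (w : ℝ → Matrix (Fin n) (Fin n) ℂ) : Prop where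
  cont : ∀ i j, ContinuousOn (fun ξ => w ξ i j) (Ici 0)
  posDef : ∀ ξ, 0 ≤ ξ → (w ξ).PosDef

open Classical in
/-- The weight that is used in the definition of `L²_w`: it is `w` itself if `w` is admissible; the
constant weight `1` is a junk value for inadmissible `w`, so that `L²_w` is always a
Hilbert space. -/
def effWeight {n : ℕ} (w : ℝ → Matrix (Fin n) (Fin n) ℂ) : ℝ → Matrix (Fin n) (Fin n) ℂ :=
  if IsWeight w then w else fun _ => 1

theorem effWeight_eq {n : ℕ} {w : ℝ → Matrix (Fin n) (Fin n) ℂ} (hw : IsWeight w) :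
    effWeight w = w := if_pos hw

theorem isWeight_effWeight {n : ℕ} (w : ℝ → Matrix (Fin n) (Fin n) ℂ) :
    IsWeight (effWeight w) := by
  unfold effWeight
  split_ifs with h
  · exact h
  · exact ⟨fun i j => continuousOn_const, fun _ _ => Matrix.PosDef.one⟩

/-- The integrand `x(ξ)⋆ w(ξ) y(ξ)`. -/
def wForm {n : ℕ} (w : ℝ → Matrix (Fin n) (Fin n) ℂ) (x y : ℝ → Fin n → ℂ) (ξ : ℝ) : ℂ :=
  star (x ξ) ⬝ᵥ (w ξ).mulVec (y ξ)

section aux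
variable {n : ℕ} {w : ℝ → Matrix (Fin n) (Fin n) ℂ}

theorem IsWeight.aesm_form (hw : IsWeight w) {x y : ℝ → Fin n → ℂ}
    (hx : AEStronglyMeasurable x halfLine) (hy : AEStronglyMeasurable y halfLine) :
    AEStronglyMeasurable (wForm w x y) halfLine := by
  have hxi : ∀ i, AEStronglyMeasurable (fun ξ => x ξ i) halfLine := fun i =>
    (continuous_apply i).comp_aestronglyMeasurable hx
  have hyi : ∀ i, AEStronglyMeasurable (fun ξ => y ξ i) halfLine := fun i =>
    (continuous_apply i).comp_aestronglyMeasurable hy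
  have hwij : ∀ i j, AEStronglyMeasurable (fun ξ => w ξ i j) halfLine := fun i j =>
    (hw.cont i j).aestronglyMeasurable measurableSet_Ici
  have : wForm w x y = fun ξ => ∑ i, star (x ξ i) * ∑ j, w ξ i j * y ξ j := by
    funext ξ; simp [wForm, dotProduct, Matrix.mulVec]
  rw [this]
  refine Finset.aestronglyMeasurable_fun_sum _ fun i _ => ?_
  refine (continuous_star.comp_aestronglyMeasurable (hxi i)).mul ?_
  exact Finset.aestronglyMeasurable_fun_sum _ fun j _ => (hwij i j).mul (hyi j)

theorem IsWeight.form_norm (hw : IsWeight w) (x : ℝ → Fin n → ℂ) {ξ : ℝ} (hξ : 0 ≤ ξ) :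
    ‖wForm w x x ξ‖ = (wForm w x x ξ).re ∧ wForm w x x ξ = ((wForm w x x ξ).re : ℂ) := by
  have h := (hw.posDef ξ hξ).posSemidef.dotProduct_mulVec_nonneg (x ξ)
  have h' : 0 ≤ wForm w x x ξ := h
  rw [Complex.le_def] at h'
  have e : wForm w x x ξ = ((wForm w x x ξ).re : ℂ) := by
    apply Complex.ext <;> simp [← h'.2]
  refine ⟨?_, e⟩
  rw [e, Complex.norm_real, Complex.ofReal_re, Real.norm_of_nonneg h'.1]

theorem wForm_add_sub (x y : ℝ → Fin n → ℂ) (ξ : ℝ) :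
    wForm w (x + y) (x + y) ξ + wForm w (x - y) (x - y) ξ
      = 2 * wForm w x x ξ + 2 * wForm w y y ξ := by
  simp [wForm, Matrix.mulVec_add, sub_eq_add_neg, Matrix.mulVec_neg]
  ring

theorem wForm_smul (c d : ℂ) (x y : ℝ → Fin n → ℂ) (ξ : ℝ) :
    wForm w (c • x) (d • y) ξ = star c * d * wForm w x y ξ := by
  simp [wForm, Matrix.mulVec_smul]
  ring

theorem IsWeight.integrable_add (hw : IsWeight w) {x y : ℝ → Fin n → ℂ}
    (hx : AEStronglyMeasurable x halfLine) (hy : AEStronglyMeasurable y halfLine)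
    (ix : Integrable (wForm w x x) halfLine) (iy : Integrable (wForm w y y) halfLine) :
    Integrable (wForm w (x + y) (x + y)) halfLine := by
  refine Integrable.mono' ((ix.norm.const_mul 2).add (iy.norm.const_mul 2))
    (hw.aesm_form (hx.add hy) (hx.add hy)) ?_
  refine (ae_restrict_iff' measurableSet_Ici).2 (Eventually.of_forall fun ξ hξ => ?_)
  have h := congrArg Complex.re (wForm_add_sub (w := w) x y ξ)
  have h1 := hw.form_norm (x + y) hξ
  have h2 := hw.form_norm (x - y) hξ
  have h3 := hw.form_norm x hξ
  have h4 := hw.form_norm y hξ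
  have h5 := norm_nonneg (wForm w (x - y) (x - y) ξ)
  simp only [Complex.add_re, Complex.mul_re, Complex.re_ofNat, Complex.im_ofNat, zero_mul,
    sub_zero] at h
  simp only [Pi.add_apply]
  linarith [h1.1, h2.1, h3.1, h4.1]

theorem IsWeight.integrable_smul {x : ℝ → Fin n → ℂ} (c : ℂ)
    (ix : Integrable (wForm w x x) halfLine) :
    Integrable (wForm w (c • x) (c • x)) halfLine := by
  have : wForm w (c • x) (c • x) = fun ξ => star c * c * wForm w x x ξ :=
    funext fun ξ => wForm_smul c c x x ξ
  rw [this]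
  exact ix.const_mul _

theorem wForm_polar (x y : ℝ → Fin n → ℂ) (ξ : ℝ) :
    wForm w x y ξ = (1 / 4 : ℂ) * (wForm w (x + y) (x + y) ξ
      - wForm w (x + (-1 : ℂ) • y) (x + (-1 : ℂ) • y) ξ
      - Complex.I * wForm w (x + Complex.I • y) (x + Complex.I • y) ξ
      + Complex.I * wForm w (x + (-Complex.I) • y) (x + (-Complex.I) • y) ξ) := by
  simp only [wForm, Pi.add_apply, Pi.smul_apply, star_add, star_smul, add_dotProduct,
    Matrix.mulVec_add, Matrix.mulVec_smul, dotProduct_add, smul_dotProduct, dotProduct_smul,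
    smul_eq_mul, star_neg, star_one, Complex.star_def, Complex.conj_I]
  ring_nf
  simp only [Complex.I_sq]
  ring

theorem IsWeight.integrable_form (hw : IsWeight w) {x y : ℝ → Fin n → ℂ}
    (hx : AEStronglyMeasurable x halfLine) (hy : AEStronglyMeasurable y halfLine)
    (ix : Integrable (wForm w x x) halfLine) (iy : Integrable (wForm w y y) halfLine) :
    Integrable (wForm w x y) halfLine := by
  have key : ∀ c : ℂ, Integrable (wForm w (x + c • y) (x + c • y)) halfLine := fun c =>
    hw.integrable_add hx (hy.const_smul c) ix (IsWeight.integrable_smul c iy)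
  have : wForm w x y = fun ξ => (1 / 4 : ℂ) * (wForm w (x + y) (x + y) ξ
      - wForm w (x + (-1 : ℂ) • y) (x + (-1 : ℂ) • y) ξ
      - Complex.I * wForm w (x + Complex.I • y) (x + Complex.I • y) ξ
      + Complex.I * wForm w (x + (-Complex.I) • y) (x + (-Complex.I) • y) ξ) :=
    funext fun ξ => wForm_polar x y ξ
  rw [this]
  refine Integrable.const_mul ?_ _
  exact (((hw.integrable_add hx hy ix iy).sub (key _)).sub ((key _).const_mul _)).add
    ((key _).const_mul _)

theorem wForm_congr {x x' y y' : ℝ → Fin n → ℂ} (hx : x =ᵐ[halfLine] x')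
    (hy : y =ᵐ[halfLine] y') : wForm w x y =ᵐ[halfLine] wForm w x' y' := by
  filter_upwards [hx, hy] with ξ h1 h2
  simp [wForm, h1, h2]

end aux

/-- The linear space of all (classes of) measurable `x : [0,∞) → ℂⁿ` for which the integral of
`x(ξ)⋆ w(ξ) x(ξ)` over `[0,∞)` is finite. -/
def L2Submodule {n : ℕ} (w : ℝ → Matrix (Fin n) (Fin n) ℂ) :
    Submodule ℂ (ℝ →ₘ[halfLine] (Fin n → ℂ)) where
  carrier := {x | Integrable (wForm (effWeight w) x x) halfLine}
  add_mem' := by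
    intro x y hx hy
    have h := (isWeight_effWeight w).integrable_add x.aestronglyMeasurable
      y.aestronglyMeasurable hx hy
    exact h.congr (wForm_congr (AEEqFun.coeFn_add x y).symm (AEEqFun.coeFn_add x y).symm)
  zero_mem' := by
    have : wForm (effWeight w) (0 : ℝ →ₘ[halfLine] (Fin n → ℂ)) (0 : ℝ →ₘ[halfLine] (Fin n → ℂ))
        =ᵐ[halfLine] fun _ => 0 := by
      filter_upwards [AEEqFun.coeFn_zero (μ := halfLine) (β := Fin n → ℂ)] with ξ h
      simp [wForm, h]
    exact (integrable_zero ℝ ℂ halfLine).congr this.symm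
  smul_mem' := by
    intro c x hx
    have h := IsWeight.integrable_smul (w := effWeight w) c hx
    exact h.congr (wForm_congr (AEEqFun.coeFn_smul c x).symm (AEEqFun.coeFn_smul c x).symm)

/-- The weighted space `L²_w(0,∞)` of `ℂⁿ`-valued functions. -/
def L2 {n : ℕ} (w : ℝ → Matrix (Fin n) (Fin n) ℂ) : Type := L2Submodule w

namespace L2
variable {n : ℕ} {w : ℝ → Matrix (Fin n) (Fin n) ℂ}

instance : AddCommGroup (L2 w) := inferInstanceAs (AddCommGroup (L2Submodule w))
instance : Module ℂ (L2 w) := inferInstanceAs (Module ℂ (L2Submodule w))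

/-- The underlying class of functions modulo equality almost everywhere. -/
def toAE (x : L2 w) : ℝ →ₘ[halfLine] (Fin n → ℂ) := x.1

/-- Elements of `L²_w` are used as functions (a representative; meaningful almost everywhere). -/
instance : CoeFun (L2 w) (fun _ => ℝ → Fin n → ℂ) := ⟨fun x => x.toAE⟩

theorem ext_ae {x y : L2 w} (h : x =ᵐ[halfLine] y) : x = y := Subtype.ext (AEEqFun.ext h)

theorem coe_add (x y : L2 w) : (x + y : L2 w) =ᵐ[halfLine] ⇑x + ⇑y :=
  AEEqFun.coeFn_add x.toAE y.toAE

theorem coe_smul (c : ℂ) (x : L2 w) : (c • x : L2 w) =ᵐ[halfLine] c • ⇑x :=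
  AEEqFun.coeFn_smul c x.toAE

theorem coe_zero : (0 : L2 w) =ᵐ[halfLine] 0 :=
  AEEqFun.coeFn_zero (μ := halfLine) (β := Fin n → ℂ)

theorem integrable_form (x y : L2 w) : Integrable (wForm (effWeight w) x y) halfLine :=
  (isWeight_effWeight w).integrable_form x.toAE.aestronglyMeasurable
    y.toAE.aestronglyMeasurable x.2 y.2

/-- The scalar product `⟪x,y⟫ = ∫ x(ξ)⋆ w(ξ) y(ξ) dξ`. -/
abbrev core : InnerProductSpace.Core ℂ (L2 w) where
  inner x y := ∫ ξ, wForm (effWeight w) x y ξ ∂halfLine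
  conj_inner_symm x y := by
    rw [← integral_conj]
    refine integral_congr_ae ?_
    refine (ae_restrict_iff' measurableSet_Ici).2 (Eventually.of_forall fun ξ hξ => ?_)
    have hH : (effWeight w ξ).IsHermitian := ((isWeight_effWeight w).posDef ξ hξ).isHermitian
    change star (star (y ξ) ⬝ᵥ (effWeight w ξ).mulVec (x ξ)) = _
    rw [Matrix.star_dotProduct, star_star, Matrix.star_mulVec, hH.eq, wForm,
      Matrix.dotProduct_mulVec]
  re_inner_nonneg x := by
    have h : ∀ᵐ ξ ∂halfLine, 0 ≤ (wForm (effWeight w) x x ξ).re := by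
      refine (ae_restrict_iff' measurableSet_Ici).2 (Eventually.of_forall fun ξ hξ => ?_)
      rw [← ((isWeight_effWeight w).form_norm x hξ).1]
      exact norm_nonneg _
    have e := integral_re (integrable_form x x)
    rw [← e]
    exact integral_nonneg_of_ae h
  add_left x y z := by
    rw [← integral_add (integrable_form x z) (integrable_form y z)]
    refine integral_congr_ae ?_
    filter_upwards [coe_add x y] with ξ h
    simp [wForm, h]
  smul_left x y r := by
    rw [← integral_const_mul]
    refine integral_congr_ae ?_
    filter_upwards [coe_smul r x] with ξ h
    simp [wForm, h]
  definite x h := by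
    have hnn : 0 ≤ᵐ[halfLine] fun ξ => (wForm (effWeight w) x x ξ).re := by
      refine (ae_restrict_iff' measurableSet_Ici).2 (Eventually.of_forall fun ξ hξ => ?_)
      change 0 ≤ (wForm (effWeight w) x x ξ).re
      rw [← ((isWeight_effWeight w).form_norm x hξ).1]
      exact norm_nonneg _
    have e := integral_re (integrable_form x x)
    have h0 : ∫ ξ, (wForm (effWeight w) x x ξ).re ∂halfLine = 0 := by
      have h' : (∫ ξ, wForm (effWeight w) x x ξ ∂halfLine) = 0 := h
      rw [h'] at e
      simpa using e
    have hz := (integral_eq_zero_iff_of_nonneg_ae hnn (integrable_form x x).re).1 h0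
    refine ext_ae ?_
    have hIci : ∀ᵐ ξ ∂halfLine, ξ ∈ Ici (0 : ℝ) := ae_restrict_mem measurableSet_Ici
    filter_upwards [hz, coe_zero (w := w), hIci] with ξ h1 h2 hξ
    rw [h2]
    by_contra hne
    have hpos := ((isWeight_effWeight w).posDef ξ hξ).dotProduct_mulVec_pos hne
    have : 0 < wForm (effWeight w) x x ξ := hpos
    rw [Complex.lt_def] at this
    exact absurd h1 (ne_of_gt this.1)

instance : NormedAddCommGroup (L2 w) := (core (w := w)).toNormedAddCommGroup

instance : InnerProductSpace ℂ (L2 w) := InnerProductSpace.ofCore (core (w := w)).toCore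

theorem norm_sq_eq (hw : IsWeight w) (x : L2 w) :
    ((‖x‖ ^ 2 : ℝ) : ℂ) = ∫ ξ in Ici (0 : ℝ), star (x ξ) ⬝ᵥ (w ξ).mulVec (x ξ) := by
  have h := inner_self_eq_norm_sq_to_K (𝕜 := ℂ) x
  have h' : inner ℂ x x = ∫ ξ, wForm (effWeight w) x x ξ ∂halfLine := rfl
  rw [effWeight_eq hw] at h'
  push_cast
  exact h.symm.trans h'

end L2

/-! ### Strongly continuous semigroups -/

/-- `(T(t))_{t ≥ 0}` is a `C₀`-semigroup of bounded linear operators on `X` (the values of `T` at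
negative times are irrelevant). -/
structure IsC0Semigroup {X : Type*} [NormedAddCommGroup X] [NormedSpace ℂ X]
    (T : ℝ → X →L[ℂ] X) : Prop where
  map_zero : T 0 = ContinuousLinearMap.id ℂ X
  map_add : ∀ s t, 0 ≤ s → 0 ≤ t → T (s + t) = (T s).comp (T t)
  strong_cont : ∀ x, ContinuousOn (fun t => T t x) (Ici 0)

/-- The (in general unbounded) operator `A : D(A) → X` is the generator of a `C₀`-semigroup: for
some `C₀`-semigroup `T`, one has `x ∈ D(A)` and `A x = y` if and only if
`(T(t) x - x) / t → y` as `t ↓ 0`. -/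
def GeneratesC0Semigroup {X : Type*} [NormedAddCommGroup X] [NormedSpace ℂ X]
    (A : X →ₗ.[ℂ] X) : Prop :=
  ∃ T : ℝ → X →L[ℂ] X, IsC0Semigroup T ∧ ∀ x y : X,
    (∃ hx : x ∈ A.domain, A ⟨x, hx⟩ = y) ↔
      Tendsto (fun t : ℝ => ((t⁻¹ : ℝ) : ℂ) • (T t x - x)) (𝓝[>] 0) (𝓝 y)

/-! ### The port-Hamiltonian operator -/

variable {n p : ℕ}

/-- The graph of `A x = P₁ (H x)'`: all pairs `(x, y)` in `L²_H × L²_H` such that `H x` has a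
locally absolutely continuous representative `u` with `W_B u(0) = 0` and `y = P₁ u'` almost
everywhere. -/
def phsGraph (P₁ : Matrix (Fin n) (Fin n) ℂ) (H : ℝ → Matrix (Fin n) (Fin n) ℂ)
    (WB : Matrix (Fin p) (Fin n) ℂ) : Submodule ℂ (L2 H × L2 H) where
  carrier := {q | ∃ u : ℝ → Fin n → ℂ, LocAC u ∧
    (∀ᵐ ξ ∂halfLine, u ξ = (H ξ).mulVec (q.1 ξ)) ∧ WB.mulVec (u 0) = 0 ∧
    ∀ᵐ ξ ∂halfLine, ∃ d, HasDerivAt u d ξ ∧ q.2 ξ = P₁.mulVec d}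
  add_mem' := by
    rintro q r ⟨u, hu, hux, hu0, huy⟩ ⟨v, hv, hvx, hv0, hvy⟩
    refine ⟨u + v, fun a b ha hb => (hu a b ha hb).add (hv a b ha hb), ?_, ?_, ?_⟩
    · filter_upwards [hux, hvx, L2.coe_add q.1 r.1] with ξ h1 h2 h3
      simp [h1, h2, h3, Matrix.mulVec_add]
    · simp [Matrix.mulVec_add, hu0, hv0]
    · filter_upwards [huy, hvy, L2.coe_add q.2 r.2] with ξ h1 h2 h3
      obtain ⟨d, hd, h1⟩ := h1
      obtain ⟨e, he, h2⟩ := h2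
      exact ⟨d + e, hd.add he, by simp [h1, h2, h3, Matrix.mulVec_add]⟩
  zero_mem' := by
    refine ⟨0, fun a b _ _ => ?_, ?_, by simp, ?_⟩
    · simpa [AbsolutelyContinuousOnInterval] using tendsto_const_nhds
    · filter_upwards [L2.coe_zero (w := H)] with ξ h
      simp [h]
    · filter_upwards [L2.coe_zero (w := H)] with ξ h
      exact ⟨0, hasDerivAt_const ξ (0 : Fin n → ℂ), by simp [h]⟩
  smul_mem' := by
    rintro c q ⟨u, hu, hux, hu0, huy⟩
    refine ⟨fun ξ => c • u ξ, fun a b ha hb => (hu a b ha hb).const_smul c, ?_, ?_, ?_⟩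
    · filter_upwards [hux, L2.coe_smul c q.1] with ξ h1 h3
      simp [h1, h3, Matrix.mulVec_smul]
    · simp [Matrix.mulVec_smul, hu0]
    · filter_upwards [huy, L2.coe_smul c q.2] with ξ h1 h3
      obtain ⟨d, hd, h1⟩ := h1
      exact ⟨c • d, hd.const_smul c, by simp [h1, h3, Matrix.mulVec_smul]⟩

/-- The operator `A x = P₁ (H x)'` in `L²_H(0,∞)`, with domain the set of all `x ∈ L²_H` such that
`H x` is locally absolutely continuous, `P₁ (H x)' ∈ L²_H` and `W_B (H x)(0) = 0`. -/
def phsOperator (P₁ : Matrix (Fin n) (Fin n) ℂ) (H : ℝ → Matrix (Fin n) (Fin n) ℂ)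
    (WB : Matrix (Fin p) (Fin n) ℂ) : L2 H →ₗ.[ℂ] L2 H :=
  (phsGraph P₁ H WB).toLinearPMap

theorem LocAC.eq_zero_of_ae {u : ℝ → Fin n → ℂ} (hu : LocAC u)
    (h : ∀ᵐ ξ ∂halfLine, u ξ = 0) : ∀ ξ, 0 < ξ → u ξ = 0 := by
  intro ξ hξ
  have hc : ContinuousOn u (Ioo 0 (ξ + 1)) := by
    have := (hu 0 (ξ + 1) le_rfl (by linarith)).continuousOn
    rw [uIcc_of_le (by linarith)] at this
    exact this.mono Ioo_subset_Icc_self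
  have h' : u =ᵐ[volume.restrict (Ioo 0 (ξ + 1))] fun _ => 0 :=
    ae_restrict_of_ae_restrict_of_subset (fun z hz => hz.1.le) h
  exact Measure.eqOn_open_of_ae_eq h' isOpen_Ioo hc continuousOn_const ⟨hξ, by linarith⟩

/-- The relation `phsGraph` is single-valued, so it is the graph of `phsOperator`. -/
theorem phsOperator_graph (P₁ : Matrix (Fin n) (Fin n) ℂ)
    (H : ℝ → Matrix (Fin n) (Fin n) ℂ) (WB : Matrix (Fin p) (Fin n) ℂ) :
    (phsOperator P₁ H WB).graph = phsGraph P₁ H WB := by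
  refine Submodule.toLinearPMap_graph_eq _ ?_
  rintro ⟨x, y⟩ ⟨u, hu, hux, -, huy⟩ (rfl : x = 0)
  have hz : ∀ ξ, 0 < ξ → u ξ = 0 := hu.eq_zero_of_ae (by
    filter_upwards [hux, L2.coe_zero (w := H)] with ξ h1 h2
    rw [h1, h2]; simp)
  refine L2.ext_ae ?_
  have hpos : ∀ᵐ ξ ∂halfLine, 0 < ξ := by
    have h1 : ∀ᵐ ξ ∂halfLine, ξ ∈ Ici (0 : ℝ) := ae_restrict_mem measurableSet_Ici
    have h2 : ∀ᵐ ξ ∂halfLine, ξ ≠ (0 : ℝ) := Measure.ae_ne _ _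
    filter_upwards [h1, h2] with ξ a b
    exact lt_of_le_of_ne a b.symm
  filter_upwards [huy, hpos, L2.coe_zero (w := H)] with ξ h1 h2 h3
  obtain ⟨d, hd, h1⟩ := h1
  have h0 : HasDerivAt u 0 ξ := by
    refine (hasDerivAt_const ξ (0 : Fin n → ℂ)).congr_of_eventuallyEq ?_
    filter_upwards [lt_mem_nhds h2] with z hz' using hz z hz'
  change y ξ = _
  rw [h1, hd.unique h0, h3]
  simp

/-! ### The diagonalized setting -/

/-- `|Δ| = (Δ⋆Δ)^{1/2}` for diagonal `Δ`. -/
def absDiag (Δ : ℝ → Matrix (Fin n) (Fin n) ℂ) (ξ : ℝ) : Matrix (Fin n) (Fin n) ℂ :=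
  Matrix.diagonal fun i => ((‖Δ ξ i i‖ : ℝ) : ℂ)

/-- In the diagonalized setting, `|Δ|` is an admissible weight. -/
theorem isWeight_absDiag {P₁ : Matrix (Fin n) (Fin n) ℂ}
    {H Δ S : ℝ → Matrix (Fin n) (Fin n) ℂ} (hP₁u : IsUnit P₁)
    (hHpos : ∀ ξ, 0 ≤ ξ → (H ξ).PosDef) (hΔ : IsC1 Δ)
    (hΔd : ∀ ξ, 0 ≤ ξ → (Δ ξ).IsDiag)
    (hdiag : ∀ ξ, 0 ≤ ξ → P₁ * H ξ = (S ξ)⁻¹ * Δ ξ * S ξ) : IsWeight (absDiag Δ) := by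
  refine ⟨fun i j => ?_, fun ξ hξ => ?_⟩
  · by_cases h : i = j
    · subst h
      have e : (fun ξ => absDiag Δ ξ i i) = fun ξ => ((‖Δ ξ i i‖ : ℝ) : ℂ) := by
        funext ξ; simp [absDiag]
      rw [e]
      exact Complex.continuous_ofReal.comp_continuousOn (hΔ i i).continuousOn.norm
    · simpa [absDiag, Matrix.diagonal_apply_ne _ h] using continuousOn_const
  · refine Matrix.PosDef.diagonal fun i => ?_
    have hu : (Δ ξ).det ≠ 0 := by
      intro h0
      have h1 := congrArg Matrix.det (hdiag ξ hξ)
      rw [Matrix.det_mul, Matrix.det_mul, Matrix.det_mul, h0, mul_zero, zero_mul] at h1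
      have hP := ((Matrix.isUnit_iff_isUnit_det _).1 hP₁u).ne_zero
      have hH := ((Matrix.isUnit_iff_isUnit_det _).1 (hHpos ξ hξ).isUnit).ne_zero
      exact mul_ne_zero hP hH h1
    rw [← (hΔd ξ hξ).diagonal_diag, Matrix.det_diagonal] at hu
    have hi : Δ ξ i i ≠ 0 := (Finset.prod_ne_zero_iff.1 hu) i (Finset.mem_univ i)
    exact_mod_cast norm_pos_iff.2 hi

/-- The span of the eigenvectors of `M` that correspond to negative eigenvalues. -/
def negEigenspan (M : Matrix (Fin n) (Fin n) ℂ) : Submodule ℂ (Fin n → ℂ) :=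
  Submodule.span ℂ {v | ∃ r : ℝ, r < 0 ∧
    Module.End.HasEigenvector (Matrix.toLin' M) (r : ℂ) v}

/-- The block `U₂` of a `p × n` matrix `U`: the columns of `U` whose index belongs to a negative
diagonal entry of the diagonal matrix `D`. If `D = diag(Λ, Θ)` with positive `Λ` and negative `Θ`,
these are the last columns. -/
def negBlock (D : Matrix (Fin n) (Fin n) ℂ) (U : Matrix (Fin p) (Fin n) ℂ) :
    Matrix (Fin p) {i : Fin n // (D i i).re < 0} ℂ :=
  U.submatrix id Subtype.val

end PHS

end

/-! With `g = S x` the operator becomes `(Δ g)' + S (S⁻¹)' Δ g`. By (b) this substitution is an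
isomorphism and by (c) the second summand is bounded, so it does not affect generation. What remains
is a family of scalar transport equations, coupled only through the condition `W_B P₁⁻¹ S(0)⁻¹ φ(0)
= 0` on the boundary value of `φ = Δ g`. The speeds `Δ_ii` are real, have no zeros and keep their
signs. Waves of positive speed run towards `0` and leave; waves of negative speed enter at `0`.
Sylvester's law of inertia (`eigenvalues_mul_posDef`) gives exactly `n₋` entering components, so
`U₂` is square: it is the matrix with which these components appear in the boundary condition.

If `U₂` is invertible, the entering boundary values are a linear function of the leaving ones. The
real part of `⟨k, A k⟩` is minus half the sum of the signed squares of the boundary values. Giving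
the leaving components a large constant weight makes it nonpositive (`exists_weights_nonneg`), and
the resolvent equation is solved by variation of constants in each component. Thus the diagonal
operator is `m`-dissipative (`isMDissipative_transportRel`), and the Lumer–Phillips theorem
(`IsMDissipative.exists_semigroup`), bounded perturbation and similarity (`mem_phsGraph_iff`) give
the semigroup.

If `U₂` is not invertible, a kernel vector yields an admissible boundary value without leaving part.
Continued into the half-axis, it becomes an eigenvector of the diagonal operator for every `l > 0`
(`exists_eigenvector_transportRel`). A bounded perturbation of a generator has no large positive
eigenvalues (`HasGenerator.eigenvector_eq_zero`), so generation fails.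

The equivalence with (iii) is linear algebra: `S(0)` carries the negative eigenspan of `P₁ H(0)`
onto the coordinate space on which `U₂` acts (`map_negEigenspan_eq_top_iff`). -/

noncomputable section

namespace PHS

/-! ### Exponentials of bounded dissipative operators -/

section ExpSemigroup

variable {Y : Type*} [NormedAddCommGroup Y] [InnerProductSpace ℂ Y] [CompleteSpace Y]

/-- The uniformly continuous semigroup generated by a bounded operator. -/
def expSemigroup (A : Y →L[ℂ] Y) (t : ℝ) : Y →L[ℂ] Y := NormedSpace.exp ((t : ℂ) • A)

theorem expSemigroup_zero (A : Y →L[ℂ] Y) : expSemigroup A 0 = 1 := by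
  simp [expSemigroup]

theorem expSemigroup_zero_left (t : ℝ) : expSemigroup (0 : Y →L[ℂ] Y) t = 1 := by
  simp [expSemigroup]

theorem expSemigroup_add (A : Y →L[ℂ] Y) (s t : ℝ) :
    expSemigroup A (s + t) = expSemigroup A s * expSemigroup A t := by
  let _ : NormedAlgebra ℚ (Y →L[ℂ] Y) := NormedAlgebra.restrictScalars ℚ ℂ _
  have hc : Commute ((s : ℂ) • A) ((t : ℂ) • A) :=
    ((Commute.refl A).smul_left _).smul_right _
  rw [expSemigroup, Complex.ofReal_add, add_smul, NormedSpace.exp_add_of_commute hc]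
  rfl

theorem commute_expSemigroup {A B : Y →L[ℂ] Y} (h : Commute B A) (t : ℝ) :
    Commute B (expSemigroup A t) := by
  let _ : NormedAlgebra ℚ (Y →L[ℂ] Y) := NormedAlgebra.restrictScalars ℚ ℂ _
  exact (h.smul_right _).exp_right

theorem hasDerivAt_expSemigroup (A : Y →L[ℂ] Y) (t : ℝ) :
    HasDerivAt (expSemigroup A) (expSemigroup A t * A) t := by
  have h := (hasDerivAt_exp_smul_const (𝕂 := ℂ) A (t : ℂ)).scomp t
    (Complex.ofRealCLM.hasDerivAt (x := t))
  simpa [Function.comp_def, expSemigroup] using! h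

theorem hasDerivAt_expSemigroup_apply (A : Y →L[ℂ] Y) (x : Y) (t : ℝ) :
    HasDerivAt (fun s => expSemigroup A s x) (expSemigroup A t (A x)) t := by
  have h := (ContinuousLinearMap.apply ℂ Y x).hasFDerivAt (x := expSemigroup A t)
  exact (h.restrictScalars ℝ).comp_hasDerivAt t (hasDerivAt_expSemigroup A t)

/-- Along an orbit, the derivative of the squared norm is `2 Re ⟨u, A u⟩`, which is nonpositive. -/
theorem norm_expSemigroup_apply_le {A : Y →L[ℂ] Y} (hA : ∀ x, (inner ℂ x (A x)).re ≤ 0)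
    {t : ℝ} (ht : 0 ≤ t) (x : Y) : ‖expSemigroup A t x‖ ≤ ‖x‖ := by
  set u : ℝ → Y := fun s => expSemigroup A s x with hu
  have hd : ∀ s, HasDerivAt u (A (u s)) s := fun s => by
    have h := hasDerivAt_expSemigroup_apply A x s
    have e : expSemigroup A s (A x) = A (expSemigroup A s x) :=
      (congrArg (fun B : Y →L[ℂ] Y => B x) (commute_expSemigroup (Commute.refl A) s).eq).symm
    rwa [e] at h
  have hd2 : ∀ s, HasDerivAt (fun s => ‖u s‖ ^ 2) (2 * (inner ℂ (u s) (A (u s))).re) s := by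
    intro s
    have h := (hd s).inner ℂ (hd s)
    have h2 := (Complex.reCLM.hasFDerivAt (x := inner ℂ (u s) (u s))).comp_hasDerivAt s h
    have e : (fun s => ‖u s‖ ^ 2) = (Complex.reCLM ∘ fun t => inner ℂ (u t) (u t)) := by
      funext s
      simpa using! (inner_self_eq_norm_sq (𝕜 := ℂ) (u s)).symm
    have e2 : 2 * (inner ℂ (u s) (A (u s))).re
        = Complex.reCLM (inner ℂ (u s) (A (u s)) + inner ℂ (A (u s)) (u s)) := by
      have := inner_re_symm (𝕜 := ℂ) (u s) (A (u s))
      simp only [RCLike.re_to_complex] at this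
      rw [Complex.reCLM_apply, Complex.add_re, ← this, two_mul]
    rw [e, e2]
    exact h2
  have hanti : Antitone fun s => ‖u s‖ ^ 2 :=
    antitone_of_deriv_nonpos (fun s => (hd2 s).differentiableAt) fun s => by
      rw [(hd2 s).deriv]
      have := hA (u s)
      linarith
  have h := hanti ht
  simp only [hu, expSemigroup_zero] at h
  exact (sq_le_sq₀ (norm_nonneg _) (norm_nonneg _)).1 h

/-- The path `s ↦ exp((t - s) B) exp(s A) x` joins the two vectors. Since `A` and `B` commute, its
derivative is `exp((t - s) B) exp(s A) (A x - B x)`, and both exponentials are contractions. -/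
theorem norm_expSemigroup_sub_le {A B : Y →L[ℂ] Y} (hA : ∀ x, (inner ℂ x (A x)).re ≤ 0)
    (hB : ∀ x, (inner ℂ x (B x)).re ≤ 0) (hAB : Commute A B) {t : ℝ} (ht : 0 ≤ t) (x : Y) :
    ‖expSemigroup A t x - expSemigroup B t x‖ ≤ t * ‖A x - B x‖ := by
  set v : ℝ → Y := fun s => expSemigroup B (t - s) (expSemigroup A s x) with hv
  have hd : ∀ s, HasDerivAt v (expSemigroup B (t - s) (expSemigroup A s (A x - B x))) s := by
    intro s
    have h1 : HasDerivAt (fun s => expSemigroup B (t - s))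
        (-(expSemigroup B (t - s) * B)) s := by
      have := (hasDerivAt_expSemigroup B (t - s)).scomp s ((hasDerivAt_id s).const_sub t)
      simpa [Function.comp_def] using! this
    have h2 := hasDerivAt_expSemigroup_apply A x s
    -- The product rule is applied over `ℝ`, the field of the time variable, so the operators are
    -- regarded as real-linear.
    have h1' : HasDerivAt (fun s => (expSemigroup B (t - s)).restrictScalars ℝ)
        ((-(expSemigroup B (t - s) * B)).restrictScalars ℝ) s :=
      (ContinuousLinearMap.restrictScalarsL ℂ Y Y ℝ ℝ).hasFDerivAt.comp_hasDerivAt s h1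
    have h3 := h1'.clm_apply h2
    have e : B (expSemigroup A s x) = expSemigroup A s (B x) :=
      congrArg (fun B : Y →L[ℂ] Y => B x) (commute_expSemigroup hAB.symm s).eq
    have e2 : expSemigroup B (t - s) (expSemigroup A s (A x - B x))
        = -(expSemigroup B (t - s) (B (expSemigroup A s x)))
          + expSemigroup B (t - s) (expSemigroup A s (A x)) := by
      rw [e, map_sub, map_sub, sub_eq_neg_add]
    rw [e2]
    exact h3
  have hb := norm_image_sub_le_of_norm_deriv_le_segment' (f := v) (a := 0) (b := t)
    (C := ‖A x - B x‖) (fun s _ => (hd s).hasDerivWithinAt) (fun s hs =>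
      (norm_expSemigroup_apply_le hB (by linarith [hs.2]) _).trans
        (norm_expSemigroup_apply_le hA hs.1 _)) t ⟨ht, le_rfl⟩
  simpa [hv, expSemigroup_zero, mul_comm] using hb

theorem norm_expSemigroup_sub_self_le {A : Y →L[ℂ] Y} (hA : ∀ x, (inner ℂ x (A x)).re ≤ 0)
    {t : ℝ} (ht : 0 ≤ t) (x : Y) : ‖expSemigroup A t x - x‖ ≤ t * ‖A x‖ := by
  simpa [expSemigroup_zero_left] using
    norm_expSemigroup_sub_le (B := 0) hA (by simp) (Commute.zero_right A) ht x

/-- A first-order Taylor estimate: `exp(s A) x - s A x` has derivative `exp(s A) A x - A x`. It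
involves `A` only through its value at `x`, so it survives the limit over the Yosida approximations.
-/
theorem norm_expSemigroup_sub_sub_le {A : Y →L[ℂ] Y} {t C : ℝ} (ht : 0 ≤ t) (x : Y)
    (hC : ∀ s ∈ Ico 0 t, ‖expSemigroup A s (A x) - A x‖ ≤ C) :
    ‖expSemigroup A t x - x - (t : ℂ) • A x‖ ≤ t * C := by
  have hd : ∀ s : ℝ, HasDerivAt (fun s : ℝ => expSemigroup A s x - (s : ℂ) • A x)
      (expSemigroup A s (A x) - A x) s := by
    intro s
    have h := (Complex.ofRealCLM.hasDerivAt (x := s)).smul_const (A x)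
    simp only [Complex.ofRealCLM_apply, Complex.ofReal_one, one_smul] at h
    exact (hasDerivAt_expSemigroup_apply A x s).sub h
  have hb := norm_image_sub_le_of_norm_deriv_le_segment' (a := 0) (b := t)
    (C := C) (fun s _ => (hd s).hasDerivWithinAt) hC t ⟨ht, le_rfl⟩
  rw [mul_comm]
  simpa [expSemigroup_zero, sub_right_comm] using hb

end ExpSemigroup

/-! ### Generation of contraction semigroups by `m`-dissipative relations -/

/-- `(x, y)` lies in the graph of the generator of `T`. -/
def HasGenerator {X : Type*} [NormedAddCommGroup X] [NormedSpace ℂ X] (T : ℝ → X →L[ℂ] X)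
    (Γ : Submodule ℂ (X × X)) : Prop :=
  ∀ x y : X, (x, y) ∈ Γ ↔
    Tendsto (fun t : ℝ => ((t⁻¹ : ℝ) : ℂ) • (T t x - x)) (𝓝[>] 0) (𝓝 y)

/-- A linear relation in a Hilbert space is `m`-dissipative. -/
structure IsMDissipative {Y : Type*} [NormedAddCommGroup Y] [InnerProductSpace ℂ Y]
    (Γ : Submodule ℂ (Y × Y)) : Prop where
  dissipative : ∀ p ∈ Γ, (inner ℂ p.1 p.2).re ≤ 0
  range : ∀ l : ℝ, 0 < l → ∀ f : Y, ∃ p ∈ Γ, (l : ℂ) • p.1 - p.2 = f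
  singleValued : ∀ y, ((0 : Y), y) ∈ Γ → y = 0

section MDissipative

variable {Y : Type*} [NormedAddCommGroup Y] [InnerProductSpace ℂ Y] {Γ : Submodule ℂ (Y × Y)}

/-- Cauchy–Schwarz for `Re ⟨x, l x - y⟩ = l ‖x‖² - Re ⟨x, y⟩ ≥ l ‖x‖²`. -/
theorem mul_norm_le_of_dissipative {x y : Y} (h : (inner ℂ x y).re ≤ 0) (l : ℝ) :
    l * ‖x‖ ≤ ‖(l : ℂ) • x - y‖ := by
  rcases eq_or_ne x 0 with rfl | hx
  · simp
  have hpos : 0 < ‖x‖ := norm_pos_iff.2 hx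
  have h1 : (inner ℂ x ((l : ℂ) • x - y)).re = l * ‖x‖ ^ 2 - (inner ℂ x y).re := by
    have := inner_self_eq_norm_sq (𝕜 := ℂ) x
    simp only [RCLike.re_to_complex] at this
    rw [inner_sub_right, inner_smul_right, Complex.sub_re, Complex.re_ofReal_mul, this]
  have h2 : (inner ℂ x ((l : ℂ) • x - y)).re ≤ ‖x‖ * ‖(l : ℂ) • x - y‖ :=
    (Complex.re_le_norm _).trans (norm_inner_le_norm _ _)
  nlinarith

/-- The lower bound of `mul_norm_le_of_dissipative` makes the solution of `l x - y = f` unique.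
Uniqueness turns the chosen solutions into a linear map, and the same bound gives its norm estimate.
-/
theorem IsMDissipative.exists_resolvent (h : IsMDissipative Γ) {l : ℝ} (hl : 0 < l) :
    ∃ R : Y →L[ℂ] Y, (∀ f, (R f, (l : ℂ) • R f - f) ∈ Γ) ∧
      (∀ p ∈ Γ, R ((l : ℂ) • p.1 - p.2) = p.1) ∧ ∀ f, l * ‖R f‖ ≤ ‖f‖ := by
  choose p hp hpf using h.range l hl
  have huniq : ∀ q ∈ Γ, ∀ r ∈ Γ, (l : ℂ) • q.1 - q.2 = (l : ℂ) • r.1 - r.2 → q.1 = r.1 := by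
    intro q hq r hr e
    have h1 := mul_norm_le_of_dissipative (h.dissipative _ (Γ.sub_mem hq hr)) l
    have h2 : (l : ℂ) • (q - r).1 - (q - r).2 = 0 := by
      rw [Prod.fst_sub, Prod.snd_sub, smul_sub, sub_sub_sub_comm, e, sub_self]
    rw [h2, norm_zero] at h1
    have h3 : ‖(q - r).1‖ ≤ 0 := by
      by_contra! hc
      nlinarith [mul_pos hl hc]
    exact sub_eq_zero.1 (norm_le_zero_iff.1 h3)
  let R₀ : Y →ₗ[ℂ] Y :=
    { toFun := fun f => (p f).1
      map_add' := fun f g => huniq _ (hp _) _ (Γ.add_mem (hp f) (hp g)) (by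
        rw [hpf, Prod.fst_add, Prod.snd_add, smul_add, add_sub_add_comm, hpf, hpf])
      map_smul' := fun c f => huniq _ (hp _) _ (Γ.smul_mem c (hp f)) (by
        rw [hpf, Prod.smul_fst, Prod.smul_snd, smul_comm, ← smul_sub, hpf]) }
  have hbd : ∀ f, l * ‖R₀ f‖ ≤ ‖f‖ := fun f => by
    have := mul_norm_le_of_dissipative (h.dissipative _ (hp f)) l
    rwa [hpf] at this
  refine ⟨R₀.mkContinuous l⁻¹ fun f => ?_, fun f => ?_, fun q hq => ?_, hbd⟩
  · rw [inv_mul_eq_div, le_div_iff₀' hl]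
    exact hbd f
  · have e : (l : ℂ) • (p f).1 - f = (p f).2 := by
      rw [sub_eq_iff_eq_add, ← sub_eq_iff_eq_add', hpf]
    change ((p f).1, (l : ℂ) • (p f).1 - f) ∈ Γ
    rw [e]
    exact hp f
  · exact huniq _ (hp _) _ hq (hpf _)

variable [CompleteSpace Y]

/-- Let `z` be orthogonal to the domain and write `z = x - y` with `(x, y)` in the relation. Then `0
= Re ⟨x, z⟩ ≥ ‖x‖²`, so `x = 0`; single-valuedness gives `y = 0`. -/
theorem IsMDissipative.dense_domain (h : IsMDissipative Γ) :
    Dense {x : Y | ∃ y, (x, y) ∈ Γ} := by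
  have e : {x : Y | ∃ y, (x, y) ∈ Γ} = (Γ.map (LinearMap.fst ℂ Y Y) : Set Y) := by
    ext x
    simp
  rw [e, Submodule.dense_iff_topologicalClosure_eq_top,
    Submodule.topologicalClosure_eq_top_iff, Submodule.eq_bot_iff]
  intro z hz
  obtain ⟨p, hp, hpz⟩ := h.range 1 one_pos z
  have h0 : inner ℂ p.1 z = 0 := hz p.1 ⟨p, hp, rfl⟩
  have h1 := h.dissipative p hp
  have h2 : (inner ℂ p.1 z).re = ‖p.1‖ ^ 2 - (inner ℂ p.1 p.2).re := by
    have := inner_self_eq_norm_sq (𝕜 := ℂ) p.1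
    simp only [RCLike.re_to_complex] at this
    rw [← hpz, inner_sub_right, Complex.ofReal_one, one_smul, Complex.sub_re, this]
  rw [h0, Complex.zero_re] at h2
  have h3 : p.1 = 0 := by
    rw [← norm_eq_zero, ← sq_eq_zero_iff]
    nlinarith [sq_nonneg ‖p.1‖]
  have h4 : p.2 = 0 := h.singleValued _ (h3 ▸ hp)
  rw [← hpz, h3, h4, smul_zero, sub_zero]

/-- The Yosida approximations of an `m`-dissipative relation: pairwise commuting, bounded,
dissipative, and strongly convergent on the domain. -/
theorem IsMDissipative.exists_yosida (h : IsMDissipative Γ) :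
    ∃ A : ℕ → Y →L[ℂ] Y, (∀ k x, (inner ℂ x (A k x)).re ≤ 0) ∧ (∀ j k, Commute (A j) (A k)) ∧
      (∀ p ∈ Γ, ∀ k, ‖A k p.1‖ ≤ ‖p.2‖) ∧
      ∀ p ∈ Γ, Tendsto (fun k => A k p.1) atTop (𝓝 p.2) := by
  have hpos : ∀ k : ℕ, (0 : ℝ) < (k : ℝ) + 1 := fun k => by positivity
  choose R hR hRinv hRb using fun k : ℕ => h.exists_resolvent (hpos k)
  set l : ℕ → ℝ := fun k => (k : ℝ) + 1 with hl
  have hRcomm : ∀ j k, Commute (R j) (R k) := by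
    intro j k
    refine ContinuousLinearMap.ext fun f => ?_
    change R j (R k f) = R k (R j f)
    rcases eq_or_ne j k with rfl | hjk
    · rfl
    -- The resolvent identity, obtained by applying `R m` to `(l m) x - y` for the graph element
    -- `(x, y)` supplied by `R i f`. Exchanging the two indices gives commutativity.
    have key : ∀ i m : ℕ, ((l m : ℂ) - l i) • R m (R i f) + R m f = R i f := fun i m => by
      rw [← map_smul, ← map_add, sub_smul]
      rw [show ((l m : ℂ) • R i f - (l i : ℂ) • R i f + f : Y)
        = (l m : ℂ) • R i f - ((l i : ℂ) • R i f - f) by abel]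
      exact hRinv m _ (hR i f)
    have h1 := key j k
    have h2 := key k j
    have hne : (l k : ℂ) - l j ≠ 0 := by
      rw [← Complex.ofReal_sub, Complex.ofReal_ne_zero, sub_ne_zero, hl]
      intro hc
      exact hjk (by exact_mod_cast (add_right_cancel hc).symm)
    refine smul_right_injective Y hne ?_
    change ((l k : ℂ) - l j) • R j (R k f) = ((l k : ℂ) - l j) • R k (R j f)
    rw [eq_sub_of_add_eq h1, ← neg_sub (l j : ℂ) (l k), neg_smul, eq_sub_of_add_eq h2, neg_sub]
  -- On the domain, `l R z - z = R z'` is of order `1 / l`. As the operators `l R` are contractions,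
  -- density of the domain extends the convergence to all vectors.
  have hRtend : ∀ y, Tendsto (fun k => (l k : ℂ) • R k y) atTop (𝓝 y) := by
    intro y
    rw [Metric.tendsto_atTop]
    intro ε hε
    obtain ⟨z, ⟨z', hz⟩, hyz⟩ := h.dense_domain.exists_dist_lt y (half_pos (half_pos hε))
    obtain ⟨N, hN⟩ := exists_nat_gt (2 * ‖z'‖ / ε)
    refine ⟨N, fun k hk => ?_⟩
    have hlR : ∀ x, ‖(l k : ℂ) • R k x‖ ≤ ‖x‖ := fun x => by
      rw [norm_smul, Complex.norm_real, Real.norm_of_nonneg (hpos k).le]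
      exact hRb k x
    have e1 : (l k : ℂ) • R k z - z = R k z' := by
      have := hRinv k _ hz
      rw [map_sub, map_smul] at this
      simp only at this
      rw [sub_eq_iff_eq_add, ← sub_eq_iff_eq_add', this]
    have e2 : (l k : ℂ) • R k y - y
        = (l k : ℂ) • R k (y - z) + ((l k : ℂ) • R k z - z) + (z - y) := by
      rw [map_sub, smul_sub]; abel
    have h3 : ‖R k z'‖ < ε / 2 := by
      have h4 := hRb k z'
      have h5 : 2 * ‖z'‖ / ε < l k := hN.trans_le (by
        have : (N : ℝ) ≤ k := by exact_mod_cast hk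
        simp only [hl]; linarith)
      rw [div_lt_iff₀ hε] at h5
      by_contra! hc
      nlinarith [mul_le_mul_of_nonneg_left hc (hpos k).le]
    rw [dist_eq_norm] at hyz
    have hyz' : ‖z - y‖ < ε / 2 / 2 := by rwa [norm_sub_rev]
    rw [dist_eq_norm, e2, e1]
    calc _ ≤ ‖(l k : ℂ) • R k (y - z)‖ + ‖R k z'‖ + ‖z - y‖ := norm_add₃_le
      _ < ε := by linarith [hlR (y - z)]
  -- The Yosida approximation `l² R - l` agrees on the domain with `l R` after the operator. Hence
  -- it is bounded there by the norm of the value, and convergent by `hRtend`.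
  have hAR : ∀ p ∈ Γ, ∀ k, (((l k : ℂ) ^ 2) • R k - (l k : ℂ) • 1 : Y →L[ℂ] Y) p.1
      = (l k : ℂ) • R k p.2 := by
    intro p hp k
    have := hRinv k p hp
    rw [map_sub, map_smul, sub_eq_iff_eq_add] at this
    change ((l k : ℂ) ^ 2) • R k p.1 - (l k : ℂ) • p.1 = _
    rw [sq, mul_smul, this, smul_add, add_sub_cancel_left]
  refine ⟨fun k => ((l k : ℂ) ^ 2) • R k - (l k : ℂ) • 1, fun k x => ?_, fun j k => ?_, ?_, ?_⟩
  · have h1 : (inner ℂ x (R k x)).re ≤ ‖x‖ * ‖R k x‖ :=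
      (Complex.re_le_norm _).trans (norm_inner_le_norm _ _)
    have h2 := inner_self_eq_norm_sq (𝕜 := ℂ) x
    simp only [RCLike.re_to_complex] at h2
    have e : (inner ℂ x ((((l k : ℂ) ^ 2) • R k - (l k : ℂ) • 1 : Y →L[ℂ] Y) x)).re
        = l k ^ 2 * (inner ℂ x (R k x)).re - l k * ‖x‖ ^ 2 := by
      rw [← h2, ← Complex.ofReal_pow]
      simp only [sub_apply, smul_apply,
        one_apply_eq_self, inner_sub_right, inner_smul_right, Complex.sub_re,
        Complex.re_ofReal_mul]
    rw [e]
    have h3 := hRb k x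
    have h4 : l k * (l k * (inner ℂ x (R k x)).re) ≤ l k * (‖x‖ * ‖x‖) := by
      refine mul_le_mul_of_nonneg_left ?_ (hpos k).le
      calc l k * (inner ℂ x (R k x)).re ≤ l k * (‖x‖ * ‖R k x‖) :=
            mul_le_mul_of_nonneg_left h1 (hpos k).le
        _ = ‖x‖ * (l k * ‖R k x‖) := by ring
        _ ≤ ‖x‖ * ‖x‖ := mul_le_mul_of_nonneg_left h3 (norm_nonneg _)
    nlinarith
  · have h1 : ∀ (B : Y →L[ℂ] Y) (c : ℂ), Commute (c • (1 : Y →L[ℂ] Y)) B := fun B c =>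
      (Commute.one_left B).smul_left c
    refine Commute.sub_left (Commute.sub_right ?_ (h1 _ _).symm) (h1 _ _)
    exact ((hRcomm j k).smul_left _).smul_right _
  · intro p hp k
    rw [hAR p hp k, norm_smul, Complex.norm_real, Real.norm_of_nonneg (hpos k).le]
    exact hRb k _
  · intro p hp
    simp only [hAR p hp]
    exact hRtend _

/-- **Lumer–Phillips theorem** in a Hilbert space: an `m`-dissipative operator generates a
contraction semigroup. -/
theorem IsMDissipative.exists_semigroup (h : IsMDissipative Γ) :
    ∃ T : ℝ → Y →L[ℂ] Y, IsC0Semigroup T ∧ HasGenerator T Γ := by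
  obtain ⟨A, hA, hcomm, hbd, htend⟩ := h.exists_yosida
  have hAc : ∀ k t, 0 ≤ t → ∀ x, ‖expSemigroup (A k) t x‖ ≤ ‖x‖ := fun k t ht x =>
    norm_expSemigroup_apply_le (hA k) ht x
  -- pointwise convergence
  have hcauchy : ∀ t : ℝ, 0 ≤ t → ∀ x, CauchySeq fun k => expSemigroup (A k) t x := by
    intro t ht x
    rw [Metric.cauchySeq_iff']
    intro ε hε
    obtain ⟨z, ⟨z', hz⟩, hxz⟩ := h.dense_domain.exists_dist_lt x (show 0 < ε / 3 by positivity)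
    have hc := (htend _ hz).cauchySeq
    rw [Metric.cauchySeq_iff'] at hc
    obtain ⟨N, hN⟩ := hc (ε / (3 * (t + 1))) (by positivity)
    refine ⟨N, fun k hk => ?_⟩
    have h1 := norm_expSemigroup_sub_le (hA k) (hA N) (hcomm k N) ht z
    have h2 := hN k hk
    rw [dist_eq_norm] at h2 hxz ⊢
    have e : expSemigroup (A k) t x - expSemigroup (A N) t x
        = expSemigroup (A k) t (x - z) + (expSemigroup (A k) t z - expSemigroup (A N) t z)
          - expSemigroup (A N) t (x - z) := by
      rw [map_sub, map_sub]; abel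
    have h3 : t * ‖A k z - A N z‖ ≤ ε / 3 := by
      calc t * ‖A k z - A N z‖ ≤ (t + 1) * (ε / (3 * (t + 1))) := by
            gcongr
            linarith
        _ = ε / 3 := by field_simp
    rw [e]
    calc _ ≤ ‖expSemigroup (A k) t (x - z)‖ + ‖expSemigroup (A k) t z - expSemigroup (A N) t z‖
          + ‖expSemigroup (A N) t (x - z)‖ := norm_sub_le_of_le (norm_add_le _ _) le_rfl
      _ < ε := by linarith [hAc k t ht (x - z), hAc N t ht (x - z)]
  have hex : ∀ t : ℝ, ∃ T : Y →L[ℂ] Y, 0 ≤ t →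
      ∀ x, Tendsto (fun k => expSemigroup (A k) t x) atTop (𝓝 (T x)) := by
    intro t
    by_cases ht : 0 ≤ t
    · choose f hf using fun x => cauchySeq_tendsto_of_complete (hcauchy t ht x)
      exact ⟨continuousLinearMapOfTendsto (fun k => expSemigroup (A k) t)
        (tendsto_pi_nhds.2 hf), fun _ => hf⟩
    · exact ⟨0, fun h => absurd h ht⟩
  choose T hT using hex
  have hTc : ∀ t, 0 ≤ t → ∀ x, ‖T t x‖ ≤ ‖x‖ := fun t ht x =>
    le_of_tendsto' (hT t ht x).norm fun k => hAc k t ht x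
  have hT0 : T 0 = ContinuousLinearMap.id ℂ Y := by
    refine ContinuousLinearMap.ext fun x => tendsto_nhds_unique (hT 0 le_rfl x) ?_
    simp only [expSemigroup_zero]
    exact tendsto_const_nhds
  have hTadd : ∀ s t, 0 ≤ s → 0 ≤ t → T (s + t) = (T s).comp (T t) := by
    intro s t hs ht
    refine ContinuousLinearMap.ext fun x => tendsto_nhds_unique (hT _ (add_nonneg hs ht) x) ?_
    have h1 := hT s hs (T t x)
    have h2 : Tendsto (fun k => expSemigroup (A k) s (expSemigroup (A k) t x - T t x)) atTop
        (𝓝 0) := by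
      refine squeeze_zero_norm (fun k => hAc k s hs _) ?_
      exact tendsto_iff_norm_sub_tendsto_zero.1 (hT t ht x)
    have h3 := h2.add h1
    rw [zero_add] at h3
    refine h3.congr fun k => ?_
    rw [← map_add, sub_add_cancel, expSemigroup_add]
    rfl
  have hTlip : ∀ t, 0 ≤ t → ∀ p ∈ Γ, ‖T t p.1 - p.1‖ ≤ t * ‖p.2‖ := by
    intro t ht p hp
    refine le_of_tendsto' ((hT t ht p.1).sub_const p.1).norm fun k => ?_
    exact (norm_expSemigroup_sub_self_le (hA k) ht p.1).trans
      (mul_le_mul_of_nonneg_left (hbd p hp k) ht)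
  have hTzero : ∀ x, Tendsto (fun t => ‖T t x - x‖) (𝓝[≥] 0) (𝓝 0) := by
    intro x
    rw [Metric.tendsto_nhdsWithin_nhds]
    intro ε hε
    obtain ⟨z, ⟨z', hz⟩, hxz⟩ := h.dense_domain.exists_dist_lt x (show 0 < ε / 3 by positivity)
    refine ⟨ε / (3 * (‖z'‖ + 1)), by positivity, fun t ht htd => ?_⟩
    have ht0 : 0 ≤ t := ht
    rw [Real.dist_eq, sub_zero, abs_of_nonneg ht0] at htd
    rw [Real.dist_eq, sub_zero, abs_norm]
    rw [dist_eq_norm] at hxz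
    have hzx : ‖z - x‖ < ε / 3 := by rwa [norm_sub_rev]
    have e : T t x - x = T t (x - z) + (T t z - z) + (z - x) := by rw [map_sub]; abel
    have h1 := hTlip t ht0 _ hz
    have h2 : t * ‖z'‖ ≤ ε / 3 := by
      calc t * ‖z'‖ ≤ (ε / (3 * (‖z'‖ + 1))) * (‖z'‖ + 1) := by
            gcongr
            linarith
        _ = ε / 3 := by field_simp
    rw [e]
    calc _ ≤ ‖T t (x - z)‖ + ‖T t z - z‖ + ‖z - x‖ := norm_add₃_le
      _ < ε := by linarith [hTc t ht0 (x - z)]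
  have hTcont : ∀ x, ContinuousOn (fun t => T t x) (Ici 0) := by
    intro x t ht
    have ht0 : 0 ≤ t := ht
    rw [ContinuousWithinAt, tendsto_iff_norm_sub_tendsto_zero]
    -- Factoring out the operator of the smaller time, a contraction, bounds `‖T s x - T t x‖` by
    -- `‖T |s - t| x - x‖`. Continuity thus reduces to right continuity at `0`.
    have h2 : Tendsto (fun s : ℝ => |s - t|) (𝓝[Ici 0] t) (𝓝[≥] 0) := by
      refine tendsto_nhdsWithin_iff.2 ⟨?_, Eventually.of_forall fun s => abs_nonneg (s - t)⟩
      have : Continuous fun s : ℝ => |s - t| := by fun_prop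
      simpa using (this.tendsto t).mono_left nhdsWithin_le_nhds
    refine squeeze_zero' (Eventually.of_forall fun _ => norm_nonneg _) ?_ ((hTzero x).comp h2)
    filter_upwards [self_mem_nhdsWithin] with s hs
    have hs0 : 0 ≤ s := hs
    simp only [Function.comp_apply]
    rcases le_total t s with hts | hts
    · have e : T s = (T t).comp (T (s - t)) := by
        rw [← hTadd _ _ ht0 (sub_nonneg.2 hts), add_sub_cancel]
      rw [e, abs_of_nonneg (sub_nonneg.2 hts), ContinuousLinearMap.comp_apply, ← map_sub]
      exact hTc t ht0 _
    · have e : T t = (T s).comp (T (t - s)) := by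
        rw [← hTadd _ _ hs0 (sub_nonneg.2 hts), add_sub_cancel]
      rw [e, abs_sub_comm, abs_of_nonneg (sub_nonneg.2 hts), ContinuousLinearMap.comp_apply,
        ← map_sub, norm_sub_rev (T (t - s) x)]
      exact hTc s hs0 _
  -- The vector `p.2` need not lie in the domain, so it is compared with a domain vector `q.1`, on
  -- which the semigroup is Lipschitz. By density `q.1` can later be taken close to `p.2`.
  have hTsecond : ∀ p ∈ Γ, ∀ q ∈ Γ, ∀ t, 0 ≤ t →
      ‖T t p.1 - p.1 - (t : ℂ) • p.2‖ ≤ t * (2 * ‖p.2 - q.1‖ + t * ‖q.2‖) := by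
    intro p hp q hq t ht
    have h1 : Tendsto (fun k => t * (2 * ‖A k p.1 - p.2‖ + (2 * ‖p.2 - q.1‖ + t * ‖q.2‖))) atTop
        (𝓝 (t * (2 * 0 + (2 * ‖p.2 - q.1‖ + t * ‖q.2‖)))) :=
      ((((tendsto_iff_norm_sub_tendsto_zero.1 (htend p hp)).const_mul 2).add_const _).const_mul t)
    rw [mul_zero, zero_add] at h1
    refine le_of_tendsto_of_tendsto' ((((hT t ht p.1).sub_const p.1).sub
      ((htend p hp).const_smul (t : ℂ))).norm) h1 fun k => ?_
    refine norm_expSemigroup_sub_sub_le ht p.1 fun s hs => ?_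
    have e : expSemigroup (A k) s (A k p.1) - A k p.1
        = (expSemigroup (A k) s (A k p.1 - q.1) - (A k p.1 - q.1))
          + (expSemigroup (A k) s q.1 - q.1) := by
      rw [map_sub]; abel
    have h2 : ‖expSemigroup (A k) s (A k p.1 - q.1) - (A k p.1 - q.1)‖
        ≤ 2 * (‖A k p.1 - p.2‖ + ‖p.2 - q.1‖) := by
      have h3 := hAc k s hs.1 (A k p.1 - q.1)
      have h4 : ‖A k p.1 - q.1‖ ≤ ‖A k p.1 - p.2‖ + ‖p.2 - q.1‖ :=
        norm_sub_le_norm_sub_add_norm_sub _ _ _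
      linarith [norm_sub_le (expSemigroup (A k) s (A k p.1 - q.1)) (A k p.1 - q.1)]
    have h5 : ‖expSemigroup (A k) s q.1 - q.1‖ ≤ t * ‖q.2‖ :=
      (norm_expSemigroup_sub_self_le (hA k) hs.1 q.1).trans
        (mul_le_mul hs.2.le (hbd q hq k) (norm_nonneg _) ht)
    rw [e]
    linarith [norm_add_le (expSemigroup (A k) s (A k p.1 - q.1) - (A k p.1 - q.1))
      (expSemigroup (A k) s q.1 - q.1)]
  have hgen : ∀ p ∈ Γ, Tendsto (fun t : ℝ => ((t⁻¹ : ℝ) : ℂ) • (T t p.1 - p.1)) (𝓝[>] 0)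
      (𝓝 p.2) := by
    intro p hp
    rw [Metric.tendsto_nhdsWithin_nhds]
    intro ε hε
    obtain ⟨z, ⟨z', hz⟩, hxz⟩ :=
      h.dense_domain.exists_dist_lt p.2 (show 0 < ε / 4 by positivity)
    refine ⟨ε / (2 * (‖z'‖ + 1)), by positivity, fun t ht htd => ?_⟩
    have ht0 : 0 < t := ht
    rw [Real.dist_eq, sub_zero, abs_of_pos ht0] at htd
    rw [dist_eq_norm] at hxz ⊢
    have h1 := hTsecond p hp _ hz t ht0.le
    have htc : (t : ℂ) ≠ 0 := by exact_mod_cast ht0.ne'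
    have e : ((t⁻¹ : ℝ) : ℂ) • (T t p.1 - p.1) - p.2
        = ((t⁻¹ : ℝ) : ℂ) • (T t p.1 - p.1 - (t : ℂ) • p.2) := by
      rw [smul_sub _ (T t p.1 - p.1), smul_smul, Complex.ofReal_inv, inv_mul_cancel₀ htc, one_smul]
    rw [e, norm_smul, Complex.norm_real, Real.norm_of_nonneg (inv_pos.2 ht0).le,
      inv_mul_lt_iff₀ ht0]
    refine h1.trans_lt (mul_lt_mul_of_pos_left ?_ ht0)
    have h2 : t * ‖z'‖ ≤ ε / 2 := by
      calc t * ‖z'‖ ≤ (ε / (2 * (‖z'‖ + 1))) * (‖z'‖ + 1) := by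
            gcongr
            linarith
        _ = ε / 2 := by field_simp
    simp only
    linarith
  refine ⟨T, ⟨hT0, hTadd, hTcont⟩, fun x y => ⟨fun hxy => hgen _ hxy, fun hxy => ?_⟩⟩
  -- The generator extends `Γ`, and `1 - Γ` is already onto. With this `p`, the vector `x - p.1` is
  -- fixed by the generator, which is impossible for a contraction semigroup unless it vanishes.
  obtain ⟨p, hp, hpxy⟩ := h.range 1 one_pos (x - y)
  rw [Complex.ofReal_one, one_smul] at hpxy
  have hv : Tendsto (fun t : ℝ => ((t⁻¹ : ℝ) : ℂ) • (T t (x - p.1) - (x - p.1))) (𝓝[>] 0)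
      (𝓝 (x - p.1)) := by
    have e : x - p.1 = y - p.2 := by
      rw [sub_eq_sub_iff_sub_eq_sub, hpxy]
    nth_rewrite 3 [e]
    refine (hxy.sub (hgen p hp)).congr fun t => ?_
    rw [← smul_sub, map_sub, sub_sub_sub_comm]
  have hle : ‖x - p.1‖ ≤ 0 := by
    refine ge_of_tendsto (tendsto_iff_norm_sub_tendsto_zero.1 hv) ?_
    filter_upwards [self_mem_nhdsWithin] with t ht
    have ht0 : 0 < t := ht
    have htc : (t : ℂ) ≠ 0 := by exact_mod_cast ht0.ne'
    generalize x - p.1 = v at hv ⊢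
    set q := ((t⁻¹ : ℝ) : ℂ) • (T t v - v) with hq
    have e1 : T t v = v + (t : ℂ) • q := by
      rw [hq, smul_smul, Complex.ofReal_inv, mul_inv_cancel₀ htc, one_smul, add_sub_cancel]
    -- Taking norms gives `(1 + t) ‖v‖ ≤ ‖v‖ + t ‖q - v‖`, that is `‖v‖ ≤ ‖q - v‖`, and the right
    -- side tends to `0`.
    have e2 : ((1 + t : ℝ) : ℂ) • v = T t v - (t : ℂ) • (q - v) := by
      rw [e1, smul_sub, Complex.ofReal_add, Complex.ofReal_one, add_smul, one_smul]
      abel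
    have h1 := congrArg norm e2
    rw [norm_smul, Complex.norm_real, Real.norm_of_nonneg (by linarith)] at h1
    have h2 := norm_sub_le (T t v) ((t : ℂ) • (q - v))
    rw [norm_smul, Complex.norm_real, Real.norm_of_nonneg ht0.le] at h2
    have h3 := hTc t ht0.le v
    by_contra! hc
    nlinarith [mul_lt_mul_of_pos_left hc ht0]
  have hx : x = p.1 := sub_eq_zero.1 (norm_le_zero_iff.1 hle)
  have hy : y = p.2 := by
    rw [hx] at hpxy
    exact (sub_right_injective hpxy).symm
  rw [hx, hy]
  exact hp

end MDissipative

/-! ### Perturbation, rescaling and similarity -/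

section Perturbation

variable {Y : Type*} [NormedAddCommGroup Y] [InnerProductSpace ℂ Y] {Γ : Submodule ℂ (Y × Y)}

/-- The sum of a linear relation and a bounded operator. -/
def perturb (Γ : Submodule ℂ (Y × Y)) (B : Y →L[ℂ] Y) : Submodule ℂ (Y × Y) :=
  Γ.comap ((LinearMap.fst ℂ Y Y).prod
    (LinearMap.snd ℂ Y Y - (B : Y →ₗ[ℂ] Y) ∘ₗ LinearMap.fst ℂ Y Y))

theorem mem_perturb {B : Y →L[ℂ] Y} {x y : Y} : (x, y) ∈ perturb Γ B ↔ (x, y - B x) ∈ Γ :=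
  Iff.rfl

variable [CompleteSpace Y]

/-- Subtracting `‖B‖` compensates the largest possible growth caused by `B`, so dissipativity is
kept and no smallness of `B` is needed. -/
theorem IsMDissipative.perturb_sub_norm (h : IsMDissipative Γ) (B : Y →L[ℂ] Y) :
    IsMDissipative (perturb Γ (B - (‖B‖ : ℂ) • 1)) where
  dissipative := by
    rintro ⟨x, y⟩ hxy
    have h1 := h.dissipative _ (mem_perturb.1 hxy)
    have h2 : (inner ℂ x (B x)).re ≤ ‖B‖ * ‖x‖ ^ 2 :=
      calc (inner ℂ x (B x)).re ≤ ‖x‖ * ‖B x‖ :=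
            (Complex.re_le_norm _).trans (norm_inner_le_norm _ _)
        _ ≤ ‖x‖ * (‖B‖ * ‖x‖) := by gcongr; exact B.le_opNorm x
        _ = ‖B‖ * ‖x‖ ^ 2 := by ring
    have h3 := inner_self_eq_norm_sq (𝕜 := ℂ) x
    simp only [RCLike.re_to_complex] at h3
    simp only [sub_apply, smul_apply,
      one_apply_eq_self, inner_sub_right, inner_smul_right, Complex.sub_re,
      Complex.re_ofReal_mul, h3] at h1
    simp only
    linarith
  range := by
    intro l hl f
    have hlb : 0 < l + ‖B‖ := add_pos_of_pos_of_nonneg hl (norm_nonneg _)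
    obtain ⟨R, hR, -, hRb⟩ := h.exists_resolvent hlb
    -- The equation to be solved reads `((l + ‖B‖) - Γ) x = f + B x`. The resolvent at `l + ‖B‖`
    -- turns it into a fixed point problem with Lipschitz constant `‖B‖ / (l + ‖B‖) < 1`.
    have hK : ContractingWith (Real.toNNReal (‖B‖ / (l + ‖B‖))) fun x => R (f + B x) := by
      refine ⟨?_, LipschitzWith.of_dist_le_mul fun x y => ?_⟩
      · rw [Real.toNNReal_lt_one, div_lt_one hlb]
        linarith
      · rw [Real.coe_toNNReal _ (by positivity), dist_eq_norm, dist_eq_norm, ← map_sub,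
          add_sub_add_left_eq_sub, ← map_sub, div_mul_eq_mul_div, le_div_iff₀' hlb]
        exact (hRb _).trans (B.le_opNorm _)
    have hx := hK.fixedPoint_isFixedPt
    set x := hK.fixedPoint
    have hx' : R (f + B x) = x := hx
    refine ⟨(x, (l : ℂ) • x - f), ?_, by simp⟩
    have h1 := hR (f + B x)
    rw [hx'] at h1
    rw [mem_perturb]
    convert h1 using 2
    simp only [sub_apply, smul_apply,
      one_apply_eq_self, Complex.ofReal_add, add_smul]
    abel
  singleValued := by
    intro y hy
    have h1 := h.singleValued _ (mem_perturb.1 hy)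
    simpa using h1

end Perturbation

/-! ### Rescaling and similarity of semigroups -/

section Transfer

variable {X : Type*} [NormedAddCommGroup X] [NormedSpace ℂ X]

/-- The product rule at `0`: split `e^{bt} S - x` into `e^{bt} (S - x)` and `(e^{bt} - 1) x`. -/
theorem tendsto_rescaled_quotient {S : ℝ → X} {x z : X} (b : ℝ)
    (h : Tendsto (fun t : ℝ => ((t⁻¹ : ℝ) : ℂ) • (S t - x)) (𝓝[>] 0) (𝓝 z)) :
    Tendsto (fun t : ℝ => ((t⁻¹ : ℝ) : ℂ) • ((Real.exp (b * t) : ℂ) • S t - x)) (𝓝[>] 0)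
      (𝓝 (z + (b : ℂ) • x)) := by
  have h1 : Tendsto (fun t : ℝ => Real.exp (b * t)) (𝓝[>] 0) (𝓝 1) := by
    have : Continuous fun t : ℝ => Real.exp (b * t) := by fun_prop
    simpa using (this.tendsto 0).mono_left nhdsWithin_le_nhds
  have h2 : Tendsto (fun t : ℝ => t⁻¹ * (Real.exp (b * t) - 1)) (𝓝[>] 0) (𝓝 b) := by
    have h3 : HasDerivAt (fun t : ℝ => Real.exp (b * t)) b 0 := by
      have := ((hasDerivAt_id (0 : ℝ)).const_mul b).exp
      simpa using! this
    have h4 := hasDerivAt_iff_tendsto_slope.1 h3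
    refine (h4.mono_left (nhdsWithin_mono _ fun t (ht : 0 < t) => ht.ne')).congr fun t => ?_
    simp [slope_def_field, div_eq_inv_mul]
  have h1' := (Complex.continuous_ofReal.tendsto _).comp h1
  have h2' := (Complex.continuous_ofReal.tendsto _).comp h2
  have h5 := (h1'.smul h).add (h2'.smul_const x)
  rw [Complex.ofReal_one, one_smul] at h5
  refine h5.congr fun t => ?_
  simp only [Function.comp_apply, Complex.ofReal_mul, Complex.ofReal_sub, Complex.ofReal_one]
  module

theorem IsC0Semigroup.exp_smul {T : ℝ → X →L[ℂ] X} (hT : IsC0Semigroup T) (b : ℝ) :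
    IsC0Semigroup fun t => (Real.exp (b * t) : ℂ) • T t where
  map_zero := by simp [hT.map_zero]
  map_add s t hs ht := by
    rw [hT.map_add s t hs ht, mul_add, Real.exp_add, Complex.ofReal_mul]
    ext x
    simp only [smul_apply, ContinuousLinearMap.comp_apply, map_smul, mul_smul]
    exact smul_comm _ _ _
  strong_cont x := by
    have : Continuous fun t : ℝ => (Real.exp (b * t) : ℂ) := by fun_prop
    exact this.continuousOn.smul (hT.strong_cont x)

variable {Y : Type*} [NormedAddCommGroup Y] [NormedSpace ℂ Y]

theorem IsC0Semigroup.conj {T : ℝ → Y →L[ℂ] Y} (hT : IsC0Semigroup T) (Φ : X ≃L[ℂ] Y) :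
    IsC0Semigroup fun t => (Φ.symm : Y →L[ℂ] X).comp ((T t).comp (Φ : X →L[ℂ] Y)) where
  map_zero := by
    ext x
    simp [hT.map_zero]
  map_add s t hs ht := by
    ext x
    simp [hT.map_add s t hs ht]
  strong_cont x := Φ.symm.continuous.comp_continuousOn (hT.strong_cont (Φ x))

/-- Generation of a semigroup by an operator that is similar to a bounded perturbation of
an `m`-dissipative one. -/
theorem IsMDissipative.exists_semigroup_of_similar {Y : Type*} [NormedAddCommGroup Y]
    [InnerProductSpace ℂ Y] [CompleteSpace Y] {Γ₀ : Submodule ℂ (Y × Y)} (h : IsMDissipative Γ₀)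
    (B : Y →L[ℂ] Y) (Φ : X ≃L[ℂ] Y) {Γ : Submodule ℂ (X × X)}
    (hΓ : ∀ x y, (x, y) ∈ Γ ↔ (Φ x, Φ y - B (Φ x)) ∈ Γ₀) :
    ∃ T : ℝ → X →L[ℂ] X, IsC0Semigroup T ∧ HasGenerator T Γ := by
  obtain ⟨T, hT, hgen⟩ := (h.perturb_sub_norm B).exists_semigroup
  set b := ‖B‖
  refine ⟨_, (hT.exp_smul b).conj Φ, fun x y => ?_⟩
  have e1 : (x, y) ∈ Γ ↔ (Φ x, Φ y - (b : ℂ) • Φ x) ∈ perturb Γ₀ (B - (b : ℂ) • 1) := by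
    rw [hΓ, mem_perturb]
    simp
  rw [e1, hgen]
  constructor
  · intro h1
    have h2 := tendsto_rescaled_quotient b h1
    rw [sub_add_cancel] at h2
    have h3 := (Φ.symm.continuous.tendsto _).comp h2
    simpa [Function.comp_def] using h3
  · intro h1
    have h2 := (Φ.continuous.tendsto _).comp h1
    have h3 : Tendsto (fun t : ℝ => ((t⁻¹ : ℝ) : ℂ) • ((Real.exp (b * t) : ℂ) • T t (Φ x) - Φ x))
        (𝓝[>] 0) (𝓝 (Φ y)) := by
      simpa [Function.comp_def] using h2
    -- Multiplication by `e^{-bt}` undoes the rescaling, so the rescaled quotient converges exactly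
    -- when the original one does.
    have h4 := tendsto_rescaled_quotient (-b) h3
    rw [Complex.ofReal_neg, neg_smul, ← sub_eq_add_neg] at h4
    refine h4.congr fun t => ?_
    rw [smul_smul, ← Complex.ofReal_mul, ← Real.exp_add, neg_mul, neg_add_cancel, Real.exp_zero,
      Complex.ofReal_one, one_smul]

end Transfer

/-! ### A necessary condition for generation -/

section Necessary

variable {X : Type*} [NormedAddCommGroup X] [NormedSpace ℂ X] {T : ℝ → X →L[ℂ] X}
  {Γ : Submodule ℂ (X × X)}

/-- By the semigroup law, the right difference quotient at `s` is `T s` applied to the one at `0`.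
The right derivative suffices for the mean value inequality used below. -/
theorem HasGenerator.hasDerivWithinAt (hT : IsC0Semigroup T) (hΓ : HasGenerator T Γ) {x y : X}
    (hxy : (x, y) ∈ Γ) {s : ℝ} (hs : 0 ≤ s) :
    HasDerivWithinAt (fun t => T t x) (T s y) (Ici s) s := by
  rw [← hasDerivWithinAt_Ioi_iff_Ici, hasDerivWithinAt_iff_tendsto_slope' (by simp)]
  have h1 := ((T s).continuous.tendsto _).comp ((hΓ x y).1 hxy)
  have h2 : Tendsto (fun t : ℝ => t - s) (𝓝[>] s) (𝓝[>] 0) := by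
    refine tendsto_nhdsWithin_iff.2 ⟨?_, ?_⟩
    · have : Continuous fun t : ℝ => t - s := by fun_prop
      simpa using (this.tendsto s).mono_left nhdsWithin_le_nhds
    · filter_upwards [self_mem_nhdsWithin] with t ht
      exact sub_pos.2 (mem_Ioi.1 ht)
  refine (h1.comp h2).congr' ?_
  filter_upwards [self_mem_nhdsWithin] with t ht
  have hst : 0 ≤ t - s := (sub_pos.2 (mem_Ioi.1 ht)).le
  have e : T t = (T s).comp (T (t - s)) := by
    rw [← hT.map_add _ _ hs hst, add_sub_cancel]
  simp only [Function.comp_apply, slope, vsub_eq_sub]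
  rw [e, map_smul, map_sub, ContinuousLinearMap.comp_apply]
  exact Complex.coe_smul _ _

/-- Orbits are bounded on the compact interval by continuity; the uniform boundedness principle does
the rest. -/
theorem IsC0Semigroup.exists_bound [CompleteSpace X] (hT : IsC0Semigroup T) :
    ∃ M, 0 < M ∧ ∀ t ∈ Icc (0 : ℝ) 1, ∀ x, ‖T t x‖ ≤ M * ‖x‖ := by
  obtain ⟨M, hM⟩ := banach_steinhaus (g := fun t : Icc (0 : ℝ) 1 => T t) fun x => by
    obtain ⟨C, hC⟩ := isCompact_Icc.exists_bound_of_continuousOn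
      ((hT.strong_cont x).mono (fun t (ht : t ∈ Icc (0 : ℝ) 1) => ht.1))
    exact ⟨C, fun t => hC t t.2⟩
  refine ⟨max M 1, by positivity, fun t ht x => ?_⟩
  exact (T t).le_of_opNorm_le ((hM ⟨t, ht⟩).trans (le_max_left _ _)) x

/-- If a bounded perturbation of a relation generates a `C₀`-semigroup, then the relation has no
large positive eigenvalues. -/
theorem HasGenerator.eigenvector_eq_zero [CompleteSpace X] (hT : IsC0Semigroup T)
    (hΓ : HasGenerator T Γ) (B : X →L[ℂ] X) :
    ∃ l₀ : ℝ, ∀ l, l₀ < l → ∀ x, (x, (l : ℂ) • x + B x) ∈ Γ → x = 0 := by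
  obtain ⟨M, hM, hMb⟩ := hT.exists_bound
  -- If `A x = l x + B x`, then `e^{-lt} T(t) x` has right derivative `e^{-lt} T(t) B x`. Comparing
  -- times `0` and `1` gives `‖x‖ ≤ (M e^{-l} + M ‖B‖ / l) ‖x‖`. Working on `[0,1]` makes an
  -- exponential growth bound unnecessary.
  have hlim : ∀ᶠ l : ℝ in atTop, M * Real.exp (-l) + M * ‖B‖ / l < 1 := by
    have h1 : Tendsto (fun l : ℝ => M * Real.exp (-l) + M * ‖B‖ / l) atTop
        (𝓝 (M * 0 + 0)) :=
      (Real.tendsto_exp_neg_atTop_nhds_zero.const_mul M).add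
        (tendsto_const_nhds.div_atTop tendsto_id)
    exact h1.eventually (gt_mem_nhds (by simp))
  obtain ⟨l₀, hl₀⟩ := eventually_atTop.1 hlim
  refine ⟨max l₀ 0, fun l hl x hx => ?_⟩
  have hlpos : 0 < l := (le_max_right _ _).trans_lt hl
  have hsmall := hl₀ l ((le_max_left _ _).trans hl.le)
  set f : ℝ → X := fun t => Real.exp (-(l * t)) • T t x with hf
  have hcont : ContinuousOn f (Icc 0 1) := by
    have : Continuous fun t : ℝ => Real.exp (-(l * t)) := by fun_prop
    exact this.continuousOn.smul ((hT.strong_cont x).mono Icc_subset_Ici_self)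
  have hexp : ∀ t : ℝ, HasDerivAt (fun t => Real.exp (-(l * t))) (-l * Real.exp (-(l * t))) t := by
    intro t
    have h : HasDerivAt (fun t => -(l * t)) (-(l * 1)) t := ((hasDerivAt_id t).const_mul l).fun_neg
    exact h.exp.congr_deriv (by ring)
  have hderiv : ∀ t ∈ Ico (0 : ℝ) 1, HasDerivWithinAt (fun t => f t - x)
      (Real.exp (-(l * t)) • T t (B x)) (Ici t) t := by
    intro t ht
    have h1 := (hexp t).hasDerivWithinAt.smul (hΓ.hasDerivWithinAt hT hx ht.1)
    refine (h1.sub_const x).congr_deriv ?_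
    rw [map_add, map_smul, ← Complex.coe_smul (Real.exp _), ← Complex.coe_smul (Real.exp _),
      ← Complex.coe_smul (-l * _)]
    push_cast
    module
  -- The majorant of `‖f t - x‖`: the integral of `M ‖B‖ ‖x‖ e^{-ls}` over `[0,t]`.
  have hB : ∀ t : ℝ, HasDerivAt (fun t => M * ‖B‖ * ‖x‖ / l * (1 - Real.exp (-(l * t))))
      (M * ‖B‖ * ‖x‖ * Real.exp (-(l * t))) t := by
    intro t
    have := ((hexp t).const_sub 1).const_mul (M * ‖B‖ * ‖x‖ / l)
    exact this.congr_deriv (by field_simp)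
  have hmain := image_norm_le_of_norm_deriv_right_le_deriv_boundary
    (hcont.sub continuousOn_const) hderiv (by simp [hf, hT.map_zero]) hB (fun t ht => by
      rw [norm_smul, Real.norm_of_nonneg (Real.exp_pos _).le, mul_comm]
      gcongr
      calc ‖T t (B x)‖ ≤ M * ‖B x‖ := hMb t ⟨ht.1, ht.2.le⟩ _
        _ ≤ M * (‖B‖ * ‖x‖) := by gcongr; exact B.le_opNorm x
        _ = _ := by ring) (right_mem_Icc.2 zero_le_one)
  have h1 : ‖f 1‖ ≤ Real.exp (-l) * (M * ‖x‖) := by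
    rw [hf, norm_smul, Real.norm_of_nonneg (Real.exp_pos _).le, mul_one]
    gcongr
    exact hMb 1 (right_mem_Icc.2 zero_le_one) x
  have h2 : M * ‖B‖ * ‖x‖ / l * (1 - Real.exp (-(l * 1))) ≤ M * ‖B‖ * ‖x‖ / l := by
    refine mul_le_of_le_one_right (by positivity) ?_
    linarith [Real.exp_pos (-(l * 1))]
  have h3 : ‖x‖ ≤ ‖f 1‖ + ‖f 1 - x‖ := by
    have := norm_sub_le (f 1) (f 1 - x)
    rwa [sub_sub_cancel] at this
  have h4 : ‖x‖ ≤ (M * Real.exp (-l) + M * ‖B‖ / l) * ‖x‖ := by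
    have h5 : ‖f 1 - x‖ ≤ _ := hmain
    calc ‖x‖ ≤ Real.exp (-l) * (M * ‖x‖) + M * ‖B‖ * ‖x‖ / l := by linarith
      _ = _ := by ring
  by_contra hne
  have hxpos : 0 < ‖x‖ := norm_pos_iff.2 hne
  nlinarith

end Necessary

/-! ### Locally absolutely continuous functions -/

section LocAC

theorem _root_.AbsolutelyContinuousOnInterval.comp_lipschitz {E F : Type*} [PseudoMetricSpace E]
    [PseudoMetricSpace F] {u : ℝ → E} {a b : ℝ} (hu : AbsolutelyContinuousOnInterval u a b)
    {K : NNReal} {g : E → F} (hg : LipschitzWith K g) :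
    AbsolutelyContinuousOnInterval (fun ξ => g (u ξ)) a b := by
  refine squeeze_zero (fun t => Finset.sum_nonneg fun i _ => dist_nonneg) (fun t => ?_)
    (by simpa using Tendsto.const_mul (K : ℝ) hu)
  rw [Finset.mul_sum]
  exact Finset.sum_le_sum fun i _ => hg.dist_le_mul _ _

theorem LocAC.comp_lipschitz {E F : Type*} [PseudoMetricSpace E]
    [PseudoMetricSpace F] {u : ℝ → E} (hu : LocAC u) {K : NNReal} {g : E → F}
    (hg : LipschitzWith K g) : LocAC fun ξ => g (u ξ) :=
  fun a b ha hab => (hu a b ha hab).comp_lipschitz hg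

theorem LocAC.continuousOn {E : Type*} [NormedAddCommGroup E] {u : ℝ → E} (hu : LocAC u) :
    ContinuousOn u (Ici 0) := by
  intro x hx
  have hx0 : 0 ≤ x := hx
  have h := (hu 0 (x + 1) le_rfl (by linarith)).continuousOn
  rw [uIcc_of_le (by linarith)] at h
  have hmem : Icc 0 (x + 1) ∈ 𝓝[Ici 0] x :=
    mem_nhdsWithin.2 ⟨Iio (x + 1), isOpen_Iio, lt_add_one x, fun y hy => ⟨hy.2, hy.1.le⟩⟩
  have hx1 : x ∈ Icc 0 (x + 1) := ⟨hx0, (lt_add_one x).le⟩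
  exact (h.continuousWithinAt hx1).mono_of_mem_nhdsWithin hmem

theorem locAC_of_contDiffOn {E : Type*} [NormedAddCommGroup E] [NormedSpace ℝ E] {u : ℝ → E}
    (hu : ContDiffOn ℝ 1 u (Ici 0)) : LocAC u := fun a b ha hab =>
  (hu.mono fun x hx => by
    rw [uIcc_of_le hab] at hx
    exact ha.trans hx.1).absolutelyContinuousOnInterval

theorem LocAC.mul {u v : ℝ → ℂ} (hu : LocAC u) (hv : LocAC v) : LocAC fun ξ => u ξ * v ξ :=
  fun a b ha hab => (hu a b ha hab).smul (hv a b ha hab)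

theorem LocAC.add {u v : ℝ → ℂ} (hu : LocAC u) (hv : LocAC v) : LocAC fun ξ => u ξ + v ξ :=
  fun a b ha hab => (hu a b ha hab).add (hv a b ha hab)

theorem LocAC.sub {u v : ℝ → ℂ} (hu : LocAC u) (hv : LocAC v) : LocAC fun ξ => u ξ - v ξ :=
  fun a b ha hab => (hu a b ha hab).sub (hv a b ha hab)

theorem locAC_const {E : Type*} [PseudoMetricSpace E] (c : E) : LocAC fun _ => c :=
  fun _ _ _ _ => (LipschitzWith.const c).lipschitzOnWith.absolutelyContinuousOnInterval

theorem LocAC.const_mul {u : ℝ → ℂ} (hu : LocAC u) (c : ℂ) : LocAC fun ξ => c * u ξ :=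
  (locAC_const c).mul hu

theorem LocAC.sum {ι : Type*} {s : Finset ι} {u : ι → ℝ → ℂ} (hu : ∀ i ∈ s, LocAC (u i)) :
    LocAC fun ξ => ∑ i ∈ s, u i ξ := by
  classical
  induction s using Finset.induction_on with
  | empty => simpa using locAC_const (0 : ℂ)
  | insert i s hi ih =>
    simp only [Finset.sum_insert hi]
    exact (hu i (Finset.mem_insert_self i s)).add
      (ih fun j hj => hu j (Finset.mem_insert_of_mem hj))

theorem LocAC.apply {ι : Type*} [Fintype ι] {u : ℝ → ι → ℂ} (hu : LocAC u) (i : ι) :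
    LocAC fun ξ => u ξ i :=
  hu.comp_lipschitz (LipschitzWith.eval i)

theorem locAC_pi {ι : Type*} [Fintype ι] {u : ℝ → ι → ℂ} (hu : ∀ i, LocAC fun ξ => u ξ i) :
    LocAC u := by
  intro a b ha hab
  have h := tendsto_finsetSum Finset.univ fun i _ => hu i a b ha hab
  refine squeeze_zero (fun t => Finset.sum_nonneg fun i _ => dist_nonneg) (fun t => ?_)
    (by simpa using h)
  rw [Finset.sum_comm]
  refine Finset.sum_le_sum fun k _ => ?_
  refine (dist_pi_le_iff (Finset.sum_nonneg fun _ _ => dist_nonneg)).2 fun i => ?_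
  exact Finset.single_le_sum (f := fun i => dist (u (t.2 k).1 i) (u (t.2 k).2 i))
    (fun _ _ => dist_nonneg) (Finset.mem_univ i)

theorem LocAC.normSq {u : ℝ → ℂ} (hu : LocAC u) : LocAC fun ξ => ‖u ξ‖ ^ 2 := by
  intro a b ha hab
  have h1 := (hu a b ha hab).comp_lipschitz Complex.reCLM.lipschitz
  have h2 := (hu a b ha hab).comp_lipschitz Complex.imCLM.lipschitz
  have e : (fun ξ => ‖u ξ‖ ^ 2) = (fun ξ => (u ξ).re) * (fun ξ => (u ξ).re)
      + (fun ξ => (u ξ).im) * (fun ξ => (u ξ).im) := by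
    funext ξ
    rw [← Complex.normSq_eq_norm_sq, Complex.normSq_apply]
    rfl
  rw [e]
  exact (h1.mul h1).add (h2.mul h2)

theorem ae_of_ae_halfLine {p : ℝ → Prop} (h : ∀ᵐ ξ ∂halfLine, p ξ) :
    ∀ᵐ ξ, 0 ≤ ξ → p ξ :=
  (ae_restrict_iff' measurableSet_Ici).1 h

theorem ae_halfLine_of_forall {p : ℝ → Prop} (h : ∀ ξ, 0 < ξ → p ξ) : ∀ᵐ ξ ∂halfLine, p ξ := by
  rw [ae_restrict_iff' measurableSet_Ici]
  have h2 : ∀ᵐ ξ : ℝ, ξ ≠ (0 : ℝ) := Measure.ae_ne _ _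
  filter_upwards [h2] with ξ h1 h3
  exact h ξ (lt_of_le_of_ne h3 h1.symm)

/-- Reduced to the real-valued case through real and imaginary parts. Integrability is known only on
`[0,b]`, so the decomposition of the integral holds only for nonnegative upper limits; absolute
continuity is therefore transferred through its `ε`-`δ` form. -/
theorem locAC_integral {f : ℝ → ℂ} (hf : ∀ b, 0 ≤ b → IntervalIntegrable f volume 0 b) :
    LocAC fun ξ => ∫ s in (0 : ℝ)..ξ, f s := by
  have key : LocAC fun ξ => ((∫ s in (0 : ℝ)..ξ, (f s).re : ℝ) : ℂ)
      + Complex.I * ((∫ s in (0 : ℝ)..ξ, (f s).im : ℝ) : ℂ) := by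
    have aux : ∀ g : ℝ → ℝ, (∀ b, 0 ≤ b → IntervalIntegrable g volume 0 b) →
        LocAC fun ξ => ((∫ s in (0 : ℝ)..ξ, g s : ℝ) : ℂ) := by
      intro g hg a b ha hab
      have h1 := (hg b (ha.trans hab)).absolutelyContinuousOnInterval_intervalIntegral
        (left_mem_uIcc)
      have h2 := h1.comp_lipschitz Complex.ofRealCLM.lipschitz
      refine h2.mono ?_
      rw [uIcc_of_le hab, uIcc_of_le (ha.trans hab)]
      exact Icc_subset_Icc_left ha
    exact (aux _ fun b hb => ⟨(hf b hb).1.re, (hf b hb).2.re⟩).add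
      ((aux _ fun b hb => ⟨(hf b hb).1.im, (hf b hb).2.im⟩).const_mul _)
  intro a b ha hab
  have h1 := key a b ha hab
  rw [absolutelyContinuousOnInterval_iff] at h1 ⊢
  have e : ∀ ξ ∈ uIcc a b, (∫ s in (0 : ℝ)..ξ, f s)
      = ((∫ s in (0 : ℝ)..ξ, (f s).re : ℝ) : ℂ)
        + Complex.I * ((∫ s in (0 : ℝ)..ξ, (f s).im : ℝ) : ℂ) := by
    intro ξ hξ
    rw [uIcc_of_le hab] at hξ
    have hi := hf ξ (ha.trans hξ.1)
    have h3 := Complex.reCLM.intervalIntegral_comp_comm hi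
    have h4 := Complex.imCLM.intervalIntegral_comp_comm hi
    simp only [Complex.reCLM_apply, Complex.imCLM_apply] at h3 h4
    rw [h3, h4, mul_comm, Complex.re_add_im]
  intro ε hε
  obtain ⟨δ, hδ, h⟩ := h1 ε hε
  refine ⟨δ, hδ, fun I hI hId => ?_⟩
  convert h I hI hId using 1
  refine Finset.sum_congr rfl fun i hi => ?_
  rw [e _ (hI.1 i hi).1, e _ (hI.1 i hi).2]

/-- The fundamental theorem of calculus for locally absolutely continuous functions. -/
theorem LocAC.integral_eq_sub {F G : ℝ → ℝ} (hF : LocAC F)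
    (hd : ∀ᵐ ξ ∂halfLine, HasDerivAt F (G ξ) ξ) {b : ℝ} (hb : 0 ≤ b) :
    IntervalIntegrable G volume 0 b ∧ ∫ ξ in (0 : ℝ)..b, G ξ = F b - F 0 := by
  have h := hF 0 b le_rfl hb
  have hae : ∀ᵐ ξ, ξ ∈ uIoc 0 b → deriv F ξ = G ξ := by
    filter_upwards [ae_of_ae_halfLine hd] with ξ h1 h2
    rw [uIoc_of_le hb] at h2
    exact (h1 h2.1.le).deriv
  refine ⟨h.intervalIntegrable_deriv.congr_ae ((ae_restrict_iff' measurableSet_uIoc).2 hae), ?_⟩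
  rw [← h.integral_deriv_eq_sub]
  exact (intervalIntegral.integral_congr_ae hae).symm

theorem hasDerivAt_norm_sq {u : ℝ → ℂ} {d : ℂ} {ξ : ℝ} (h : HasDerivAt u d ξ) :
    HasDerivAt (fun ξ => ‖u ξ‖ ^ 2) (2 * (star (u ξ) * d).re) ξ := by
  have := h.norm_sq
  convert this using 2
  rw [Complex.inner, mul_comm]
  rfl

end LocAC

/-! ### The scalar transport equation -/

section Scalar

variable {θ : ℝ → ℝ}

/-- The travel time from `0` to `ξ` with speed `θ`. -/
def travelTime (θ : ℝ → ℝ) (ξ : ℝ) : ℝ := ∫ s in (0 : ℝ)..ξ, (θ (max s 0))⁻¹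

/-- Freezing the speed at its value at `0` on the negative axis makes the travel time continuously
differentiable on the whole line, without one-sided derivatives at `0`. -/
theorem continuous_comp_max (hθc : ContinuousOn θ (Ici 0)) : Continuous fun s => θ (max s 0) :=
  hθc.comp_continuous (by fun_prop) fun s => mem_Ici.2 (le_max_right s 0)

theorem hasDerivAt_travelTime (hθc : ContinuousOn θ (Ici 0)) (hθ : ∀ ξ, 0 ≤ ξ → 0 < θ ξ)
    (ξ : ℝ) : HasDerivAt (travelTime θ) (θ (max ξ 0))⁻¹ ξ := by
  have h : Continuous fun s => (θ (max s 0))⁻¹ :=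
    (continuous_comp_max hθc).inv₀ fun s => (hθ _ (le_max_right _ _)).ne'
  exact intervalIntegral.integral_hasDerivAt_right (h.intervalIntegrable _ _)
    (h.stronglyMeasurableAtFilter _ _) h.continuousAt

/-- The exponential of a multiple of the travel time. -/
def expTime (θ : ℝ → ℝ) (m ξ : ℝ) : ℝ := Real.exp (m * travelTime θ ξ)

theorem expTime_pos (m ξ : ℝ) : 0 < expTime θ m ξ := Real.exp_pos _

theorem expTime_zero (m : ℝ) : expTime θ m 0 = 1 := by simp [expTime, travelTime]

theorem expTime_mul_neg (m ξ : ℝ) : expTime θ m ξ * expTime θ (-m) ξ = 1 := by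
  rw [expTime, expTime, ← Real.exp_add]
  simp

theorem hasDerivAt_expTime (hθc : ContinuousOn θ (Ici 0)) (hθ : ∀ ξ, 0 ≤ ξ → 0 < θ ξ)
    (m ξ : ℝ) : HasDerivAt (expTime θ m) (m * expTime θ m ξ / θ (max ξ 0)) ξ := by
  have h := ((hasDerivAt_travelTime hθc hθ ξ).const_mul m).exp
  refine h.congr_deriv ?_
  rw [expTime, div_eq_mul_inv]
  ring

theorem continuous_expTime (hθc : ContinuousOn θ (Ici 0)) (hθ : ∀ ξ, 0 ≤ ξ → 0 < θ ξ) (m : ℝ) :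
    Continuous (expTime θ m) :=
  continuous_iff_continuousAt.2 fun ξ => (hasDerivAt_expTime hθc hθ m ξ).continuousAt

theorem locAC_expTime (hθc : ContinuousOn θ (Ici 0)) (hθ : ∀ ξ, 0 ≤ ξ → 0 < θ ξ) (m : ℝ) :
    LocAC fun ξ => (expTime θ m ξ : ℂ) := by
  have h1 : ContDiff ℝ 1 (expTime θ m) := by
    rw [contDiff_one_iff_deriv]
    refine ⟨fun ξ => (hasDerivAt_expTime hθc hθ m ξ).differentiableAt, ?_⟩
    have e : deriv (expTime θ m) = fun ξ => m * expTime θ m ξ / θ (max ξ 0) :=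
      funext fun ξ => (hasDerivAt_expTime hθc hθ m ξ).deriv
    rw [e]
    exact (continuous_const.mul (continuous_expTime hθc hθ m)).div₀ (continuous_comp_max hθc)
      fun s => (hθ _ (le_max_right _ _)).ne'
  exact locAC_of_contDiffOn (Complex.ofRealCLM.contDiff.comp h1).contDiffOn

theorem intervalIntegrable_of_memLp {f : ℝ → ℂ} (hf : MemLp f 2 halfLine) {b : ℝ} (hb : 0 ≤ b) :
    IntervalIntegrable f volume 0 b := by
  rw [intervalIntegrable_iff_integrableOn_Ioc_of_le hb]
  have h : MemLp f 2 (volume.restrict (Ioc 0 b)) :=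
    hf.mono_measure (Measure.restrict_mono (fun x hx => hx.1.le) le_rfl)
  exact h.integrable (by norm_num)

theorem intervalIntegrable_expTime_mul (hθc : ContinuousOn θ (Ici 0))
    (hθ : ∀ ξ, 0 ≤ ξ → 0 < θ ξ) (m : ℝ) {f : ℝ → ℂ} (hf : MemLp f 2 halfLine) {b : ℝ}
    (hb : 0 ≤ b) :
    IntervalIntegrable (fun s => ((expTime θ m s / √(θ s) : ℝ) : ℂ) * f s) volume 0 b := by
  refine (intervalIntegrable_of_memLp hf hb).continuousOn_mul ?_
  rw [uIcc_of_le hb]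
  refine Complex.continuous_ofReal.comp_continuousOn ?_
  refine (continuous_expTime hθc hθ m).continuousOn.div ?_ fun x hx =>
    (Real.sqrt_pos.2 (hθ x hx.1)).ne'
  exact (hθc.mono fun x hx => hx.1).sqrt

/-- Variation of constants. -/
def transportSol (θ : ℝ → ℝ) (m : ℝ) (f : ℝ → ℂ) (a : ℂ) (ξ : ℝ) : ℂ :=
  (expTime θ m ξ : ℂ) * (a - ∫ s in (0 : ℝ)..ξ, ((expTime θ (-m) s / √(θ s) : ℝ) : ℂ) * f s)

theorem transportSol_zero (m : ℝ) (f : ℝ → ℂ) (a : ℂ) : transportSol θ m f a 0 = a := by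
  simp [transportSol, expTime_zero]

variable (hθc : ContinuousOn θ (Ici 0)) (hθ : ∀ ξ, 0 ≤ ξ → 0 < θ ξ)
include hθc hθ

theorem locAC_transportSol (m : ℝ) {f : ℝ → ℂ} (hf : MemLp f 2 halfLine) (a : ℂ) :
    LocAC (transportSol θ m f a) :=
  (locAC_expTime hθc hθ m).mul ((locAC_const a).sub
    (locAC_integral fun _ hb => intervalIntegrable_expTime_mul hθc hθ (-m) hf hb))

/-- In the coordinate `ψ = σ √θ k`, the resolvent equation `√θ ψ' = l k - f` takes this form with `m
= σ l`. -/
theorem hasDerivAt_transportSol (m : ℝ) {f : ℝ → ℂ} (hf : MemLp f 2 halfLine) (a : ℂ) :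
    ∀ᵐ ξ ∂halfLine, HasDerivAt (transportSol θ m f a)
      ((m / θ ξ : ℝ) * transportSol θ m f a ξ - f ξ / (√(θ ξ) : ℝ)) ξ := by
  -- Lebesgue differentiation is used on the countably many intervals `[0,b]` with integer `b`, so
  -- the exceptional sets have a null union.
  have h1 : ∀ᵐ ξ, ∀ b : ℕ, ξ ∈ uIcc (0 : ℝ) b → ∀ c ∈ uIcc (0 : ℝ) b,
      HasDerivAt (fun x => ∫ s in c..x, ((expTime θ (-m) s / √(θ s) : ℝ) : ℂ) * f s)
        (((expTime θ (-m) ξ / √(θ ξ) : ℝ) : ℂ) * f ξ) ξ :=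
    ae_all_iff.2 fun b => (intervalIntegrable_expTime_mul hθc hθ (-m) hf
      (Nat.cast_nonneg b)).ae_hasDerivAt_integral
  rw [ae_restrict_iff' measurableSet_Ici]
  filter_upwards [h1] with ξ h2 hξ
  have hξ0 : 0 ≤ ξ := hξ
  obtain ⟨b, hb⟩ := exists_nat_ge ξ
  have hb0 : (0 : ℝ) ≤ b := hξ0.trans hb
  have h3 := h2 b (by rw [uIcc_of_le hb0]; exact ⟨hξ0, hb⟩) 0 left_mem_uIcc
  have h4 := (hasDerivAt_expTime hθc hθ m ξ).ofReal_comp.mul (h3.const_sub a)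
  refine h4.congr_deriv ?_
  rw [max_eq_left hξ0, transportSol]
  have h5 : ((expTime θ m ξ : ℝ) : ℂ) * (expTime θ (-m) ξ : ℝ) = 1 := by
    exact_mod_cast expTime_mul_neg m ξ
  push_cast
  linear_combination (-f ξ / (√(θ ξ) : ℝ)) * h5

/-- The energy estimate for the transport equation with speed `σ θ`. -/
theorem energy_estimate {l σ : ℝ} (hl : 0 < l) (hσ : σ ^ 2 = 1) {f ψ : ℝ → ℂ}
    (hf : MemLp f 2 halfLine) (hψ : LocAC ψ)
    (hd : ∀ᵐ ξ ∂halfLine, HasDerivAt ψ ((σ * l / θ ξ : ℝ) * ψ ξ - f ξ / (√(θ ξ) : ℝ)) ξ)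
    {b : ℝ} (hb : 0 ≤ b) :
    l * ∫ ξ in (0 : ℝ)..b, ‖ψ ξ / (√(θ ξ) : ℝ)‖ ^ 2 ≤
      σ * (‖ψ b‖ ^ 2 - ‖ψ 0‖ ^ 2) + l⁻¹ * ∫ ξ, ‖f ξ‖ ^ 2 ∂halfLine := by
  set G : ℝ → ℝ := fun ξ =>
    2 * (star (ψ ξ) * ((σ * l / θ ξ : ℝ) * ψ ξ - f ξ / (√(θ ξ) : ℝ))).re with hG
  obtain ⟨hGi, hGint⟩ := hψ.normSq.integral_eq_sub
    (G := G) (hd.mono fun ξ h => hasDerivAt_norm_sq h) hb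
  have hf2 : Integrable (fun ξ => ‖f ξ‖ ^ 2) halfLine :=
    (memLp_two_iff_integrable_sq_norm hf.1).1 hf
  have hf2b : IntegrableOn (fun ξ => ‖f ξ‖ ^ 2) (Ioc 0 b) :=
    hf2.mono_measure (Measure.restrict_mono (fun x hx => hx.1.le) le_rfl)
  have hf2i : IntervalIntegrable (fun ξ => ‖f ξ‖ ^ 2) volume 0 b :=
    (intervalIntegrable_iff_integrableOn_Ioc_of_le hb).2 hf2b
  have hle : ∫ ξ in (0 : ℝ)..b, ‖f ξ‖ ^ 2 ≤ ∫ ξ, ‖f ξ‖ ^ 2 ∂halfLine := by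
    rw [intervalIntegral.integral_of_le hb]
    exact setIntegral_mono_set hf2 (Eventually.of_forall fun x => by positivity)
      (Eventually.of_forall fun x (hx : x ∈ Ioc 0 b) => hx.1.le)
  have hψi : IntervalIntegrable (fun ξ => ‖ψ ξ / (√(θ ξ) : ℝ)‖ ^ 2) volume 0 b := by
    refine ContinuousOn.intervalIntegrable ?_
    rw [uIcc_of_le hb]
    have hsub : Icc 0 b ⊆ Ici 0 := fun x hx => hx.1
    refine ((hψ.continuousOn.mono hsub).div (Complex.continuous_ofReal.comp_continuousOn
      (hθc.mono hsub).sqrt) fun x hx => ?_).norm.pow 2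
    simp only [Function.comp_apply]
    exact_mod_cast (Real.sqrt_pos.2 (hθ x hx.1)).ne'
  -- Pointwise, `σ (‖ψ‖²)' = 2 l ‖ψ/√θ‖² - 2 σ Re(ψ⋆ f)/√θ` because `σ² = 1`. Young's inequality
  -- absorbs the mixed term into one of the two copies of `l ‖ψ/√θ‖²`.
  have hmono : ∫ ξ in (0 : ℝ)..b, l * ‖ψ ξ / (√(θ ξ) : ℝ)‖ ^ 2
      ≤ ∫ ξ in (0 : ℝ)..b, (σ * G ξ + l⁻¹ * ‖f ξ‖ ^ 2) := by
    refine intervalIntegral.integral_mono_on hb (hψi.const_mul l)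
      ((hGi.const_mul σ).add (hf2i.const_mul _)) fun ξ hξ => ?_
    have hθξ := hθ ξ hξ.1
    set r := √(θ ξ) with hr
    have hr0 : 0 < r := Real.sqrt_pos.2 hθξ
    have hr2 : θ ξ = r ^ 2 := (Real.sq_sqrt hθξ.le).symm
    have e1 : star (ψ ξ) * ((σ * l / θ ξ : ℝ) * ψ ξ - f ξ / (r : ℝ))
        = ((σ * l * (‖ψ ξ‖ / r) ^ 2 : ℝ) : ℂ) - star (ψ ξ) * f ξ / (r : ℝ) := by
      have h1 : star (ψ ξ) * ψ ξ = ((‖ψ ξ‖ ^ 2 : ℝ) : ℂ) := by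
        rw [Complex.star_def, ← Complex.normSq_eq_conj_mul_self, Complex.normSq_eq_norm_sq]
      rw [hr2, mul_sub, mul_left_comm, h1]
      push_cast
      ring
    have e2 : (star (ψ ξ) * ((σ * l / θ ξ : ℝ) * ψ ξ - f ξ / (r : ℝ))).re
        = σ * l * (‖ψ ξ‖ / r) ^ 2 - (star (ψ ξ) * f ξ).re / r := by
      rw [e1, Complex.sub_re, Complex.ofReal_re, Complex.div_ofReal_re]
    have e3 : |(star (ψ ξ) * f ξ).re / r| ≤ (‖ψ ξ‖ / r) * ‖f ξ‖ := by
      rw [abs_div, abs_of_pos hr0, div_mul_eq_mul_div]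
      gcongr
      refine (Complex.abs_re_le_norm _).trans ?_
      rw [norm_mul, norm_star]
    have e4 : ‖ψ ξ / (r : ℝ)‖ = ‖ψ ξ‖ / r := by
      rw [norm_div, Complex.norm_real, Real.norm_of_nonneg hr0.le]
    change _ ≤ σ * (2 * (star (ψ ξ) * ((σ * l / θ ξ : ℝ) * ψ ξ - f ξ / (r : ℝ))).re) + _
    rw [e2, e4]
    set u := ‖ψ ξ‖ / r
    set w := (star (ψ ξ) * f ξ).re / r
    have hσ1 : |σ| = 1 := by
      rw [← Real.sqrt_sq_eq_abs, hσ, Real.sqrt_one]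
    have e5 : σ * w ≤ u * ‖f ξ‖ := by
      calc σ * w ≤ |σ * w| := le_abs_self _
        _ = |w| := by rw [abs_mul, hσ1, one_mul]
        _ ≤ _ := e3
    have e6 : 2 * (u * ‖f ξ‖) ≤ l * u ^ 2 + l⁻¹ * ‖f ξ‖ ^ 2 := by
      have h7 : 0 ≤ l⁻¹ * (l * u - ‖f ξ‖) ^ 2 := by positivity
      have h8 : l⁻¹ * (l * u - ‖f ξ‖) ^ 2 = l * u ^ 2 + l⁻¹ * ‖f ξ‖ ^ 2 - 2 * (u * ‖f ξ‖) := by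
        field_simp
        ring
      linarith
    have e7 : σ * (2 * (σ * l * u ^ 2 - w)) = 2 * (l * u ^ 2) - 2 * (σ * w) := by
      linear_combination (2 * l * u ^ 2) * hσ
    rw [e7]
    linarith
  rw [intervalIntegral.integral_const_mul, intervalIntegral.integral_add (hGi.const_mul σ)
    (hf2i.const_mul _), intervalIntegral.integral_const_mul σ, intervalIntegral.integral_const_mul l⁻¹,
    hGint] at hmono
  have : l⁻¹ * ∫ ξ in (0 : ℝ)..b, ‖f ξ‖ ^ 2 ≤ l⁻¹ * ∫ ξ, ‖f ξ‖ ^ 2 ∂halfLine := by gcongr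
  linarith

theorem memLp_of_bounded_energy {ψ : ℝ → ℂ} (hψ : LocAC ψ) {C : ℝ}
    (h : ∀ b, 0 ≤ b → ∫ ξ in (0 : ℝ)..b, ‖ψ ξ / (√(θ ξ) : ℝ)‖ ^ 2 ≤ C) :
    MemLp (fun ξ => ψ ξ / (√(θ ξ) : ℝ)) 2 halfLine := by
  have hc : ContinuousOn (fun ξ => ψ ξ / (√(θ ξ) : ℝ)) (Ici 0) := by
    refine hψ.continuousOn.div (Complex.continuous_ofReal.comp_continuousOn hθc.sqrt) fun x hx => ?_
    exact_mod_cast (Real.sqrt_pos.2 (hθ x hx)).ne'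
  rw [memLp_two_iff_integrable_sq_norm (hc.aestronglyMeasurable measurableSet_Ici)]
  have := integrableOn_Ioi_of_intervalIntegral_norm_bounded (μ := volume)
    (f := fun ξ => ‖ψ ξ / (√(θ ξ) : ℝ)‖ ^ 2) (l := atTop) (b := id) C 0 (fun b => ?_) tendsto_id ?_
  · exact (integrableOn_Ici_iff_integrableOn_Ioi (by simp)).2 this
  · have : ContinuousOn (fun ξ => ‖ψ ξ / (√(θ ξ) : ℝ)‖ ^ 2) (Icc 0 b) :=
      (hc.mono fun x hx => hx.1).norm.pow 2
    exact this.integrableOn_Icc.mono_set Ioc_subset_Icc_self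
  · filter_upwards [eventually_ge_atTop 0] with b hb
    simpa using h b hb

/-- The resolvent equation for negative speed, with prescribed boundary value. -/
theorem exists_solution_neg {l : ℝ} (hl : 0 < l) {f : ℝ → ℂ} (hf : MemLp f 2 halfLine) (a : ℂ) :
    ∃ ψ : ℝ → ℂ, LocAC ψ ∧ ψ 0 = a ∧ MemLp (fun ξ => ψ ξ / (√(θ ξ) : ℝ)) 2 halfLine ∧
      ∀ᵐ ξ ∂halfLine, HasDerivAt ψ ((-1 * l / θ ξ : ℝ) * ψ ξ - f ξ / (√(θ ξ) : ℝ)) ξ := by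
  have hψ := locAC_transportSol hθc hθ (-1 * l) hf a
  have hd := hasDerivAt_transportSol hθc hθ (-1 * l) hf a
  refine ⟨_, hψ, transportSol_zero _ _ _, memLp_of_bounded_energy hθc hθ hψ
    (C := l⁻¹ * (‖a‖ ^ 2 + l⁻¹ * ∫ ξ, ‖f ξ‖ ^ 2 ∂halfLine)) fun b hb => ?_, hd⟩
  -- For `σ = -1` the term with `‖ψ b‖²` has the favourable sign and is dropped, so every boundary
  -- value `a` is admissible.
  have h := energy_estimate hθc hθ hl (by norm_num) hf hψ hd hb
  rw [transportSol_zero] at h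
  rw [le_inv_mul_iff₀ hl]
  nlinarith [sq_nonneg ‖transportSol θ (-1 * l) f a b‖]

/-- Young's inequality with weight `q = e^{-lτ(b)}`, where `τ` is the travel time: the part
`e^{-2lτ}/θ` has an explicit primitive and contributes at most `q² / (2l)`. The resulting factor `q`
is what later cancels the growth `e^{lτ(b)}`. -/
theorem integral_expTime_le {l : ℝ} (hl : 0 < l) {f : ℝ → ℂ} (hf : MemLp f 2 halfLine)
    {b c : ℝ} (hb : 0 ≤ b) (hbc : b ≤ c) :
    ∫ s in b..c, ‖((expTime θ (-l) s / √(θ s) : ℝ) : ℂ) * f s‖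
      ≤ expTime θ (-l) b * ((2 * l)⁻¹ + ∫ ξ, ‖f ξ‖ ^ 2 ∂halfLine) := by
  have hc : 0 ≤ c := hb.trans hbc
  set q := expTime θ (-l) b with hq
  have hq0 : 0 < q := expTime_pos _ _
  have hE2 : ∀ ξ, expTime θ (-(2 * l)) ξ = expTime θ (-l) ξ ^ 2 := fun ξ => by
    rw [expTime, expTime, ← Real.exp_nat_mul]
    congr 1
    push_cast
    ring
  have hsub : uIcc b c ⊆ uIcc 0 c := by
    rw [uIcc_of_le hbc, uIcc_of_le hc]
    exact Icc_subset_Icc_left hb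
  have hf2 : Integrable (fun ξ => ‖f ξ‖ ^ 2) halfLine :=
    (memLp_two_iff_integrable_sq_norm hf.1).1 hf
  have hf2i : IntervalIntegrable (fun ξ => ‖f ξ‖ ^ 2) volume b c :=
    (intervalIntegrable_iff_integrableOn_Ioc_of_le hbc).2
      (hf2.mono_measure (Measure.restrict_mono (fun x hx => hb.trans hx.1.le) le_rfl))
  have hle : ∫ ξ in b..c, ‖f ξ‖ ^ 2 ≤ ∫ ξ, ‖f ξ‖ ^ 2 ∂halfLine := by
    rw [intervalIntegral.integral_of_le hbc]
    exact setIntegral_mono_set hf2 (Eventually.of_forall fun x => by positivity)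
      (Eventually.of_forall fun x (hx : x ∈ Ioc b c) => hb.trans hx.1.le)
  have hgi : IntervalIntegrable (fun s => expTime θ (-(2 * l)) s / θ (max s 0)) volume b c :=
    ((continuous_expTime hθc hθ _).div₀ (continuous_comp_max hθc)
      fun s => (hθ _ (le_max_right _ _)).ne').intervalIntegrable _ _
  have hgint : ∫ s in b..c, expTime θ (-(2 * l)) s / θ (max s 0) ≤ q ^ 2 * (2 * l)⁻¹ := by
    have hd : ∀ s ∈ uIcc b c, HasDerivAt (fun s => -(2 * l)⁻¹ * expTime θ (-(2 * l)) s)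
        (expTime θ (-(2 * l)) s / θ (max s 0)) s := fun s _ => by
      refine ((hasDerivAt_expTime hθc hθ (-(2 * l)) s).const_mul _).congr_deriv ?_
      field_simp
    rw [intervalIntegral.integral_eq_sub_of_hasDerivAt hd hgi, hE2 b, ← hq]
    have := (expTime_pos (θ := θ) (-(2 * l)) c).le
    have h2 : 0 ≤ (2 * l)⁻¹ * expTime θ (-(2 * l)) c := by positivity
    linarith
  calc ∫ s in b..c, ‖((expTime θ (-l) s / √(θ s) : ℝ) : ℂ) * f s‖
      ≤ ∫ s in b..c, (q⁻¹ * (expTime θ (-(2 * l)) s / θ (max s 0)) + q * ‖f s‖ ^ 2) := by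
        refine intervalIntegral.integral_mono_on hbc
          (((intervalIntegrable_expTime_mul hθc hθ (-l) hf hc).mono_set hsub).norm)
          ((hgi.const_mul _).add (hf2i.const_mul _)) fun s hs => ?_
        have hs0 : 0 ≤ s := hb.trans hs.1
        have hr0 : 0 < √(θ s) := Real.sqrt_pos.2 (hθ s hs0)
        have hE := expTime_pos (θ := θ) (-l) s
        rw [norm_mul, Complex.norm_real, Real.norm_of_nonneg (by positivity), hE2,
          max_eq_left hs0]
        nth_rewrite 2 [← Real.sq_sqrt (hθ s hs0).le]
        set e := expTime θ (-l) s
        set r := √(θ s)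
        have h1 : 0 ≤ q * ((q⁻¹ * (e / r) - ‖f s‖) ^ 2 + 2 * 0) := by positivity
        have h2 : 0 ≤ e / r * ‖f s‖ := by positivity
        have h3 : q * ((q⁻¹ * (e / r) - ‖f s‖) ^ 2 + 2 * 0)
            = q⁻¹ * (e ^ 2 / r ^ 2) + q * ‖f s‖ ^ 2 - 2 * (e / r * ‖f s‖) := by
          field_simp
          ring
        linarith
    _ = q⁻¹ * (∫ s in b..c, expTime θ (-(2 * l)) s / θ (max s 0)) + q * ∫ s in b..c, ‖f s‖ ^ 2 := by
        rw [intervalIntegral.integral_add (hgi.const_mul _) (hf2i.const_mul _),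
          intervalIntegral.integral_const_mul, intervalIntegral.integral_const_mul]
    _ ≤ q⁻¹ * (q ^ 2 * (2 * l)⁻¹) + q * ∫ ξ, ‖f ξ‖ ^ 2 ∂halfLine := by gcongr
    _ = _ := by field_simp

/-- The resolvent equation for positive speed. -/
theorem exists_solution_pos {l : ℝ} (hl : 0 < l) {f : ℝ → ℂ} (hf : MemLp f 2 halfLine) :
    ∃ ψ : ℝ → ℂ, LocAC ψ ∧ MemLp (fun ξ => ψ ξ / (√(θ ξ) : ℝ)) 2 halfLine ∧
      ∀ᵐ ξ ∂halfLine, HasDerivAt ψ ((1 * l / θ ξ : ℝ) * ψ ξ - f ξ / (√(θ ξ) : ℝ)) ξ := by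
  set g : ℝ → ℂ := fun s => ((expTime θ (-l) s / √(θ s) : ℝ) : ℂ) * f s with hg
  have hgi : ∀ b, 0 ≤ b → IntervalIntegrable g volume 0 b := fun b hb =>
    intervalIntegrable_expTime_mul hθc hθ (-l) hf hb
  set K := (2 * l)⁻¹ + ∫ ξ, ‖f ξ‖ ^ 2 ∂halfLine with hK
  have hint : IntegrableOn g (Ioi 0) := by
    refine integrableOn_Ioi_of_intervalIntegral_norm_bounded (l := atTop) (b := fun k : ℕ => (k : ℝ))
      (expTime θ (-l) 0 * K) 0 (fun k => ?_) tendsto_natCast_atTop_atTop ?_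
    · exact (intervalIntegrable_iff_integrableOn_Ioc_of_le (Nat.cast_nonneg k)).1
        (hgi k (Nat.cast_nonneg k))
    · exact Eventually.of_forall fun k =>
        integral_expTime_le hθc hθ hl hf le_rfl (Nat.cast_nonneg k)
  -- This initial value removes the growing part: `a - ∫₀ᵇ g` becomes the tail of the integral,
  -- which decays like `e^{-lτ(b)}`.
  set a := ∫ s in Ioi 0, g s
  have hψ := locAC_transportSol hθc hθ (1 * l) hf a
  have hd := hasDerivAt_transportSol hθc hθ (1 * l) hf a
  have hbd : ∀ b, 0 ≤ b → ‖transportSol θ (1 * l) f a b‖ ≤ K := by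
    intro b hb
    have h1 : ‖a - ∫ s in (0 : ℝ)..b, g s‖ ≤ expTime θ (-l) b * K := by
      have ht := (intervalIntegral_tendsto_integral_Ioi 0 hint tendsto_id).sub_const
        (∫ s in (0 : ℝ)..b, g s)
      refine le_of_tendsto ht.norm ?_
      filter_upwards [eventually_ge_atTop b] with c hc
      have hc : b ≤ c := hc
      simp only [id]
      rw [intervalIntegral.integral_interval_sub_left (hgi c (hb.trans hc)) (hgi b hb)]
      exact (intervalIntegral.norm_integral_le_integral_norm hc).trans
        (integral_expTime_le hθc hθ hl hf hb hc)
    have hE := expTime_pos (θ := θ) l b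
    rw [transportSol, one_mul, norm_mul, Complex.norm_real, Real.norm_of_nonneg hE.le]
    calc expTime θ l b * ‖a - ∫ s in (0 : ℝ)..b, g s‖
        ≤ expTime θ l b * (expTime θ (-l) b * K) := by gcongr
      _ = K := by rw [← mul_assoc, expTime_mul_neg, one_mul]
  refine ⟨_, hψ, memLp_of_bounded_energy hθc hθ hψ
    (C := l⁻¹ * (K ^ 2 + l⁻¹ * ∫ ξ, ‖f ξ‖ ^ 2 ∂halfLine)) fun b hb => ?_, hd⟩
  have h := energy_estimate hθc hθ hl (by norm_num) hf hψ hd hb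
  have h2 : ‖transportSol θ (1 * l) f a b‖ ^ 2 ≤ K ^ 2 := by
    gcongr
    exact hbd b hb
  rw [le_inv_mul_iff₀ hl]
  nlinarith [sq_nonneg ‖transportSol θ (1 * l) f a 0‖]

omit hθc in
-- Integrate `(‖ψ‖²)' = 2 σ Re(k⋆ h)` over the half-axis. Boundedness of the speed, hypothesis (a),
-- makes `‖ψ‖² = θ ‖k‖²` integrable, which kills the boundary term at infinity.
theorem re_integral_inner_eq {M σ : ℝ} (hM : ∀ ξ, 0 ≤ ξ → θ ξ ≤ M) (hσ : σ ^ 2 = 1)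
    {k h ψ : ℝ → ℂ} (hk : MemLp k 2 halfLine) (hh : MemLp h 2 halfLine) (hψ : LocAC ψ)
    (hψk : ∀ᵐ ξ ∂halfLine, ψ ξ = (σ * √(θ ξ) : ℝ) * k ξ)
    (hd : ∀ᵐ ξ ∂halfLine, HasDerivAt ψ (h ξ / (√(θ ξ) : ℝ)) ξ) :
    (∫ ξ, star (k ξ) * h ξ ∂halfLine).re = -(σ * ‖ψ 0‖ ^ 2 / 2) := by
  have hmem : ∀ᵐ ξ ∂halfLine, ξ ∈ Ici (0 : ℝ) := ae_restrict_mem measurableSet_Ici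
  have hprod : Integrable (fun ξ => star (k ξ) * h ξ) halfLine := hk.star.integrable_mul hh
  set G : ℝ → ℝ := fun ξ => 2 * σ * (star (k ξ) * h ξ).re with hG
  have hGi : Integrable G halfLine := hprod.re.const_mul _
  have hdF : ∀ᵐ ξ ∂halfLine, HasDerivAt (fun ξ => ‖ψ ξ‖ ^ 2) (G ξ) ξ := by
    filter_upwards [hψk, hd, hmem] with ξ h1 h2 hξ
    refine (hasDerivAt_norm_sq h2).congr_deriv ?_
    have hr : (√(θ ξ) : ℂ) ≠ 0 := by exact_mod_cast (Real.sqrt_pos.2 (hθ ξ hξ)).ne'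
    have e : star (ψ ξ) * (h ξ / (√(θ ξ) : ℝ)) = (σ : ℂ) * (star (k ξ) * h ξ) := by
      rw [h1, star_mul', Complex.star_def, Complex.conj_ofReal]
      push_cast
      field_simp
    rw [e, Complex.re_ofReal_mul, hG]
    ring
  have hFint : Integrable (fun ξ => ‖ψ ξ‖ ^ 2) halfLine := by
    have hk2 : Integrable (fun ξ => M * ‖k ξ‖ ^ 2) halfLine :=
      ((memLp_two_iff_integrable_sq_norm hk.1).1 hk).const_mul M
    refine hk2.mono' (hψ.normSq.continuousOn.aestronglyMeasurable measurableSet_Ici) ?_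
    filter_upwards [hψk, hmem] with ξ h1 hξ
    rw [h1, norm_mul, Complex.norm_real, Real.norm_of_nonneg (by positivity), mul_pow,
      Real.norm_eq_abs, sq_abs, mul_pow, hσ, one_mul, Real.sq_sqrt (hθ ξ hξ).le]
    gcongr
    exact hM ξ hξ
  have hGi' : IntegrableOn G (Ioi 0) := hGi.mono_measure
    (Measure.restrict_mono Ioi_subset_Ici_self le_rfl)
  have hlim : Tendsto (fun b => ‖ψ b‖ ^ 2) atTop (𝓝 (‖ψ 0‖ ^ 2 + ∫ ξ in Ioi 0, G ξ)) := by
    have h1 := (intervalIntegral_tendsto_integral_Ioi 0 hGi' tendsto_id).const_add (‖ψ 0‖ ^ 2)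
    refine h1.congr' ?_
    filter_upwards [eventually_ge_atTop 0] with b hb
    have := (hψ.normSq.integral_eq_sub hdF hb).2
    simp only [id]
    rw [this]
    ring
  -- An integrable function that converges at infinity has limit `0`, since every neighbourhood of
  -- infinity has infinite measure.
  have hzero : ‖ψ 0‖ ^ 2 + ∫ ξ in Ioi 0, G ξ = 0 := by
    refine IntegrableAtFilter.eq_zero_of_tendsto (μ := volume) (l := atTop)
      ⟨Ici 0, Ici_mem_atTop 0, hFint⟩ ?_ hlim
    intro s hs
    rcases mem_atTop_sets.1 hs with ⟨b, hb⟩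
    rw [← top_le_iff, ← Real.volume_Ici (a := b)]
    exact measure_mono hb
  have hI : ∫ ξ in Ioi 0, G ξ = 2 * σ * (∫ ξ, star (k ξ) * h ξ ∂halfLine).re := by
    rw [← integral_Ici_eq_integral_Ioi, hG, integral_const_mul]
    congr 1
    exact integral_re hprod
  rw [hI] at hzero
  linear_combination (σ / 2) * hzero - (∫ ξ, star (k ξ) * h ξ ∂halfLine).re * hσ

end Scalar

/-! ### The diagonal transport relation -/

/-- The Hilbert space `L²(0,∞; ℂⁿ)`. -/
abbrev UnweightedL2 (n : ℕ) : Type := PiLp 2 fun _ : Fin n => Lp ℂ 2 halfLine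

section Transport

variable {n : ℕ}

/-- The decoupled transport equations with speeds `σ i * θ i` and boundary space `V`, in the
coordinates `ψ i = σ i √(θ i) k i`. -/
def transportRel (σ : Fin n → ℝ) (θ : Fin n → ℝ → ℝ) (V : Submodule ℂ (Fin n → ℂ)) :
    Submodule ℂ (UnweightedL2 n × UnweightedL2 n) where
  carrier := {q | ∃ ψ : Fin n → ℝ → ℂ, (∀ i, LocAC (ψ i)) ∧
    (∀ i, ∀ᵐ ξ ∂halfLine, ψ i ξ = (σ i * √(θ i ξ) : ℝ) * q.1 i ξ) ∧
    (∀ i, ∀ᵐ ξ ∂halfLine, HasDerivAt (ψ i) (q.2 i ξ / (√(θ i ξ) : ℝ)) ξ) ∧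
    (fun i => ψ i 0) ∈ V}
  add_mem' := by
    rintro p q ⟨φ, h1, h2, h3, h4⟩ ⟨ψ, g1, g2, g3, g4⟩
    refine ⟨fun i ξ => φ i ξ + ψ i ξ, fun i => (h1 i).add (g1 i), fun i => ?_, fun i => ?_,
      V.add_mem h4 g4⟩
    · filter_upwards [h2 i, g2 i, Lp.coeFn_add (p.1 i) (q.1 i)] with ξ a b c
      change _ = _ * (p.1 i + q.1 i : Lp ℂ 2 halfLine) ξ
      rw [c, a, b, Pi.add_apply, mul_add]
    · filter_upwards [h3 i, g3 i, Lp.coeFn_add (p.2 i) (q.2 i)] with ξ a b c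
      refine (a.add b).congr_deriv ?_
      change _ = (p.2 i + q.2 i : Lp ℂ 2 halfLine) ξ / _
      rw [c, Pi.add_apply, add_div]
  zero_mem' := by
    refine ⟨fun i _ => 0, fun i => locAC_const 0, fun i => ?_, fun i => ?_, V.zero_mem⟩
    · filter_upwards [Lp.coeFn_zero ℂ 2 halfLine] with ξ a
      change _ = _ * (0 : Lp ℂ 2 halfLine) ξ
      rw [a]
      simp
    · filter_upwards [Lp.coeFn_zero ℂ 2 halfLine] with ξ a
      change HasDerivAt _ ((0 : Lp ℂ 2 halfLine) ξ / _) _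
      rw [a]
      simpa using hasDerivAt_const ξ (0 : ℂ)
  smul_mem' := by
    rintro c p ⟨φ, h1, h2, h3, h4⟩
    refine ⟨fun i ξ => c * φ i ξ, fun i => (h1 i).const_mul c, fun i => ?_, fun i => ?_,
      V.smul_mem c h4⟩
    · filter_upwards [h2 i, Lp.coeFn_smul c (p.1 i)] with ξ a b
      change _ = _ * (c • p.1 i : Lp ℂ 2 halfLine) ξ
      rw [b, a, Pi.smul_apply, smul_eq_mul]
      ring
    · filter_upwards [h3 i, Lp.coeFn_smul c (p.2 i)] with ξ a b
      refine (a.const_mul c).congr_deriv ?_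
      change _ = (c • p.2 i : Lp ℂ 2 halfLine) ξ / _
      rw [b, Pi.smul_apply, smul_eq_mul, mul_div_assoc]

variable {σ : Fin n → ℝ} {θ : Fin n → ℝ → ℝ} {V : Submodule ℂ (Fin n → ℂ)}

theorem LocAC.hasDerivAt_zero_of_ae {ψ : ℝ → ℂ} (hψ : LocAC ψ)
    (h : ∀ᵐ ξ ∂halfLine, ψ ξ = 0) {ξ : ℝ} (hξ : 0 < ξ) : HasDerivAt ψ 0 ξ := by
  have h0 := LocAC.eq_zero_of_ae (n := 1) (u := fun ξ _ => ψ ξ) (locAC_pi fun _ => hψ)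
    (h.mono fun ξ h => funext fun _ => h)
  refine (hasDerivAt_const ξ (0 : ℂ)).congr_of_eventuallyEq ?_
  filter_upwards [lt_mem_nhds hξ] with z hz
  exact congrFun (h0 z hz) 0

theorem LocAC.apply_zero_of_ae {ψ : ℝ → ℂ} (hψ : LocAC ψ)
    (h : ∀ᵐ ξ ∂halfLine, ψ ξ = 0) : ψ 0 = 0 := by
  have h0 := LocAC.eq_zero_of_ae (n := 1) (u := fun ξ _ => ψ ξ) (locAC_pi fun _ => hψ)
    (h.mono fun ξ h => funext fun _ => h)
  have h1 : Tendsto ψ (𝓝[>] 0) (𝓝 (ψ 0)) :=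
    (hψ.continuousOn 0 self_mem_Ici).mono_left (nhdsWithin_mono _ Ioi_subset_Ici_self)
  refine tendsto_nhds_unique h1 (tendsto_const_nhds.congr' ?_)
  filter_upwards [self_mem_nhdsWithin] with z hz
  exact (congrFun (h0 z hz) 0).symm

/-- For `s = 1` the wave leaves at `0`, and the boundary value `b` is that of the solution without
growing part. For `s = -1` the wave enters and its boundary value is free; `b` is then a dummy. -/
theorem exists_component_solution {s : ℝ} (hs : s = 1 ∨ s = -1) {ϑ : ℝ → ℝ}
    (hθc : ContinuousOn ϑ (Ici 0)) (hθ : ∀ ξ, 0 ≤ ξ → 0 < ϑ ξ) {l : ℝ} (hl : 0 < l)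
    (f : Lp ℂ 2 halfLine) :
    ∃ b : ℂ, ∀ a : ℂ, (s = 1 → a = b) → ∃ (k : Lp ℂ 2 halfLine) (ψ : ℝ → ℂ), LocAC ψ ∧ ψ 0 = a ∧
      (∀ᵐ ξ ∂halfLine, ψ ξ = (s * √(ϑ ξ) : ℝ) * k ξ) ∧
      ∀ᵐ ξ ∂halfLine, HasDerivAt ψ (((l : ℂ) • k - f : Lp ℂ 2 halfLine) ξ / (√(ϑ ξ) : ℝ)) ξ := by
  have hs2 : s * s = 1 := by rcases hs with rfl | rfl <;> norm_num
  have hmem : ∀ᵐ ξ ∂halfLine, ξ ∈ Ici (0 : ℝ) := ae_restrict_mem measurableSet_Ici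
  have build : ∀ ψ : ℝ → ℂ, LocAC ψ → MemLp (fun ξ => ψ ξ / (√(ϑ ξ) : ℝ)) 2 halfLine →
      (∀ᵐ ξ ∂halfLine, HasDerivAt ψ ((s * l / ϑ ξ : ℝ) * ψ ξ - f ξ / (√(ϑ ξ) : ℝ)) ξ) →
      ∃ (k : Lp ℂ 2 halfLine) (φ : ℝ → ℂ), LocAC φ ∧ φ 0 = ψ 0 ∧
      (∀ᵐ ξ ∂halfLine, φ ξ = (s * √(ϑ ξ) : ℝ) * k ξ) ∧
      ∀ᵐ ξ ∂halfLine, HasDerivAt φ (((l : ℂ) • k - f : Lp ℂ 2 halfLine) ξ / (√(ϑ ξ) : ℝ)) ξ := by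
    intro ψ hψ hm hd
    have hm' : MemLp (fun ξ => (s : ℂ) * (ψ ξ / (√(ϑ ξ) : ℝ))) 2 halfLine := hm.const_mul _
    have hsc : (s : ℂ) * s = 1 := by exact_mod_cast hs2
    refine ⟨hm'.toLp, ψ, hψ, rfl, ?_, ?_⟩
    · filter_upwards [hm'.coeFn_toLp, hmem] with ξ h1 hξ
      have hr : (√(ϑ ξ) : ℂ) ≠ 0 := by exact_mod_cast (Real.sqrt_pos.2 (hθ ξ hξ)).ne'
      rw [h1]
      push_cast
      field_simp
      linear_combination -ψ ξ * hsc
    · filter_upwards [hm'.coeFn_toLp, hmem, hd, Lp.coeFn_sub ((l : ℂ) • hm'.toLp) f,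
        Lp.coeFn_smul (l : ℂ) hm'.toLp] with ξ h1 hξ h2 h3 h4
      refine h2.congr_deriv ?_
      rw [h3, Pi.sub_apply, h4, Pi.smul_apply, h1, smul_eq_mul]
      have hr : (√(ϑ ξ) : ℂ) ≠ 0 := by exact_mod_cast (Real.sqrt_pos.2 (hθ ξ hξ)).ne'
      have hr2 : ((ϑ ξ : ℝ) : ℂ) = (√(ϑ ξ) : ℂ) ^ 2 := by
        exact_mod_cast (Real.sq_sqrt (hθ ξ hξ).le).symm
      push_cast
      rw [hr2]
      field_simp
  rcases hs with rfl | rfl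
  · obtain ⟨ψ, h1, h2, h3⟩ := exists_solution_pos hθc hθ hl (Lp.memLp f)
    refine ⟨ψ 0, fun a ha => ?_⟩
    rw [ha rfl]
    exact build ψ h1 h2 h3
  · refine ⟨0, fun a _ => ?_⟩
    obtain ⟨ψ, h1, h0, h2, h3⟩ := exists_solution_neg hθc hθ hl (Lp.memLp f) a
    rw [← h0]
    exact build ψ h1 h2 h3

/-- By `re_integral_inner_eq`, dissipativity is nonnegativity of the signed boundary form on `V`.
The components of the resolvent equation are solved separately: the leaving ones impose their
boundary values, and `hVs` completes these to an element of `V`. -/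
theorem isMDissipative_transportRel (hθc : ∀ i, ContinuousOn (θ i) (Ici 0))
    (hθ : ∀ i ξ, 0 ≤ ξ → 0 < θ i ξ) {M : ℝ} (hM : ∀ i ξ, 0 ≤ ξ → θ i ξ ≤ M)
    (hσ : ∀ i, σ i = 1 ∨ σ i = -1)
    (hV : ∀ v ∈ V, 0 ≤ ∑ i, σ i * ‖v i‖ ^ 2)
    (hVs : ∀ a : Fin n → ℂ, ∃ v ∈ V, ∀ i, σ i = 1 → v i = a i) :
    IsMDissipative (transportRel σ θ V) where
  dissipative := by
    rintro ⟨k, h⟩ ⟨ψ, h1, h2, h3, h4⟩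
    have key : ∀ i, (inner ℂ (k i) (h i)).re = -(σ i * ‖ψ i 0‖ ^ 2 / 2) := by
      intro i
      have hs : σ i ^ 2 = 1 := by rcases hσ i with h | h <;> simp [h]
      rw [← re_integral_inner_eq (hθ i) (hM i) hs (Lp.memLp (k i)) (Lp.memLp (h i))
        (h1 i) (h2 i) (h3 i), L2.inner_def]
      congr 1
      refine integral_congr_ae (Eventually.of_forall fun ξ => ?_)
      exact mul_comm _ _
    simp only [PiLp.inner_apply, Complex.re_sum, key]
    rw [Finset.sum_neg_distrib, ← Finset.sum_div]
    have := hV _ h4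
    linarith
  range := by
    intro l hl f
    choose a ha using fun i => exists_component_solution (hσ i) (hθc i) (hθ i) hl (f i)
    obtain ⟨v, hvV, hv⟩ := hVs a
    choose k ψ h1 h2 h3 h4 using fun i => ha i (v i) (hv i)
    refine ⟨(WithLp.toLp 2 k, (l : ℂ) • WithLp.toLp 2 k - f), ⟨ψ, h1, h3, h4, ?_⟩,
      sub_sub_cancel _ _⟩
    rwa [funext h2]
  singleValued := by
    rintro y ⟨ψ, h1, h2, h3, -⟩
    refine PiLp.ext fun i => Lp.ext ?_
    have hz : ∀ᵐ ξ ∂halfLine, ψ i ξ = 0 := by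
      filter_upwards [h2 i, Lp.coeFn_zero ℂ 2 halfLine] with ξ a b
      rw [a]
      change _ * (0 : Lp ℂ 2 halfLine) ξ = 0
      rw [b, Pi.zero_apply, mul_zero]
    filter_upwards [h3 i, Lp.coeFn_zero ℂ 2 halfLine, ae_halfLine_of_forall (p := fun ξ => 0 < ξ)
      fun ξ h => h] with ξ a b hξ
    have h5 := a.unique ((h1 i).hasDerivAt_zero_of_ae hz hξ)
    have hr : (√(θ i ξ) : ℂ) ≠ 0 := by exact_mod_cast (Real.sqrt_pos.2 (hθ i ξ hξ.le)).ne'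
    change y i ξ = (0 : Lp ℂ 2 halfLine) ξ
    rw [b]
    exact (div_eq_zero_iff.1 h5).resolve_right hr

/-- Boundary values without outgoing part give rise to eigenvectors for all positive numbers. -/
theorem exists_eigenvector_transportRel (hθc : ∀ i, ContinuousOn (θ i) (Ici 0))
    (hθ : ∀ i ξ, 0 ≤ ξ → 0 < θ i ξ) (hσ : ∀ i, σ i = 1 ∨ σ i = -1) {v : Fin n → ℂ}
    (hvV : v ∈ V) (hv0 : v ≠ 0) (hv : ∀ i, σ i = 1 → v i = 0) {l : ℝ} (hl : 0 < l) :
    ∃ k, k ≠ 0 ∧ (k, (l : ℂ) • k) ∈ transportRel σ θ V := by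
  have hex : ∀ i, ∃ (k : Lp ℂ 2 halfLine) (ψ : ℝ → ℂ), LocAC ψ ∧ ψ 0 = v i ∧
      (∀ᵐ ξ ∂halfLine, ψ ξ = (σ i * √(θ i ξ) : ℝ) * k ξ) ∧
      ∀ᵐ ξ ∂halfLine, HasDerivAt ψ (((l : ℂ) • k : Lp ℂ 2 halfLine) ξ / (√(θ i ξ) : ℝ)) ξ := by
    intro i
    by_cases h : σ i = 1
    · refine ⟨0, fun _ => 0, locAC_const 0, (hv i h).symm, ?_, ?_⟩
      · filter_upwards [Lp.coeFn_zero ℂ 2 halfLine] with ξ a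
        rw [a, Pi.zero_apply, mul_zero]
      · filter_upwards [Lp.coeFn_zero ℂ 2 halfLine] with ξ a
        rw [smul_zero, a, Pi.zero_apply, zero_div]
        exact hasDerivAt_const ξ (0 : ℂ)
    · obtain ⟨b, hb⟩ := exists_component_solution (hσ i) (hθc i) (hθ i) hl 0
      simpa only [sub_zero] using hb (v i) fun h' => absurd h' h
  choose k ψ h1 h2 h3 h4 using hex
  refine ⟨WithLp.toLp 2 k, fun hk => hv0 (funext fun i => ?_), ψ, h1, h3, h4, ?_⟩
  · rw [← h2 i]
    refine (h1 i).apply_zero_of_ae ?_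
    have hki : k i = 0 := congrArg (fun q : UnweightedL2 n => q i) hk
    filter_upwards [h3 i, Lp.coeFn_zero ℂ 2 halfLine] with ξ a b
    rw [a, hki, b, Pi.zero_apply, mul_zero]
  · rwa [funext h2]

end Transport

/-! ### Linear algebra: inertia and the boundary matrix -/

section Inertia

variable {n : ℕ}

/-- On vectors `y` supported where `d < 0`, the form of `d` is negative definite. If `W y` vanishes
where `e < 0`, the same form is nonnegative, so `y = 0`. Hence one coordinate space embeds into the
other; invertibility of `W` plays no role. -/
theorem card_neg_le_of_diagonal_congr {d e : Fin n → ℝ} {W : Matrix (Fin n) (Fin n) ℂ}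
    (h : Matrix.conjTranspose W * Matrix.diagonal (fun i => (e i : ℂ)) * W
      = Matrix.diagonal fun i => (d i : ℂ)) :
    Fintype.card {i // d i < 0} ≤ Fintype.card {i // e i < 0} := by
  classical
  let ext : ({i // d i < 0} → ℂ) →ₗ[ℂ] (Fin n → ℂ) :=
    { toFun := fun z i => if hi : d i < 0 then z ⟨i, hi⟩ else 0
      map_add' := fun z w => by
        funext i
        by_cases hi : d i < 0 <;> simp [hi]
      map_smul' := fun c z => by
        funext i
        by_cases hi : d i < 0 <;> simp [hi] }
  let L : ({i // d i < 0} → ℂ) →ₗ[ℂ] ({i // e i < 0} → ℂ) :=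
    (LinearMap.funLeft ℂ ℂ Subtype.val) ∘ₗ (Matrix.mulVecLin W) ∘ₗ ext
  have hquad : ∀ (c : Fin n → ℝ) (y : Fin n → ℂ),
      star y ⬝ᵥ (Matrix.diagonal (fun i => (c i : ℂ))).mulVec y
        = ((∑ i, c i * ‖y i‖ ^ 2 : ℝ) : ℂ) := by
    intro c y
    rw [dotProduct, Complex.ofReal_sum]
    refine Finset.sum_congr rfl fun i _ => ?_
    rw [Matrix.mulVec_diagonal, Pi.star_apply, mul_left_comm, Complex.star_def,
      ← Complex.normSq_eq_conj_mul_self, Complex.normSq_eq_norm_sq]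
    push_cast
    ring
  have hinj : Function.Injective L := by
    rw [injective_iff_map_eq_zero]
    intro z hz
    set y := ext z with hy
    have h1 : ∀ i, e i < 0 → W.mulVec y i = 0 := fun i hi => congrFun hz ⟨i, hi⟩
    have h2 : ∑ i, d i * ‖y i‖ ^ 2 = ∑ i, e i * ‖W.mulVec y i‖ ^ 2 := by
      have := hquad e (W.mulVec y)
      rw [Matrix.star_mulVec, ← Matrix.dotProduct_mulVec, Matrix.mulVec_mulVec,
        Matrix.mulVec_mulVec, h, hquad d y] at this
      exact_mod_cast this
    have h3 : 0 ≤ ∑ i, d i * ‖y i‖ ^ 2 := by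
      rw [h2]
      refine Finset.sum_nonneg fun i _ => ?_
      by_cases hi : e i < 0
      · simp [h1 i hi]
      · exact mul_nonneg (not_lt.1 hi) (by positivity)
    have h4 : ∀ i, d i * ‖y i‖ ^ 2 ≤ 0 := fun i => by
      by_cases hi : d i < 0
      · exact mul_nonpos_of_nonpos_of_nonneg hi.le (by positivity)
      · simp [hy, ext, hi]
    have h5 := (Finset.sum_eq_zero_iff_of_nonpos fun i _ => h4 i).1
      (le_antisymm (Finset.sum_nonpos fun i _ => h4 i) h3)
    funext i
    have h6 := h5 i (Finset.mem_univ _)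
    have h7 : y i = 0 := by
      rcases mul_eq_zero.1 h6 with h | h
      · exact absurd h i.2.ne
      · simpa using h
    have h8 : y i = z i := by
      change (if hi : d i < 0 then z ⟨i, hi⟩ else 0) = z i
      rw [dif_pos i.2]
    rw [← h8, h7, Pi.zero_apply]
  have := LinearMap.finrank_le_finrank_of_injective hinj
  simpa using this

theorem exists_unitary_diagonalization {A : Matrix (Fin n) (Fin n) ℂ} (hA : A.IsHermitian) :
    ∃ U : Matrix (Fin n) (Fin n) ℂ, U * Matrix.conjTranspose U = 1 ∧
      Matrix.conjTranspose U * A * U = Matrix.diagonal fun i => (hA.eigenvalues i : ℂ) := by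
  refine ⟨hA.eigenvectorUnitary, Unitary.coe_mul_star_self _, ?_⟩
  have h := hA.conjStarAlgAut_star_eigenvectorUnitary
  rw [Unitary.conjStarAlgAut_star_apply] at h
  exact h

theorem card_neg_eigenvalues_le {A B W : Matrix (Fin n) (Fin n) ℂ} (hA : A.IsHermitian)
    (hB : B.IsHermitian) (h : Matrix.conjTranspose W * A * W = B) :
    Fintype.card {i // hB.eigenvalues i < 0} ≤ Fintype.card {i // hA.eigenvalues i < 0} := by
  obtain ⟨U, hU, hUd⟩ := exists_unitary_diagonalization hA
  obtain ⟨V, hV, hVd⟩ := exists_unitary_diagonalization hB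
  refine card_neg_le_of_diagonal_congr (W := Matrix.conjTranspose U * W * V) ?_
  rw [← hUd, ← hVd, ← h]
  simp only [Matrix.conjTranspose_mul, Matrix.conjTranspose_conjTranspose, Matrix.mul_assoc]
  rw [← Matrix.mul_assoc U, hU, Matrix.one_mul, ← Matrix.mul_assoc U (Matrix.conjTranspose U), hU,
    Matrix.one_mul]

open scoped MatrixOrder in
/-- **Sylvester's law of inertia** for the product of a Hermitian matrix and a positive definite
one. -/
theorem eigenvalues_mul_posDef {P H S D : Matrix (Fin n) (Fin n) ℂ} (hP : P.IsHermitian)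
    (hH : H.PosDef) (hS : IsUnit S) (hD : D.IsDiag) (h : P * H = S⁻¹ * D * S) :
    (∀ i, D i i = ((D i i).re : ℂ)) ∧
      Fintype.card {i // (D i i).re < 0} = Fintype.card {i // hP.eigenvalues i < 0} := by
  classical
  obtain ⟨B, hB⟩ := CStarAlgebra.nonneg_iff_eq_star_mul_self.mp hH.posSemidef.nonneg
  rw [Matrix.star_eq_conjTranspose] at hB
  have hSdet : IsUnit S.det := (Matrix.isUnit_iff_isUnit_det _).1 hS
  have hBdet : IsUnit B.det := by
    have h1 := (Matrix.isUnit_iff_isUnit_det _).1 hH.isUnit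
    rw [hB, Matrix.det_mul] at h1
    exact isUnit_of_mul_isUnit_right h1
  have hQ : (B * P * Matrix.conjTranspose B).IsHermitian :=
    Matrix.isHermitian_mul_mul_conjTranspose B hP
  -- With `H = B⋆ B`, the matrices `P H` and `B P B⋆` have the same characteristic polynomial. Thus
  -- the diagonal entries of `D` are the eigenvalues of a Hermitian matrix that is congruent to `P`.
  have hroots : Multiset.map (fun i => D i i) Finset.univ.val
      = Multiset.map (fun i => (hQ.eigenvalues i : ℂ)) Finset.univ.val := by
    have h1 : (B * P * Matrix.conjTranspose B).charpoly = D.charpoly := by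
      rw [Matrix.mul_assoc, Matrix.charpoly_mul_comm, Matrix.mul_assoc, ← hB, h,
        Matrix.charpoly_mul_comm, ← Matrix.mul_assoc, Matrix.mul_nonsing_inv _ hSdet,
        Matrix.one_mul]
    have h2 := hQ.roots_charpoly_eq_eigenvalues
    rw [h1, ← hD.diagonal_diag, Matrix.charpoly_diagonal, Polynomial.roots_prod _ _
      (Finset.prod_ne_zero_iff.2 fun i _ => Polynomial.X_sub_C_ne_zero _)] at h2
    simpa [Function.comp_def] using h2
  refine ⟨fun i => ?_, ?_⟩
  · have h1 : D i i ∈ Multiset.map (fun i => D i i) Finset.univ.val :=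
      Multiset.mem_map_of_mem _ (Finset.mem_univ i)
    rw [hroots, Multiset.mem_map] at h1
    obtain ⟨j, -, hj⟩ := h1
    rw [← hj, Complex.ofReal_re]
  · have h1 : Fintype.card {i // (D i i).re < 0} = Fintype.card {i // hQ.eigenvalues i < 0} := by
      have h2 := congrArg (Multiset.countP fun z : ℂ => z.re < 0) hroots
      rw [Multiset.countP_map, Multiset.countP_map] at h2
      rw [Fintype.card_subtype, Fintype.card_subtype]
      simpa using! h2
    rw [h1]
    refine le_antisymm (card_neg_eigenvalues_le (W := Matrix.conjTranspose B) hP hQ ?_)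
      (card_neg_eigenvalues_le (W := Matrix.conjTranspose B⁻¹) hQ hP ?_)
    · rw [Matrix.conjTranspose_conjTranspose]
    · have h3 : B⁻¹ * B = 1 := Matrix.nonsing_inv_mul _ hBdet
      have h4 : Matrix.conjTranspose B * Matrix.conjTranspose B⁻¹ = 1 := by
        rw [← Matrix.conjTranspose_mul, h3, Matrix.conjTranspose_one]
      rw [Matrix.conjTranspose_conjTranspose]
      calc B⁻¹ * (B * P * Matrix.conjTranspose B) * Matrix.conjTranspose B⁻¹
          = (B⁻¹ * B) * P * (Matrix.conjTranspose B * Matrix.conjTranspose B⁻¹) := by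
            simp only [Matrix.mul_assoc]
        _ = P := by rw [h3, h4, Matrix.one_mul, Matrix.mul_one]

end Inertia

/-! ### The boundary block and the negative eigenspace -/

section Boundary

variable {n p : ℕ}

theorem exists_inverse_iff_injective {ι : Type*} [Fintype ι] [DecidableEq ι]
    (hcard : Fintype.card ι = p) (U : Matrix (Fin p) ι ℂ) :
    (∃ V : Matrix ι (Fin p) ℂ, U * V = 1 ∧ V * U = 1) ↔ Function.Injective U.mulVec := by
  constructor
  · rintro ⟨V, -, hVU⟩ x y hxy
    have := congrArg V.mulVec hxy
    simpa only [Matrix.mulVec_mulVec, hVU, Matrix.one_mulVec] using this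
  · intro hinj
    have hfr : Module.finrank ℂ (ι → ℂ) = Module.finrank ℂ (Fin p → ℂ) := by simp [hcard]
    have hb : Function.Bijective (Matrix.toLin' U) :=
      ⟨hinj, (LinearMap.injective_iff_surjective_of_finrank_eq_finrank hfr).1 hinj⟩
    let e := LinearEquiv.ofBijective (Matrix.toLin' U) hb
    refine ⟨LinearMap.toMatrix' (e.symm : (Fin p → ℂ) →ₗ[ℂ] (ι → ℂ)), ?_, ?_⟩
    · apply Matrix.toLin'.injective
      rw [Matrix.toLin'_mul, Matrix.toLin'_toMatrix', Matrix.toLin'_one]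
      exact LinearMap.ext fun y => e.apply_symm_apply y
    · apply Matrix.toLin'.injective
      rw [Matrix.toLin'_mul, Matrix.toLin'_toMatrix', Matrix.toLin'_one]
      exact LinearMap.ext fun y => e.symm_apply_apply y

theorem injective_mulVec_iff_surjective {ι : Type*} [Fintype ι] [DecidableEq ι]
    (hcard : Fintype.card ι = p) (U : Matrix (Fin p) ι ℂ) :
    Function.Injective U.mulVec ↔ Function.Surjective U.mulVec :=
  LinearMap.injective_iff_surjective_of_finrank_eq_finrank (f := Matrix.toLin' U)
    (by simp [hcard])

/-- The extension by zero of a vector indexed by the negative entries of `D`. -/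
def extendNeg (D : Matrix (Fin n) (Fin n) ℂ) (z : {i : Fin n // (D i i).re < 0} → ℂ) (i : Fin n) :
    ℂ :=
  if hi : (D i i).re < 0 then z ⟨i, hi⟩ else 0

theorem negBlock_mulVec (D : Matrix (Fin n) (Fin n) ℂ) (U : Matrix (Fin p) (Fin n) ℂ)
    (z : {i : Fin n // (D i i).re < 0} → ℂ) :
    (negBlock D U).mulVec z = U.mulVec (extendNeg D z) := by
  funext j
  simp only [Matrix.mulVec, dotProduct, negBlock, Matrix.submatrix_apply, id]
  rw [← Fintype.sum_subtype_add_sum_subtype (fun i => (D i i).re < 0)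
    (fun i => U j i * extendNeg D z i)]
  rw [Finset.sum_eq_zero (s := (Finset.univ : Finset {i // ¬ (D i i).re < 0}))
    fun i _ => by simp [extendNeg, i.2], add_zero]
  exact Finset.sum_congr rfl fun i _ => by simp [extendNeg, i.2]

theorem extendNeg_restrict {D : Matrix (Fin n) (Fin n) ℂ} {y : Fin n → ℂ}
    (hy : ∀ i, ¬ (D i i).re < 0 → y i = 0) : extendNeg D (fun i => y i) = y := by
  funext i
  by_cases hi : (D i i).re < 0
  · simp [extendNeg, hi]
  · simp [extendNeg, hi, hy i hi]

/-- `S` maps the negative eigenspan of `M` onto the vectors supported on the negative entries of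
`D`, and `K S⁻¹` acts on those vectors through its negative block. -/
theorem map_negEigenspan_eq_top_iff {M S D : Matrix (Fin n) (Fin n) ℂ} (hS : IsUnit S)
    (hD : D.IsDiag) (hDr : ∀ i, D i i = ((D i i).re : ℂ)) (h : M = S⁻¹ * D * S)
    (K : Matrix (Fin p) (Fin n) ℂ) :
    (negEigenspan M).map (Matrix.toLin' K) = ⊤ ↔
      Function.Surjective (negBlock D (K * S⁻¹)).mulVec := by
  have hSdet : IsUnit S.det := (Matrix.isUnit_iff_isUnit_det _).1 hS
  have hDv : ∀ y i, D.mulVec y i = D i i * y i := fun y i => by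
    nth_rewrite 1 [← hD.diagonal_diag]
    rw [Matrix.mulVec_diagonal]
    rfl
  -- For an eigenvector with eigenvalue `r < 0`, `(D i i - r) (S v) i = 0`, so the coordinates at
  -- nonnegative entries vanish.
  have hspan : ∀ v ∈ negEigenspan M, ∀ i, ¬ (D i i).re < 0 → S.mulVec v i = 0 := by
    intro v hv
    induction hv using Submodule.span_induction with
    | mem v hv =>
      obtain ⟨r, hr, hv⟩ := hv
      intro i hi
      have h1 : M.mulVec v = (r : ℂ) • v := hv.apply_eq_smul
      have h2 : D.mulVec (S.mulVec v) = (r : ℂ) • S.mulVec v := by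
        rw [← Matrix.mulVec_smul, ← h1, h, Matrix.mulVec_mulVec, Matrix.mulVec_mulVec,
          ← Matrix.mul_assoc, ← Matrix.mul_assoc, Matrix.mul_nonsing_inv _ hSdet, Matrix.one_mul]
      have h3 := congrFun h2 i
      rw [hDv, Pi.smul_apply, smul_eq_mul, ← sub_eq_zero, ← sub_mul] at h3
      refine (mul_eq_zero.1 h3).resolve_left fun h4 => hi ?_
      rw [sub_eq_zero.1 h4, Complex.ofReal_re]
      exact hr
    | zero => simp
    | add x y _ _ hx hy =>
      intro i hi
      rw [Matrix.mulVec_add, Pi.add_apply, hx i hi, hy i hi, add_zero]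
    | smul c x _ hx =>
      intro i hi
      rw [Matrix.mulVec_smul, Pi.smul_apply, hx i hi, smul_zero]
  -- Conversely, the columns of `S⁻¹` at negative entries of `D` are eigenvectors of `M`.
  have hmem : ∀ z, S⁻¹.mulVec (extendNeg D z) ∈ negEigenspan M := by
    intro z
    have h1 : extendNeg D z = ∑ i : {i : Fin n // (D i i).re < 0}, z i • Pi.single i.1 (1 : ℂ) := by
      funext j
      rw [Finset.sum_apply]
      by_cases hj : (D j j).re < 0
      · rw [Finset.sum_eq_single ⟨j, hj⟩ (fun i _ hi => ?_) (by simp)]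
        · simp [extendNeg, hj]
        · have : j ≠ i.1 := fun hc => hi (Subtype.ext hc.symm)
          simp [this]
      · rw [Finset.sum_eq_zero fun i _ => ?_]
        · simp [extendNeg, hj]
        · have : j ≠ i.1 := fun hc => hj (hc ▸ i.2)
          simp [this]
    rw [h1, Matrix.mulVec_sum]
    refine Submodule.sum_mem _ fun i _ => ?_
    rw [Matrix.mulVec_smul]
    refine Submodule.smul_mem _ _ (Submodule.subset_span ⟨(D i i).re, i.2, ?_⟩)
    rw [Module.End.hasEigenvector_iff, Module.End.mem_eigenspace_iff]
    constructor
    · rw [Matrix.toLin'_apply, h, Matrix.mulVec_mulVec, Matrix.mul_assoc, Matrix.mul_assoc,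
        Matrix.mul_nonsing_inv _ hSdet, Matrix.mul_one, ← Matrix.mulVec_mulVec,
        ← Matrix.mulVec_smul]
      congr 1
      funext j
      rw [hDv, Pi.smul_apply, smul_eq_mul, ← hDr]
      rcases eq_or_ne j i with rfl | hj
      · rfl
      · simp [hj]
    · intro h0
      have h2 := congrArg S.mulVec h0
      rw [Matrix.mulVec_mulVec, Matrix.mul_nonsing_inv _ hSdet, Matrix.one_mulVec,
        Matrix.mulVec_zero] at h2
      have h3 := congrFun h2 i
      simp at h3
  rw [Submodule.eq_top_iff']
  refine forall_congr' fun w => ?_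
  rw [Submodule.mem_map]
  constructor
  · rintro ⟨v, hv, rfl⟩
    refine ⟨fun i => S.mulVec v i, ?_⟩
    rw [negBlock_mulVec, extendNeg_restrict (hspan v hv), Matrix.mulVec_mulVec, Matrix.mul_assoc,
      Matrix.nonsing_inv_mul _ hSdet, Matrix.mul_one, Matrix.toLin'_apply]
  · rintro ⟨z, rfl⟩
    refine ⟨_, hmem z, ?_⟩
    rw [negBlock_mulVec, Matrix.toLin'_apply, Matrix.mulVec_mulVec]

end Boundary

/-! ### Removing a diagonal weight -/

section Weight

variable {n : ℕ} {w : ℝ → Matrix (Fin n) (Fin n) ℂ} {θ : Fin n → ℝ → ℝ}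

theorem wForm_diagonal (x : ℝ → Fin n → ℂ) {ξ : ℝ}
    (h : w ξ = Matrix.diagonal fun i => (θ i ξ : ℂ)) :
    wForm w x x ξ = ((∑ i, θ i ξ * ‖x ξ i‖ ^ 2 : ℝ) : ℂ) := by
  rw [wForm, h, dotProduct, Complex.ofReal_sum]
  refine Finset.sum_congr rfl fun i _ => ?_
  rw [Matrix.mulVec_diagonal, Pi.star_apply, mul_left_comm, Complex.star_def,
    ← Complex.normSq_eq_conj_mul_self, Complex.normSq_eq_norm_sq]
  push_cast
  ring

theorem norm_sq_lp_eq (f : Lp ℂ 2 halfLine) : ‖f‖ ^ 2 = ∫ ξ, ‖f ξ‖ ^ 2 ∂halfLine := by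
  have h1 := inner_self_eq_norm_sq (𝕜 := ℂ) f
  have h2 : inner ℂ f f = ((∫ ξ, ‖f ξ‖ ^ 2 ∂halfLine : ℝ) : ℂ) := by
    rw [L2.inner_def, ← integral_complex_ofReal]
    refine integral_congr_ae (Eventually.of_forall fun ξ => ?_)
    simp
  rw [h2] at h1
  simpa using! h1.symm

variable (hw : IsWeight w) (hwθ : ∀ ξ, 0 ≤ ξ → w ξ = Matrix.diagonal fun i => (θ i ξ : ℂ))
  (hθc : ∀ i, ContinuousOn (θ i) (Ici 0)) (hθ : ∀ i ξ, 0 ≤ ξ → 0 < θ i ξ)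
include hw hwθ hθc hθ

theorem mem_L2Submodule_iff (x : ℝ →ₘ[halfLine] (Fin n → ℂ)) :
    x ∈ L2Submodule w ↔ ∀ i, Integrable (fun ξ => θ i ξ * ‖x ξ i‖ ^ 2) halfLine := by
  have hmem : ∀ᵐ ξ ∂halfLine, ξ ∈ Ici (0 : ℝ) := ae_restrict_mem measurableSet_Ici
  have hsum : wForm w x x =ᵐ[halfLine] fun ξ => ((∑ i, θ i ξ * ‖x ξ i‖ ^ 2 : ℝ) : ℂ) := by
    filter_upwards [hmem] with ξ hξ
    exact wForm_diagonal x (hwθ ξ hξ)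
  change Integrable (wForm (effWeight w) x x) halfLine ↔ _
  rw [effWeight_eq hw, integrable_congr hsum]
  have hxi : ∀ i, AEStronglyMeasurable (fun ξ => x ξ i) halfLine := fun i =>
    (continuous_apply i).comp_aestronglyMeasurable x.aestronglyMeasurable
  have hm : ∀ i, AEStronglyMeasurable (fun ξ => θ i ξ * ‖x ξ i‖ ^ 2) halfLine := fun i =>
    ((hθc i).aestronglyMeasurable measurableSet_Ici).mul ((hxi i).norm.pow 2)
  constructor
  · intro h i
    refine h.re.mono' (hm i) ?_
    filter_upwards [hmem] with ξ hξ
    have hnn : ∀ j, 0 ≤ θ j ξ * ‖x ξ j‖ ^ 2 := fun j =>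
      mul_nonneg (hθ j ξ hξ).le (by positivity)
    rw [Real.norm_of_nonneg (hnn i)]
    exact Finset.single_le_sum (f := fun j => θ j ξ * ‖x ξ j‖ ^ 2) (fun j _ => hnn j)
      (Finset.mem_univ i)
  · intro h
    exact (integrable_finsetSum Finset.univ fun i _ => h i).ofReal (𝕜 := ℂ)

theorem L2.norm_sq_eq_sum (x : L2 w) :
    ‖x‖ ^ 2 = ∑ i, ∫ ξ, θ i ξ * ‖x ξ i‖ ^ 2 ∂halfLine := by
  have hmem : ∀ᵐ ξ ∂halfLine, ξ ∈ Ici (0 : ℝ) := ae_restrict_mem measurableSet_Ici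
  have h := L2.norm_sq_eq hw x
  have h2 : ∫ ξ in Ici (0 : ℝ), star (x ξ) ⬝ᵥ (w ξ).mulVec (x ξ)
      = ((∫ ξ, ∑ i, θ i ξ * ‖x ξ i‖ ^ 2 ∂halfLine : ℝ) : ℂ) := by
    rw [← integral_complex_ofReal]
    refine integral_congr_ae ?_
    filter_upwards [hmem] with ξ hξ
    exact wForm_diagonal x (hwθ ξ hξ)
  rw [h2, Complex.ofReal_inj, integral_finsetSum] at h
  · exact h
  · exact fun i _ => (mem_L2Submodule_iff hw hwθ hθc hθ x.1).1 x.2 i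

theorem memLp_component (x : L2 w) (c : ℝ) (i : Fin n) :
    MemLp (fun ξ => ((c * √(θ i ξ) : ℝ) : ℂ) * x ξ i) 2 halfLine := by
  have hmem : ∀ᵐ ξ ∂halfLine, ξ ∈ Ici (0 : ℝ) := ae_restrict_mem measurableSet_Ici
  have hxi : AEStronglyMeasurable (fun ξ => x ξ i) halfLine :=
    (continuous_apply i).comp_aestronglyMeasurable x.toAE.aestronglyMeasurable
  have hs : ContinuousOn (fun ξ => ((c * √(θ i ξ) : ℝ) : ℂ)) (Ici 0) :=
    Complex.continuous_ofReal.comp_continuousOn (continuousOn_const.mul (hθc i).sqrt)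
  have hm : AEStronglyMeasurable (fun ξ => ((c * √(θ i ξ) : ℝ) : ℂ) * x ξ i) halfLine :=
    (hs.aestronglyMeasurable measurableSet_Ici).mul hxi
  rw [memLp_two_iff_integrable_sq_norm hm]
  refine (((mem_L2Submodule_iff hw hwθ hθc hθ x.1).1 x.2 i).const_mul (c ^ 2)).congr ?_
  filter_upwards [hmem] with ξ hξ
  rw [norm_mul, Complex.norm_real, mul_pow, Real.norm_eq_abs, sq_abs, mul_pow,
    Real.sq_sqrt (hθ i ξ hξ).le, mul_assoc]
  rfl

/-- A diagonal weight is removed by an isomorphism, with an additional scaling of the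
components. -/
theorem exists_weight_equiv {c : Fin n → ℝ} (hc : ∀ i, 0 < c i) :
    ∃ Ψ : L2 w ≃L[ℂ] UnweightedL2 n, ∀ x i,
      ∀ᵐ ξ ∂halfLine, Ψ x i ξ = ((c i * √(θ i ξ) : ℝ) : ℂ) * x ξ i := by
  have hmem : ∀ᵐ ξ ∂halfLine, ξ ∈ Ici (0 : ℝ) := ae_restrict_mem measurableSet_Ici
  have hm := fun x : L2 w => fun i => memLp_component hw hwθ hθc hθ x (c i) i
  let L : L2 w →ₗ[ℂ] UnweightedL2 n :=
    { toFun := fun x => WithLp.toLp 2 fun i => (hm x i).toLp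
      map_add' := fun x y => PiLp.ext fun i => Lp.ext (by
        change (hm (x + y) i).toLp =ᵐ[halfLine] ((hm x i).toLp + (hm y i).toLp : Lp ℂ 2 halfLine)
        filter_upwards [(hm (x + y) i).coeFn_toLp, (hm x i).coeFn_toLp, (hm y i).coeFn_toLp,
          Lp.coeFn_add (hm x i).toLp (hm y i).toLp, L2.coe_add x y] with ξ h1 h2 h3 h4 h5
        rw [h1, h4, Pi.add_apply, h2, h3, h5, Pi.add_apply, Pi.add_apply, mul_add])
      map_smul' := fun a x => PiLp.ext fun i => Lp.ext (by
        change (hm (a • x) i).toLp =ᵐ[halfLine] (a • (hm x i).toLp : Lp ℂ 2 halfLine)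
        filter_upwards [(hm (a • x) i).coeFn_toLp, (hm x i).coeFn_toLp,
          Lp.coeFn_smul a (hm x i).toLp, L2.coe_smul a x] with ξ h1 h2 h3 h4
        rw [h1, h3, Pi.smul_apply, h2, h4, Pi.smul_apply, Pi.smul_apply, smul_eq_mul, smul_eq_mul,
          mul_left_comm]) }
  have hL : ∀ x i, ∀ᵐ ξ ∂halfLine, L x i ξ = ((c i * √(θ i ξ) : ℝ) : ℂ) * x ξ i := fun x i =>
    (hm x i).coeFn_toLp
  have hne : ∀ i ξ, 0 ≤ ξ → ((c i * √(θ i ξ) : ℝ) : ℂ) ≠ 0 := fun i ξ hξ => by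
    exact_mod_cast (mul_pos (hc i) (Real.sqrt_pos.2 (hθ i ξ hξ))).ne'
  have hsurj : Function.Surjective L := by
    intro k
    have hgm : ∀ i, AEStronglyMeasurable (fun ξ => k i ξ / ((c i * √(θ i ξ) : ℝ) : ℂ)) halfLine := by
      intro i
      have hs : ContinuousOn (fun ξ => (((c i * √(θ i ξ) : ℝ) : ℂ))⁻¹) (Ici 0) :=
        (Complex.continuous_ofReal.comp_continuousOn
          (continuousOn_const.mul (hθc i).sqrt)).inv₀ fun ξ hξ => hne i ξ hξ
      simp only [div_eq_mul_inv]
      exact (Lp.aestronglyMeasurable (k i)).mul (hs.aestronglyMeasurable measurableSet_Ici)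
    have hg : AEStronglyMeasurable (fun ξ i => k i ξ / ((c i * √(θ i ξ) : ℝ) : ℂ)) halfLine :=
      (aemeasurable_pi_lambda _ fun i => (hgm i).aemeasurable).aestronglyMeasurable
    have hgL : AEEqFun.mk _ hg ∈ L2Submodule w := by
      rw [mem_L2Submodule_iff hw hwθ hθc hθ]
      intro i
      have h1 : Integrable (fun ξ => ‖k i ξ‖ ^ 2) halfLine :=
        (memLp_two_iff_integrable_sq_norm (Lp.aestronglyMeasurable (k i))).1 (Lp.memLp (k i))
      refine (h1.const_mul ((c i ^ 2)⁻¹)).congr ?_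
      filter_upwards [AEEqFun.coeFn_mk _ hg, hmem] with ξ h2 hξ
      have hpos := hθ i ξ hξ
      rw [h2, norm_div, Complex.norm_real, div_pow, Real.norm_eq_abs, sq_abs, mul_pow,
        Real.sq_sqrt hpos.le]
      have := hc i
      field_simp
    refine ⟨⟨AEEqFun.mk _ hg, hgL⟩, PiLp.ext fun i => Lp.ext ?_⟩
    filter_upwards [hL ⟨AEEqFun.mk _ hg, hgL⟩ i, AEEqFun.coeFn_mk _ hg, hmem] with ξ h1 h2 hξ
    rw [h1]
    change _ * (AEEqFun.mk _ hg) ξ i = _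
    rw [h2, mul_div_cancel₀ _ (hne i ξ hξ)]
  have hinj : Function.Injective L := by
    rw [injective_iff_map_eq_zero]
    intro x hx
    refine L2.ext_ae ?_
    have h1 : ∀ᵐ ξ ∂halfLine, ∀ i, L x i ξ = ((c i * √(θ i ξ) : ℝ) : ℂ) * x ξ i :=
      ae_all_iff.2 fun i => hL x i
    filter_upwards [h1, hmem, L2.coe_zero (w := w), Lp.coeFn_zero ℂ 2 halfLine] with ξ h2 hξ h3 h4
    rw [h3]
    funext i
    have h5 := h2 i
    rw [hx] at h5
    change (0 : Lp ℂ 2 halfLine) ξ = _ at h5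
    rw [h4, Pi.zero_apply, eq_comm, mul_eq_zero] at h5
    exact h5.resolve_left (hne i ξ hξ)
  have hnorm : ∀ x, ‖L x‖ ^ 2 = ∑ i, c i ^ 2 * ∫ ξ, θ i ξ * ‖x ξ i‖ ^ 2 ∂halfLine := by
    intro x
    rw [PiLp.norm_sq_eq_of_L2]
    refine Finset.sum_congr rfl fun i _ => ?_
    rw [norm_sq_lp_eq, ← integral_const_mul]
    refine integral_congr_ae ?_
    filter_upwards [hL x i, hmem] with ξ h1 hξ
    rw [h1, norm_mul, Complex.norm_real, mul_pow, Real.norm_eq_abs, sq_abs, mul_pow,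
      Real.sq_sqrt (hθ i ξ hξ).le, mul_assoc]
  have hann : ∀ (x : L2 w) i, 0 ≤ ∫ ξ, θ i ξ * ‖x ξ i‖ ^ 2 ∂halfLine := fun x i => by
    refine integral_nonneg_of_ae ?_
    filter_upwards [hmem] with ξ hξ
    exact mul_nonneg (hθ i ξ hξ).le (by positivity)
  have hsumle : ∀ d a : Fin n → ℝ, (∀ i, 0 ≤ d i) → (∀ i, 0 ≤ a i) →
      ∑ i, d i * a i ≤ (∑ i, d i) * ∑ i, a i := fun d a hd ha => by
    rw [Finset.sum_mul]
    refine Finset.sum_le_sum fun i _ => mul_le_mul_of_nonneg_left ?_ (hd i)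
    exact Finset.single_le_sum (fun j _ => ha j) (Finset.mem_univ i)
  let e := LinearEquiv.ofBijective L ⟨hinj, hsurj⟩
  have hto : ∀ x, ‖e x‖ ≤ √(∑ i, c i ^ 2) * ‖x‖ := by
    intro x
    refine (sq_le_sq₀ (norm_nonneg _) (by positivity)).1 ?_
    rw [mul_pow, Real.sq_sqrt (Finset.sum_nonneg fun i _ => sq_nonneg _),
      L2.norm_sq_eq_sum hw hwθ hθc hθ]
    exact (hnorm x).trans_le (hsumle _ _ (fun i => sq_nonneg _) (hann x))
  have hinv : ∀ k, ‖e.symm k‖ ≤ √(∑ i, (c i ^ 2)⁻¹) * ‖k‖ := by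
    intro k
    obtain ⟨x, rfl⟩ := e.surjective k
    rw [LinearEquiv.symm_apply_apply]
    refine (sq_le_sq₀ (norm_nonneg _) (by positivity)).1 ?_
    rw [mul_pow, Real.sq_sqrt (Finset.sum_nonneg fun i _ => by positivity),
      L2.norm_sq_eq_sum hw hwθ hθc hθ]
    have h1 : ‖e x‖ ^ 2 = _ := hnorm x
    rw [h1]
    calc ∑ i, ∫ ξ, θ i ξ * ‖x ξ i‖ ^ 2 ∂halfLine
        = ∑ i, (c i ^ 2)⁻¹ * (c i ^ 2 * ∫ ξ, θ i ξ * ‖x ξ i‖ ^ 2 ∂halfLine) := by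
          refine Finset.sum_congr rfl fun i _ => ?_
          rw [inv_mul_cancel_left₀ (pow_pos (hc i) 2).ne']
      _ ≤ _ := hsumle _ _ (fun i => by positivity) fun i => mul_nonneg (sq_nonneg _) (hann x i)
  exact ⟨e.toContinuousLinearEquivOfBounds _ _ hto hinv, hL⟩

end Weight

/-! ### Calculus of matrix-valued functions -/

section MatrixCalculus

variable {m k : Type*}

theorem isC1_const (A : Matrix m k ℂ) : IsC1 fun _ => A := fun _ _ => contDiffOn_const

theorem matDeriv_const (A : Matrix m k ℂ) (ξ : ℝ) : matDeriv (fun _ => A) ξ = 0 := by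
  ext i j
  simp [matDeriv]

theorem IsC1.hasDerivAt {M : ℝ → Matrix m k ℂ} (hM : IsC1 M) {ξ : ℝ} (hξ : 0 < ξ) (i : m) (j : k) :
    HasDerivAt (fun ζ => M ζ i j) (matDeriv M ξ i j) ξ :=
  ((hM i j).differentiableOn one_ne_zero ξ hξ.le).hasDerivWithinAt.hasDerivAt (Ici_mem_nhds hξ)

variable [Fintype k]

theorem IsC1.hasDerivAt_mulVec [Fintype m] {M : ℝ → Matrix m k ℂ} (hM : IsC1 M)
    {v : ℝ → k → ℂ} {d : k → ℂ} {ξ : ℝ} (hξ : 0 < ξ) (hv : HasDerivAt v d ξ) :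
    HasDerivAt (fun ζ => (M ζ).mulVec (v ζ))
      ((matDeriv M ξ).mulVec (v ξ) + (M ξ).mulVec d) ξ := by
  refine hasDerivAt_pi.2 fun i => ?_
  have h := HasDerivAt.fun_sum (u := Finset.univ) fun j _ =>
    (hM.hasDerivAt hξ i j).mul (hasDerivAt_pi.1 hv j)
  simpa only [Finset.sum_add_distrib] using! h

theorem IsC1.locAC_mulVec [Fintype m] {M : ℝ → Matrix m k ℂ} (hM : IsC1 M)
    {v : ℝ → k → ℂ} (hv : LocAC v) : LocAC fun ζ => (M ζ).mulVec (v ζ) :=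
  locAC_pi fun i => LocAC.sum (s := Finset.univ) fun j _ =>
    (locAC_of_contDiffOn (hM i j)).mul (hv.apply j)

theorem hasDerivAt_const_mulVec [Fintype m] (A : Matrix m k ℂ) {v : ℝ → k → ℂ} {d : k → ℂ} {ξ : ℝ}
    (hξ : 0 < ξ) (hv : HasDerivAt v d ξ) : HasDerivAt (fun ζ => A.mulVec (v ζ)) (A.mulVec d) ξ := by
  simpa [matDeriv_const] using (isC1_const A).hasDerivAt_mulVec hξ hv

variable [DecidableEq k]

theorem IsC1.contDiffOn_det {M : ℝ → Matrix k k ℂ} (hM : IsC1 M) :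
    ContDiffOn ℝ 1 (fun ζ => (M ζ).det) (Ici 0) := by
  simp only [Matrix.det_apply]
  exact ContDiffOn.sum fun σ _ => (contDiffOn_prod fun i _ => hM (σ i) i).const_smul _

/-- Cramer's rule: the entries of the adjugate are determinants of continuously differentiable
matrices. -/
theorem IsC1.inv {M : ℝ → Matrix k k ℂ} (hM : IsC1 M) (hu : ∀ ξ, 0 ≤ ξ → IsUnit (M ξ)) :
    IsC1 fun ζ => (M ζ)⁻¹ := by
  intro i j
  simp only [Matrix.inv_def, Ring.inverse_eq_inv', Matrix.smul_apply, Matrix.adjugate_apply,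
    smul_eq_mul]
  refine (hM.contDiffOn_det.inv fun ξ hξ => ?_).mul (IsC1.contDiffOn_det fun a b => ?_)
  · exact ((Matrix.isUnit_iff_isUnit_det _).1 (hu ξ hξ)).ne_zero
  · by_cases h : a = j
    · subst h
      simpa using contDiffOn_const
    · simpa [Matrix.updateRow_ne h] using hM a b

/-- The product rule for `M v`, with the derivative of `M` expressed by that of `M⁻¹`. -/
theorem IsC1.hasDerivAt_mulVec_of_inv {M : ℝ → Matrix k k ℂ} (hM : IsC1 M)
    (hu : ∀ ξ, 0 ≤ ξ → IsUnit (M ξ)) {v : ℝ → k → ℂ} {d : k → ℂ} {ξ : ℝ} (hξ : 0 < ξ)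
    (hv : HasDerivAt v d ξ) :
    HasDerivAt (fun ζ => (M ζ).mulVec (v ζ))
      ((M ξ).mulVec d - (M ξ * matDeriv (fun ζ => (M ζ)⁻¹) ξ).mulVec ((M ξ).mulVec (v ξ))) ξ := by
  have hdet : ∀ ζ, 0 ≤ ζ → IsUnit (M ζ).det := fun ζ hζ =>
    (Matrix.isUnit_iff_isUnit_det _).1 (hu ζ hζ)
  have h1 := (hM.inv hu).hasDerivAt_mulVec hξ (hM.hasDerivAt_mulVec hξ (hasDerivAt_const ξ (v ξ)))
  -- Differentiating the constant `M⁻¹ M v(ξ)` gives `M' = -M (M⁻¹)' M`, which brings the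
  -- perturbation into the form of hypothesis (c).
  have h2 : HasDerivAt (fun ζ => (M ζ)⁻¹.mulVec ((M ζ).mulVec (v ξ))) 0 ξ := by
    refine (hasDerivAt_const ξ (v ξ)).congr_of_eventuallyEq ?_
    filter_upwards [lt_mem_nhds hξ] with ζ hζ
    rw [Matrix.mulVec_mulVec, Matrix.nonsing_inv_mul _ (hdet ζ hζ.le), Matrix.one_mulVec]
  have h3 := congrArg (M ξ).mulVec (h1.unique h2)
  rw [Matrix.mulVec_zero, add_zero, Matrix.mulVec_add,
    Matrix.mulVec_mulVec ((matDeriv M ξ).mulVec (v ξ)) (M ξ) (M ξ)⁻¹,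
    Matrix.mul_nonsing_inv _ (hdet ξ hξ.le), Matrix.one_mulVec] at h3
  convert hM.hasDerivAt_mulVec hξ hv using 1
  rw [eq_neg_of_add_eq_zero_right h3, Matrix.mulVec_mulVec, sub_eq_add_neg, add_comm,
    Matrix.mulVec_mulVec, Matrix.mulVec_mulVec]

end MatrixCalculus

/-! ### Diagonalization of the port-Hamiltonian operator -/

section Diagonalization

variable {n p : ℕ} {P₁ : Matrix (Fin n) (Fin n) ℂ} {H Δ S : ℝ → Matrix (Fin n) (Fin n) ℂ}
  {WB : Matrix (Fin p) (Fin n) ℂ}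

/-- The substitution is `φ = S P₁ u`, which equals `Δ S x` because `u = H x`. The product rule
produces the term with `(S⁻¹)'`, and `u(0) = P₁⁻¹ S(0)⁻¹ φ(0)` translates the boundary condition. -/
theorem exists_locAC_iff_diagonalized (hP : IsUnit P₁) (hS : IsC1 S)
    (hSu : ∀ ξ, 0 ≤ ξ → IsUnit (S ξ))
    (hdiag : ∀ ξ, 0 ≤ ξ → P₁ * H ξ = (S ξ)⁻¹ * Δ ξ * S ξ) (x y : ℝ → Fin n → ℂ) :
    (∃ u : ℝ → Fin n → ℂ, LocAC u ∧ (∀ᵐ ξ ∂halfLine, u ξ = (H ξ).mulVec (x ξ)) ∧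
      WB.mulVec (u 0) = 0 ∧ ∀ᵐ ξ ∂halfLine, ∃ d, HasDerivAt u d ξ ∧ y ξ = P₁.mulVec d) ↔
    ∃ φ : ℝ → Fin n → ℂ, LocAC φ ∧
      (∀ᵐ ξ ∂halfLine, φ ξ = (Δ ξ).mulVec ((S ξ).mulVec (x ξ))) ∧
      (∀ᵐ ξ ∂halfLine, HasDerivAt φ ((S ξ).mulVec (y ξ) -
        (S ξ * matDeriv (fun ζ => (S ζ)⁻¹) ξ * Δ ξ).mulVec ((S ξ).mulVec (x ξ))) ξ) ∧
      (WB * P₁⁻¹ * (S 0)⁻¹).mulVec (φ 0) = 0 := by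
  have hPdet : IsUnit P₁.det := (Matrix.isUnit_iff_isUnit_det _).1 hP
  have hSdet : ∀ ζ, 0 ≤ ζ → IsUnit (S ζ).det := fun ζ hζ =>
    (Matrix.isUnit_iff_isUnit_det _).1 (hSu ζ hζ)
  have hpos : ∀ᵐ ξ ∂halfLine, 0 < ξ := ae_halfLine_of_forall fun _ h => h
  constructor
  · rintro ⟨u, hu, hux, hu0, huy⟩
    have hφ : ∀ᵐ ξ ∂halfLine,
        (S ξ).mulVec (P₁.mulVec (u ξ)) = (Δ ξ).mulVec ((S ξ).mulVec (x ξ)) := by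
      filter_upwards [hux, hpos] with ξ h1 hξ
      rw [h1, Matrix.mulVec_mulVec, Matrix.mulVec_mulVec, Matrix.mulVec_mulVec, Matrix.mul_assoc,
        hdiag ξ hξ.le, Matrix.mul_assoc, Matrix.mul_nonsing_inv_cancel_left _ _ (hSdet ξ hξ.le)]
    refine ⟨fun ζ => (S ζ).mulVec (P₁.mulVec (u ζ)),
      hS.locAC_mulVec ((isC1_const P₁).locAC_mulVec hu), hφ, ?_, ?_⟩
    · filter_upwards [hφ, huy, hpos] with ξ h1 h2 hξ
      obtain ⟨d, hd, h2⟩ := h2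
      convert hS.hasDerivAt_mulVec_of_inv hSu hξ (hasDerivAt_const_mulVec P₁ hξ hd) using 2
      · rw [h2]
      · rw [h1, Matrix.mulVec_mulVec, Matrix.mulVec_mulVec, Matrix.mulVec_mulVec]
    · rw [Matrix.mulVec_mulVec, Matrix.nonsing_inv_mul_cancel_right _ _ (hSdet 0 le_rfl),
        Matrix.mulVec_mulVec, Matrix.nonsing_inv_mul_cancel_right _ _ hPdet, hu0]
  · rintro ⟨φ, hφ, hφx, hφy, hφ0⟩
    refine ⟨fun ζ => P₁⁻¹.mulVec ((S ζ)⁻¹.mulVec (φ ζ)),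
      (isC1_const P₁⁻¹).locAC_mulVec ((hS.inv hSu).locAC_mulVec hφ), ?_, ?_, ?_⟩
    · filter_upwards [hφx, hpos] with ξ h1 hξ
      rw [h1]
      simp only [Matrix.mulVec_mulVec]
      rw [← Matrix.mul_assoc _ (Δ ξ), ← hdiag ξ hξ.le, Matrix.nonsing_inv_mul_cancel_left _ _ hPdet]
    · simpa only [Matrix.mulVec_mulVec, Matrix.mul_assoc] using hφ0
    · filter_upwards [hφx, hφy, hpos] with ξ h1 h2 hξ
      refine ⟨_, hasDerivAt_const_mulVec P₁⁻¹ hξ ((hS.inv hSu).hasDerivAt_mulVec hξ h2), ?_⟩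
      rw [Matrix.mulVec_mulVec, Matrix.mul_nonsing_inv _ hPdet, Matrix.one_mulVec,
        Matrix.mulVec_sub, h1]
      simp only [Matrix.mulVec_mulVec, Matrix.mul_assoc]
      rw [Matrix.nonsing_inv_mul_cancel_left _ _ (hSdet ξ hξ.le),
        Matrix.nonsing_inv_mul _ (hSdet ξ hξ.le), Matrix.one_mulVec]
      abel

variable {σ : Fin n → ℝ} {θ : Fin n → ℝ → ℝ}

/-- The correspondence is `ψ i = c i * φ i`. The scaling by `c` leaves the differential equations
unchanged and only deforms the boundary space; this freedom is what later makes the boundary form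
nonnegative. -/
theorem mem_transportRel_iff (hθ : ∀ i ξ, 0 ≤ ξ → 0 < θ i ξ)
    (hΔσ : ∀ ξ, 0 ≤ ξ → Δ ξ = Matrix.diagonal fun i => ((σ i * θ i ξ : ℝ) : ℂ))
    {w : ℝ → Matrix (Fin n) (Fin n) ℂ} {c : Fin n → ℝ} (hc : ∀ i, 0 < c i)
    {Ψ : L2 w ≃L[ℂ] UnweightedL2 n}
    (hΨ : ∀ x i, ∀ᵐ ξ ∂halfLine, Ψ x i ξ = ((c i * √(θ i ξ) : ℝ) : ℂ) * x ξ i)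
    (G : Matrix (Fin p) (Fin n) ℂ) (g h : L2 w) :
    (Ψ g, Ψ h) ∈ transportRel σ θ (LinearMap.ker (Matrix.toLin'
      (G * Matrix.diagonal fun i => (((c i)⁻¹ : ℝ) : ℂ)))) ↔
    ∃ φ : ℝ → Fin n → ℂ, LocAC φ ∧ (∀ᵐ ξ ∂halfLine, φ ξ = (Δ ξ).mulVec (g ξ)) ∧
      (∀ᵐ ξ ∂halfLine, HasDerivAt φ (h ξ) ξ) ∧ G.mulVec (φ 0) = 0 := by
  have hmem : ∀ᵐ ξ ∂halfLine, ξ ∈ Ici (0 : ℝ) := ae_restrict_mem measurableSet_Ici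
  have hcc : ∀ i, (((c i)⁻¹ : ℝ) : ℂ) * (c i : ℂ) = 1 := fun i => by
    exact_mod_cast inv_mul_cancel₀ (hc i).ne'
  have hθs : ∀ i ξ, 0 ≤ ξ → ((√(θ i ξ) : ℝ) : ℂ) ≠ 0 ∧
      ((√(θ i ξ) : ℝ) : ℂ) * ((√(θ i ξ) : ℝ) : ℂ) = θ i ξ := fun i ξ hξ => by
    refine ⟨by exact_mod_cast (Real.sqrt_pos.2 (hθ i ξ hξ)).ne', ?_⟩
    exact_mod_cast Real.mul_self_sqrt (hθ i ξ hξ).le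
  have hΔv : ∀ ξ, 0 ≤ ξ → ∀ v i, (Δ ξ).mulVec v i = (σ i * θ i ξ : ℂ) * v i := fun ξ hξ v i => by
    rw [hΔσ ξ hξ, Matrix.mulVec_diagonal]
    push_cast
    rfl
  have hbd : ∀ v : Fin n → ℂ, v ∈ LinearMap.ker (Matrix.toLin'
      (G * Matrix.diagonal fun i => (((c i)⁻¹ : ℝ) : ℂ))) ↔
      G.mulVec (fun i => (((c i)⁻¹ : ℝ) : ℂ) * v i) = 0 := fun v => by
    rw [LinearMap.mem_ker, Matrix.toLin'_apply, ← Matrix.mulVec_mulVec]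
    refine Eq.congr_left (congrArg _ (funext fun i => ?_))
    rw [Matrix.mulVec_diagonal]
  constructor
  · rintro ⟨ψ, h1, h2, h3, h4⟩
    refine ⟨fun ξ i => (((c i)⁻¹ : ℝ) : ℂ) * ψ i ξ, locAC_pi fun i => (h1 i).const_mul _, ?_, ?_,
      (hbd _).1 h4⟩
    · filter_upwards [ae_all_iff.2 h2, ae_all_iff.2 (hΨ g), hmem] with ξ e1 e2 hξ
      funext i
      have e3 := e1 i
      change ψ i ξ = _ * Ψ g i ξ at e3
      rw [hΔv ξ hξ, e3, e2 i, ← (hθs i ξ hξ).2]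
      push_cast
      have := hcc i
      push_cast at this
      linear_combination (σ i * √(θ i ξ) * √(θ i ξ) * g ξ i : ℂ) * this
    · filter_upwards [ae_all_iff.2 h3, ae_all_iff.2 (hΨ h), hmem] with ξ e1 e2 hξ
      refine hasDerivAt_pi.2 fun i => ?_
      have e3 := (e1 i).const_mul (((c i)⁻¹ : ℝ) : ℂ)
      change HasDerivAt _ (_ * (Ψ h i ξ / _)) ξ at e3
      refine e3.congr_deriv ?_
      rw [e2 i, ← mul_div_assoc, div_eq_iff (hθs i ξ hξ).1]
      have := hcc i
      push_cast at this ⊢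
      linear_combination (√(θ i ξ) * h ξ i : ℂ) * this
  · rintro ⟨φ, h1, h2, h3, h4⟩
    refine ⟨fun i ξ => (c i : ℂ) * φ ξ i, fun i => (h1.apply i).const_mul _, fun i => ?_,
      fun i => ?_, (hbd _).2 ?_⟩
    · filter_upwards [h2, hΨ g i, hmem] with ξ e1 e2 hξ
      change _ = _ * Ψ g i ξ
      rw [e2, e1, hΔv ξ hξ, ← (hθs i ξ hξ).2]
      push_cast
      ring
    · filter_upwards [h3, hΨ h i, hmem] with ξ e1 e2 hξ
      refine ((hasDerivAt_pi.1 e1 i).const_mul (c i : ℂ)).congr_deriv ?_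
      change _ = Ψ h i ξ / _
      rw [e2, eq_div_iff (hθs i ξ hξ).1]
      push_cast
      ring
    · simpa only [← mul_assoc, hcc, one_mul] using h4

/-- Up to a similarity and a bounded perturbation, the port-Hamiltonian operator is a system of
decoupled transport equations. -/
theorem mem_phsGraph_iff (hP : IsUnit P₁) (hS : IsC1 S) (hSu : ∀ ξ, 0 ≤ ξ → IsUnit (S ξ))
    (hdiag : ∀ ξ, 0 ≤ ξ → P₁ * H ξ = (S ξ)⁻¹ * Δ ξ * S ξ) (hθ : ∀ i ξ, 0 ≤ ξ → 0 < θ i ξ)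
    (hΔσ : ∀ ξ, 0 ≤ ξ → Δ ξ = Matrix.diagonal fun i => ((σ i * θ i ξ : ℝ) : ℂ))
    {w : ℝ → Matrix (Fin n) (Fin n) ℂ} {Φ : L2 H ≃L[ℂ] L2 w}
    (hΦ : ∀ x : L2 H, ∀ᵐ ξ ∂halfLine, Φ x ξ = (S ξ).mulVec (x ξ)) {B : L2 w →L[ℂ] L2 w}
    (hB : ∀ g : L2 w, ∀ᵐ ξ ∂halfLine,
      B g ξ = (S ξ * matDeriv (fun ζ => (S ζ)⁻¹) ξ * Δ ξ).mulVec (g ξ))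
    {c : Fin n → ℝ} (hc : ∀ i, 0 < c i) {Ψ : L2 w ≃L[ℂ] UnweightedL2 n}
    (hΨ : ∀ x i, ∀ᵐ ξ ∂halfLine, Ψ x i ξ = ((c i * √(θ i ξ) : ℝ) : ℂ) * x ξ i) (x y : L2 H) :
    (x, y) ∈ phsGraph P₁ H WB ↔ (Ψ (Φ x), Ψ (Φ y) - Ψ (B (Φ x))) ∈
      transportRel σ θ (LinearMap.ker (Matrix.toLin'
        (WB * P₁⁻¹ * (S 0)⁻¹ * Matrix.diagonal fun i => (((c i)⁻¹ : ℝ) : ℂ)))) := by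
  rw [← map_sub, mem_transportRel_iff hθ hΔσ hc hΨ]
  refine (exists_locAC_iff_diagonalized hP hS hSu hdiag x y).trans
    (exists_congr fun φ => and_congr_right fun _ => and_congr ?_ (and_congr_left fun _ => ?_))
  · refine eventually_congr ?_
    filter_upwards [hΦ x] with ξ h1
    rw [h1]
  · refine eventually_congr ?_
    have hsub : ∀ a b : L2 w, ⇑(a - b) =ᵐ[halfLine] ⇑a - ⇑b := fun a b =>
      AEEqFun.coeFn_sub a.toAE b.toAE
    filter_upwards [hΦ x, hΦ y, hB (Φ x), hsub (Φ y) (B (Φ x))] with ξ h1 h2 h3 h4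
    rw [h4, Pi.sub_apply, h3, h2, h1]

end Diagonalization

/-! ### The generation theorem -/

section Generation

variable {n p : ℕ}

/-- A continuous real function without zeros on `[0,∞)` has constant sign. -/
theorem eq_sign_mul_norm {f : ℝ → ℂ} (hf : ContinuousOn f (Ici 0))
    (hr : ∀ ξ, 0 ≤ ξ → f ξ = ((f ξ).re : ℂ)) (h0 : ∀ ξ, 0 ≤ ξ → f ξ ≠ 0) {ξ : ℝ} (hξ : 0 ≤ ξ) :
    f ξ = (((if (f 0).re < 0 then -1 else 1) * ‖f ξ‖ : ℝ) : ℂ) := by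
  have hc : ContinuousOn (fun ξ => (f ξ).re) (Ici 0) := Complex.continuous_re.comp_continuousOn hf
  have hz : ∀ ζ, 0 ≤ ζ → (f ζ).re ≠ 0 := fun ζ hζ h => h0 ζ hζ (by rw [hr ζ hζ, h]; simp)
  have key : (f ξ).re < 0 ↔ (f 0).re < 0 := by
    constructor
    · intro h
      by_contra h'
      obtain ⟨ζ, hζ, e⟩ := isPreconnected_Ici.intermediate_value (a := ξ) (b := 0) hξ
        self_mem_Ici hc ⟨h.le, not_lt.1 h'⟩
      exact hz ζ hζ e
    · intro h
      by_contra h'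
      obtain ⟨ζ, hζ, e⟩ := isPreconnected_Ici.intermediate_value (a := 0) (b := ξ) self_mem_Ici
        hξ hc ⟨h.le, not_lt.1 h'⟩
      exact hz ζ hζ e
  have hn : ‖f ξ‖ = |(f ξ).re| := by
    conv_lhs => rw [hr ξ hξ]
    rw [Complex.norm_real, Real.norm_eq_abs]
  rw [hn]
  conv_lhs => rw [hr ξ hξ]
  rw [Complex.ofReal_inj]
  by_cases h : (f 0).re < 0
  · rw [if_pos h, abs_of_neg (key.2 h)]
    ring
  · rw [if_neg h, abs_of_nonneg (not_lt.1 fun h' => h (key.1 h')), one_mul]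

/-- The signs of the diagonal entries. -/
def diagSign (D : Matrix (Fin n) (Fin n) ℂ) (i : Fin n) : ℝ := if (D i i).re < 0 then -1 else 1

theorem diagSign_eq (D : Matrix (Fin n) (Fin n) ℂ) (i : Fin n) :
    diagSign D i = 1 ∨ diagSign D i = -1 := by
  unfold diagSign
  split_ifs <;> simp

theorem diagSign_eq_one_iff (D : Matrix (Fin n) (Fin n) ℂ) (i : Fin n) :
    diagSign D i = 1 ↔ ¬ (D i i).re < 0 := by
  unfold diagSign
  split_ifs with h
  · simp only [h, not_true, iff_false]
    norm_num
  · simp [h]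

/-! ### Linear algebra of the boundary space -/

variable {D : Matrix (Fin n) (Fin n) ℂ} {G : Matrix (Fin p) (Fin n) ℂ}

theorem mulVec_apply_of_isDiag (hD : D.IsDiag) (y : Fin n → ℂ) (i : Fin n) :
    D.mulVec y i = D i i * y i := by
  conv_lhs => rw [← hD.diagonal_diag]
  rw [Matrix.mulVec_diagonal, Matrix.diag_apply]

/-- Weights of the components that make the boundary form nonnegative on the kernel of `G`. -/
theorem exists_weights_nonneg (hD : D.IsDiag) (hD0 : ∀ i, D i i ≠ 0)
    (hinj : Function.Injective (negBlock D (G * D)).mulVec) :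
    ∃ c : Fin n → ℝ, (∀ i, 0 < c i) ∧
      ∀ φ, G.mulVec φ = 0 → 0 ≤ ∑ i, diagSign D i * ‖(c i : ℂ) * φ i‖ ^ 2 := by
  let pr : (Fin n → ℂ) →ₗ[ℂ] (Fin n → ℂ) :=
    LinearMap.pi fun i => if (D i i).re < 0 then 0 else LinearMap.proj i
  have hpr : ∀ φ i, pr φ i = if (D i i).re < 0 then 0 else φ i := fun φ i => by
    simp only [pr, LinearMap.pi_apply]
    split_ifs <;> rfl
  -- A vector of the kernel of `G` without leaving part is `D` applied to a vector in the kernel of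
  -- the negative block, hence zero. So the leaving part controls the whole boundary vector with
  -- some constant `K`.
  let L := pr.comp (LinearMap.ker (Matrix.toLin' G)).subtype
  have hL : LinearMap.ker L = ⊥ := by
    rw [LinearMap.ker_eq_bot']
    rintro ⟨φ, hφ⟩ h
    have hφ' : G.mulVec φ = 0 := hφ
    have h' : ∀ i, ¬ (D i i).re < 0 → φ i = 0 := fun i hi => by
      have := congrFun h i
      change pr φ i = 0 at this
      rwa [hpr, if_neg hi] at this
    have hy : D.mulVec (extendNeg D fun i => (D i i)⁻¹ * φ i) = φ := by
      have e : extendNeg D (fun i => (D i i)⁻¹ * φ i) = fun i => (D i i)⁻¹ * φ i :=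
        extendNeg_restrict (y := fun i => (D i i)⁻¹ * φ i) fun i hi => by
          rw [h' i hi, mul_zero]
      rw [e]
      funext i
      rw [mulVec_apply_of_isDiag hD, mul_inv_cancel_left₀ (hD0 i)]
    have hz := hinj (a₁ := fun i => (D i i)⁻¹ * φ i) (a₂ := 0) (by
      rw [negBlock_mulVec, ← Matrix.mulVec_mulVec, hy, hφ', Matrix.mulVec_zero])
    refine Subtype.ext (funext fun i => ?_)
    by_cases hi : (D i i).re < 0
    · exact (mul_eq_zero.1 (congrFun hz ⟨i, hi⟩)).resolve_left (inv_ne_zero (hD0 i))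
    · exact h' i hi
  obtain ⟨K, -, hK⟩ := L.exists_antilipschitzWith hL
  have hb : ∀ φ, G.mulVec φ = 0 → ‖φ‖ ≤ K * ‖pr φ‖ := fun φ hφ => by
    simpa using! hK.le_mul_norm (map_zero L) (⟨φ, hφ⟩ : LinearMap.ker (Matrix.toLin' G))
  have hpos : (0 : ℝ) < n * (K : ℝ) ^ 2 + 1 := by positivity
  -- Each of the at most `n` entering components has squared modulus at most `K² ‖pr φ‖²`; the
  -- weight `n K² + 1` of the leaving squares outweighs them all.
  refine ⟨fun i => if (D i i).re < 0 then 1 else √(n * (K : ℝ) ^ 2 + 1), fun i => ?_, fun φ hφ => ?_⟩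
  · dsimp only
    split_ifs
    · exact one_pos
    · exact Real.sqrt_pos.2 hpos
  · have hsum : ‖pr φ‖ ^ 2 ≤ ∑ i, ‖pr φ i‖ ^ 2 := by
      rw [← Real.sq_sqrt (Finset.sum_nonneg fun i _ => sq_nonneg ‖pr φ i‖)]
      refine pow_le_pow_left₀ (norm_nonneg _) ((pi_norm_le_iff_of_nonneg (Real.sqrt_nonneg _)).2
        fun i => Real.le_sqrt_of_sq_le ?_) 2
      exact Finset.single_le_sum (f := fun i => ‖pr φ i‖ ^ 2) (fun i _ => sq_nonneg _)
        (Finset.mem_univ i)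
    -- The loss `K² ‖pr φ‖²` is charged to every index, also to the leaving ones, so that the sum
    -- has a uniform shape.
    have hle : ∀ i, (n * (K : ℝ) ^ 2 + 1) * ‖pr φ i‖ ^ 2 - (K : ℝ) ^ 2 * ‖pr φ‖ ^ 2 ≤
        diagSign D i * ‖((if (D i i).re < 0 then 1 else √(n * (K : ℝ) ^ 2 + 1) : ℝ) : ℂ)
          * φ i‖ ^ 2 := by
      intro i
      rw [hpr, diagSign]
      split_ifs with hi
      · have h1 : ‖φ i‖ ≤ K * ‖pr φ‖ := (norm_le_pi_norm φ i).trans (hb φ hφ)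
        have h2 := pow_le_pow_left₀ (norm_nonneg _) h1 2
        rw [mul_pow] at h2
        simpa using h2
      · rw [norm_mul, mul_pow, Complex.norm_real, Real.norm_eq_abs, sq_abs, Real.sq_sqrt hpos.le,
          one_mul]
        exact sub_le_self _ (by positivity)
    refine le_trans ?_ (Finset.sum_le_sum fun i _ => hle i)
    rw [Finset.sum_sub_distrib, ← Finset.mul_sum, Finset.sum_const, Finset.card_univ,
      Fintype.card_fin, nsmul_eq_mul]
    have h1 : n * (K : ℝ) ^ 2 * ‖pr φ‖ ^ 2 ≤ n * (K : ℝ) ^ 2 * ∑ i, ‖pr φ i‖ ^ 2 :=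
      mul_le_mul_of_nonneg_left hsum (by positivity)
    nlinarith [Finset.sum_nonneg fun i (_ : i ∈ Finset.univ) => sq_nonneg ‖pr φ i‖]

/-- The leaving components are prescribed, and surjectivity of the negative block supplies entering
ones that restore the boundary condition. This is the range condition for the transport relation. -/
theorem exists_mem_ker_extending (hD : D.IsDiag)
    (hsurj : Function.Surjective (negBlock D (G * D)).mulVec) (a : Fin n → ℂ) :
    ∃ φ, G.mulVec φ = 0 ∧ ∀ i, ¬ (D i i).re < 0 → φ i = a i := by
  obtain ⟨z, hz⟩ := hsurj (-G.mulVec fun i => if (D i i).re < 0 then 0 else a i)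
  refine ⟨(fun i => if (D i i).re < 0 then 0 else a i) + D.mulVec (extendNeg D z), ?_, ?_⟩
  · rw [Matrix.mulVec_add, Matrix.mulVec_mulVec, ← negBlock_mulVec, hz, add_neg_cancel]
  · intro i hi
    rw [Pi.add_apply, if_neg hi, mulVec_apply_of_isDiag hD]
    simp [extendNeg, hi]

/-- A kernel vector of the negative block, extended by zero and multiplied by `D`, is an admissible
boundary value with entering part only: the seed of the eigenvectors in the necessity proof. -/
theorem exists_mem_ker_of_not_injective (hD : D.IsDiag) (hD0 : ∀ i, D i i ≠ 0)
    (hinj : ¬ Function.Injective (negBlock D (G * D)).mulVec) :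
    ∃ φ, φ ≠ 0 ∧ G.mulVec φ = 0 ∧ ∀ i, ¬ (D i i).re < 0 → φ i = 0 := by
  have h1 : ¬ ∀ z, (negBlock D (G * D)).mulVec z = 0 → z = 0 := fun h => hinj
    ((injective_iff_map_eq_zero (Matrix.toLin' (negBlock D (G * D)))).2 h)
  push Not at h1
  obtain ⟨z, hz, hz0⟩ := h1
  refine ⟨D.mulVec (extendNeg D z), fun h => hz0 (funext fun i => ?_), ?_, fun i hi => ?_⟩
  · have := congrFun h i
    rw [mulVec_apply_of_isDiag hD, Pi.zero_apply, mul_eq_zero] at this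
    have := this.resolve_left (hD0 i)
    simpa [extendNeg, i.2] using this
  · rw [Matrix.mulVec_mulVec, ← negBlock_mulVec, hz]
  · rw [mulVec_apply_of_isDiag hD]
    simp [extendNeg, hi]

/-! ### From the boundary matrix to generation -/

theorem generatesC0Semigroup_phsOperator_iff {P₁ : Matrix (Fin n) (Fin n) ℂ}
    {H : ℝ → Matrix (Fin n) (Fin n) ℂ} {WB : Matrix (Fin p) (Fin n) ℂ} :
    GeneratesC0Semigroup (phsOperator P₁ H WB) ↔
      ∃ T : ℝ → L2 H →L[ℂ] L2 H, IsC0Semigroup T ∧ HasGenerator T (phsGraph P₁ H WB) := by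
  have h : ∀ x y : L2 H, (∃ hx : x ∈ (phsOperator P₁ H WB).domain,
      phsOperator P₁ H WB ⟨x, hx⟩ = y) ↔ (x, y) ∈ phsGraph P₁ H WB := fun x y => by
    rw [← phsOperator_graph, LinearPMap.mem_graph_iff]
    constructor
    · rintro ⟨hx, rfl⟩
      exact ⟨⟨x, hx⟩, rfl, rfl⟩
    · rintro ⟨⟨x', hx⟩, h1, h2⟩
      obtain rfl : x' = x := h1
      exact ⟨hx, h2⟩
  simp only [GeneratesC0Semigroup, HasGenerator, h]

variable {P₁ : Matrix (Fin n) (Fin n) ℂ} {H Δ S : ℝ → Matrix (Fin n) (Fin n) ℂ}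
  {WB : Matrix (Fin p) (Fin n) ℂ}

/-- Both directions use the same similarity to the transport relation: sufficiency with weights
adapted to the boundary form, necessity with all weights equal to `1`. -/
theorem exists_semigroup_iff_injective (hP : IsUnit P₁) (hS : IsC1 S)
    (hSu : ∀ ξ, 0 ≤ ξ → IsUnit (S ξ))
    (hdiag : ∀ ξ, 0 ≤ ξ → P₁ * H ξ = (S ξ)⁻¹ * Δ ξ * S ξ) (hΔ : IsC1 Δ)
    (hΔd : ∀ ξ, 0 ≤ ξ → (Δ ξ).IsDiag) (hΔr : ∀ ξ, 0 ≤ ξ → ∀ i, Δ ξ i i = ((Δ ξ i i).re : ℂ))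
    (hw : IsWeight (absDiag Δ)) {M : ℝ} (hM : ∀ ξ, 0 ≤ ξ → ∀ i j, ‖Δ ξ i j‖ ≤ M)
    {Φ : L2 H ≃L[ℂ] L2 (absDiag Δ)}
    (hΦ : ∀ x : L2 H, ∀ᵐ ξ ∂halfLine, Φ x ξ = (S ξ).mulVec (x ξ))
    {B : L2 (absDiag Δ) →L[ℂ] L2 (absDiag Δ)}
    (hB : ∀ g : L2 (absDiag Δ), ∀ᵐ ξ ∂halfLine,
      B g ξ = (S ξ * matDeriv (fun ζ => (S ζ)⁻¹) ξ * Δ ξ).mulVec (g ξ))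
    (hcard : Fintype.card {i // (Δ 0 i i).re < 0} = p) :
    (∃ T : ℝ → L2 H →L[ℂ] L2 H, IsC0Semigroup T ∧ HasGenerator T (phsGraph P₁ H WB)) ↔
      Function.Injective (negBlock (Δ 0) (WB * H 0 * (S 0)⁻¹)).mulVec := by
  have hPdet : IsUnit P₁.det := (Matrix.isUnit_iff_isUnit_det _).1 hP
  have hSdet : IsUnit (S 0).det := (Matrix.isUnit_iff_isUnit_det _).1 (hSu 0 le_rfl)
  -- The boundary condition acts on `φ = Δ S x`, the block `U₂` on `S x`; the two matrices differ by
  -- the factor `Δ(0)`.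
  have hG : WB * H 0 * (S 0)⁻¹ = WB * P₁⁻¹ * (S 0)⁻¹ * Δ 0 := by
    have h1 : H 0 = P₁⁻¹ * ((S 0)⁻¹ * Δ 0 * S 0) := by
      rw [← hdiag 0 le_rfl, Matrix.nonsing_inv_mul_cancel_left _ _ hPdet]
    rw [h1]
    simp only [Matrix.mul_assoc]
    rw [Matrix.mul_nonsing_inv _ hSdet, Matrix.mul_one]
  have hθ : ∀ (i : Fin n) ξ, 0 ≤ ξ → 0 < ‖Δ ξ i i‖ := fun i ξ hξ => by
    have h := (hw.posDef ξ hξ).diag_pos (i := i)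
    rw [absDiag, Matrix.diagonal_apply_eq] at h
    exact_mod_cast h
  have hθc : ∀ i : Fin n, ContinuousOn (fun ξ => ‖Δ ξ i i‖) (Ici 0) := fun i =>
    (hΔ i i).continuousOn.norm
  have hD0 : ∀ i, Δ 0 i i ≠ 0 := fun i => norm_pos_iff.1 (hθ i 0 le_rfl)
  have hΔσ : ∀ ξ, 0 ≤ ξ →
      Δ ξ = Matrix.diagonal fun i => ((diagSign (Δ 0) i * ‖Δ ξ i i‖ : ℝ) : ℂ) := fun ξ hξ => by
    conv_lhs => rw [← (hΔd ξ hξ).diagonal_diag]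
    refine congrArg _ (funext fun i => ?_)
    exact eq_sign_mul_norm (hΔ i i).continuousOn (fun ζ hζ => hΔr ζ hζ i)
      (fun ζ hζ => norm_pos_iff.1 (hθ i ζ hζ)) hξ
  have hsim : ∀ c : Fin n → ℝ, (∀ i, 0 < c i) →
      ∃ (Φ' : L2 H ≃L[ℂ] UnweightedL2 n) (B' : UnweightedL2 n →L[ℂ] UnweightedL2 n),
        ∀ x y, (x, y) ∈ phsGraph P₁ H WB ↔ (Φ' x, Φ' y - B' (Φ' x)) ∈
          transportRel (diagSign (Δ 0)) (fun i ξ => ‖Δ ξ i i‖) (LinearMap.ker (Matrix.toLin'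
            (WB * P₁⁻¹ * (S 0)⁻¹ * Matrix.diagonal fun i => (((c i)⁻¹ : ℝ) : ℂ)))) := by
    intro c hc
    obtain ⟨Ψ, hΨ⟩ := exists_weight_equiv hw (θ := fun i ξ => ‖Δ ξ i i‖) (fun _ _ => rfl) hθc hθ hc
    refine ⟨Φ.trans Ψ, (Ψ : L2 (absDiag Δ) →L[ℂ] UnweightedL2 n).comp
      (B.comp (Ψ.symm : UnweightedL2 n →L[ℂ] L2 (absDiag Δ))), fun x y => ?_⟩
    rw [mem_phsGraph_iff hP hS hSu hdiag hθ hΔσ hΦ hB hc hΨ]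
    simp
  have hker : ∀ (c : Fin n → ℝ) (v : Fin n → ℂ), v ∈ LinearMap.ker (Matrix.toLin'
      (WB * P₁⁻¹ * (S 0)⁻¹ * Matrix.diagonal fun i => (((c i)⁻¹ : ℝ) : ℂ))) ↔
      (WB * P₁⁻¹ * (S 0)⁻¹).mulVec (fun i => (((c i)⁻¹ : ℝ) : ℂ) * v i) = 0 := fun c v => by
    rw [LinearMap.mem_ker, Matrix.toLin'_apply, ← Matrix.mulVec_mulVec]
    refine Eq.congr_left (congrArg _ (funext fun i => ?_))
    rw [Matrix.mulVec_diagonal]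
  have hΔ0 := hΔd 0 le_rfl
  rw [hG]
  set G := WB * P₁⁻¹ * (S 0)⁻¹
  constructor
  · rintro ⟨T, hT, hgen⟩
    by_contra hinj
    obtain ⟨v, hv0, hGv, hv⟩ := exists_mem_ker_of_not_injective hΔ0 hD0 hinj
    obtain ⟨Φ', B', hrel⟩ := hsim (fun _ => 1) fun _ => one_pos
    -- Completeness, needed for the uniform boundedness principle, is inherited from the unweighted
    -- space.
    have : CompleteSpace (L2 H) :=
      (completeSpace_congr (e := Φ'.toEquiv) Φ'.isUniformEmbedding).2 inferInstance
    obtain ⟨l₀, hl₀⟩ := hgen.eigenvector_eq_zero hT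
      ((Φ'.symm : UnweightedL2 n →L[ℂ] L2 H).comp (B'.comp (Φ' : L2 H →L[ℂ] UnweightedL2 n)))
    -- The number `max l₀ 0 + 1` is positive and exceeds `l₀`, so the eigenvector exists and is
    -- excluded at the same time.
    obtain ⟨k, hk0, hk⟩ := exists_eigenvector_transportRel hθc hθ (diagSign_eq (Δ 0))
      ((hker (fun _ => 1) v).2 (by simpa using hGv)) hv0
      (fun i hi => hv i ((diagSign_eq_one_iff _ i).1 hi)) (l := max l₀ 0 + 1) (by positivity)
    have hx := hl₀ (max l₀ 0 + 1) (by linarith [le_max_left l₀ 0]) (Φ'.symm k) ((hrel _ _).2 (by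
      simpa using hk))
    exact hk0 (by simpa using hx)
  · intro hinj
    have hsurj := (injective_mulVec_iff_surjective hcard _).1 hinj
    obtain ⟨c, hc, hcV⟩ := exists_weights_nonneg hΔ0 hD0 hinj
    obtain ⟨Φ', B', hrel⟩ := hsim c hc
    have hcc : ∀ i, (c i : ℂ) * (((c i)⁻¹ : ℝ) : ℂ) = 1 := fun i => by
      exact_mod_cast mul_inv_cancel₀ (hc i).ne'
    refine (isMDissipative_transportRel hθc hθ (M := M) (fun i ξ hξ => hM ξ hξ i i)
      (diagSign_eq (Δ 0)) (fun v hv => ?_) fun a => ?_).exists_semigroup_of_similar B' Φ' hrel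
    · simpa only [← mul_assoc, hcc, one_mul] using hcV _ ((hker c v).1 hv)
    · obtain ⟨φ, hφ, hφa⟩ := exists_mem_ker_extending hΔ0 hsurj
        fun i => (((c i)⁻¹ : ℝ) : ℂ) * a i
      refine ⟨fun i => (c i : ℂ) * φ i, (hker c _).2 ?_, fun i hi => ?_⟩
      · simpa only [← mul_assoc, mul_comm _ (c _ : ℂ), hcc, one_mul] using hφ
      · change (c i : ℂ) * φ i = a i
        rw [hφa i ((diagSign_eq_one_iff _ i).1 hi), ← mul_assoc, hcc, one_mul]

/-! ### Constant multipliers -/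

/-- The constant matrices that act on `L²_w` by multiplication. -/
def constMultipliers (w : ℝ → Matrix (Fin n) (Fin n) ℂ) : Subalgebra ℂ (Matrix (Fin n) (Fin n) ℂ) where
  carrier := {A | ∀ x : L2 w, ∃ z : L2 w, ∀ᵐ ξ ∂halfLine, z ξ = A.mulVec (x ξ)}
  mul_mem' := by
    intro A B hA hB x
    obtain ⟨y, hy⟩ := hB x
    obtain ⟨z, hz⟩ := hA y
    refine ⟨z, ?_⟩
    filter_upwards [hy, hz] with ξ h1 h2
    rw [h2, h1, Matrix.mulVec_mulVec]
  add_mem' := by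
    intro A B hA hB x
    obtain ⟨y, hy⟩ := hA x
    obtain ⟨z, hz⟩ := hB x
    refine ⟨y + z, ?_⟩
    filter_upwards [hy, hz, L2.coe_add y z] with ξ h1 h2 h3
    rw [h3, Pi.add_apply, h1, h2, Matrix.add_mulVec]
  algebraMap_mem' := by
    intro a x
    refine ⟨a • x, ?_⟩
    filter_upwards [L2.coe_smul a x] with ξ h1
    rw [h1, Pi.smul_apply, Algebra.algebraMap_eq_smul_one, Matrix.smul_mulVec, Matrix.one_mulVec]

/-- Left multiplication by `A` is injective on the finite-dimensional algebra `𝓐`, hence surjective,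
so `1 = A X` with `X` in `𝓐`. -/
theorem inv_mem_subalgebra (𝓐 : Subalgebra ℂ (Matrix (Fin n) (Fin n) ℂ))
    {A : Matrix (Fin n) (Fin n) ℂ} (hA : IsUnit A) (h : A ∈ 𝓐) : A⁻¹ ∈ 𝓐 := by
  have hdet : IsUnit A.det := (Matrix.isUnit_iff_isUnit_det _).1 hA
  have hinj : Function.Injective (LinearMap.mulLeft ℂ (⟨A, h⟩ : 𝓐)) := fun X Y hXY =>
    Subtype.ext (hA.mul_left_cancel (congrArg Subtype.val hXY))
  obtain ⟨X, hX⟩ := LinearMap.injective_iff_surjective.1 hinj 1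
  have hX' : A * X = 1 := congrArg Subtype.val hX
  rw [Matrix.inv_eq_right_inv hX']
  exact X.2

/-- The multipliers form an algebra, so `P₁⁻¹` acts on the weighted space together with `P₁`; each
form of the derivative condition follows from the other. -/
theorem mem_phsOperator_domain_iff (hP : IsUnit P₁)
    (hm : ∀ x : L2 H, ∃ z : L2 H, ∀ᵐ ξ ∂halfLine, z ξ = P₁.mulVec (x ξ)) (x : L2 H) :
    x ∈ (phsOperator P₁ H WB).domain ↔ ∃ u : ℝ → Fin n → ℂ, LocAC u ∧
      (∀ᵐ ξ ∂halfLine, u ξ = (H ξ).mulVec (x ξ)) ∧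
      (∃ z : L2 H, ∀ᵐ ξ ∂halfLine, HasDerivAt u (z ξ) ξ) ∧ WB.mulVec (u 0) = 0 := by
  have hPdet : IsUnit P₁.det := (Matrix.isUnit_iff_isUnit_det _).1 hP
  have hinv : P₁⁻¹ ∈ constMultipliers H := inv_mem_subalgebra _ hP hm
  rw [LinearPMap.mem_domain_iff, phsOperator_graph]
  constructor
  · rintro ⟨y, u, h1, h2, h3, h4⟩
    obtain ⟨z, hz⟩ := hinv y
    refine ⟨u, h1, h2, ⟨z, ?_⟩, h3⟩
    filter_upwards [hz, h4] with ξ e1 ⟨d, hd, e2⟩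
    change y ξ = _ at e2
    rwa [e1, e2, Matrix.mulVec_mulVec, Matrix.nonsing_inv_mul _ hPdet, Matrix.one_mulVec]
  · rintro ⟨u, h1, h2, ⟨z, hz⟩, h3⟩
    obtain ⟨y, hy⟩ := hm z
    refine ⟨y, u, h1, h2, h3, ?_⟩
    filter_upwards [hz, hy] with ξ e1 e2 using ⟨_, e1, e2⟩

end Generation

end PHS

end

/-! ### The main theorem -/

theorem theorem4p10 {n : ℕ} (hn : 1 ≤ n)
    -- `P₁` is Hermitian and invertible
    (P₁ : Matrix (Fin n) (Fin n) ℂ) (hP₁ : P₁.IsHermitian) (hP₁u : IsUnit P₁)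
    -- the Hamiltonian
    (H : ℝ → Matrix (Fin n) (Fin n) ℂ) (hH : PHS.IsC1 H)
    (hHpos : ∀ ξ, 0 ≤ ξ → (H ξ).PosDef)
    -- the smooth diagonalization
    (Δ S : ℝ → Matrix (Fin n) (Fin n) ℂ) (hΔ : PHS.IsC1 Δ) (hS : PHS.IsC1 S)
    (hΔd : ∀ ξ, 0 ≤ ξ → (Δ ξ).IsDiag) (hSu : ∀ ξ, 0 ≤ ξ → IsUnit (S ξ))
    (hdiag : ∀ ξ, 0 ≤ ξ → P₁ * H ξ = (S ξ)⁻¹ * Δ ξ * S ξ)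
    -- the number of negative eigenvalues of `P₁`, and the boundary matrix
    (nm : ℕ) (hnm : nm = Fintype.card {i : Fin n // hP₁.eigenvalues i < 0}) (hnm1 : 1 ≤ nm)
    (WB : Matrix (Fin nm) (Fin n) ℂ)
    -- (a) `Δ` is bounded
    (ha : ∃ M : ℝ, ∀ ξ, 0 ≤ ξ → ∀ i j, ‖Δ ξ i j‖ ≤ M)
    -- (b) `x ↦ S x` is an isomorphism of Banach spaces
    (hb : ∃ Φ : PHS.L2 H ≃L[ℂ] PHS.L2 (PHS.absDiag Δ), ∀ x : PHS.L2 H,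
      ∀ᵐ ξ ∂PHS.halfLine, Φ x ξ = (S ξ).mulVec (x ξ))
    -- (c) `g ↦ S (S⁻¹)' Δ g` is a bounded operator
    (hc : ∃ B : PHS.L2 (PHS.absDiag Δ) →L[ℂ] PHS.L2 (PHS.absDiag Δ),
      ∀ g : PHS.L2 (PHS.absDiag Δ), ∀ᵐ ξ ∂PHS.halfLine,
        B g ξ = (S ξ * PHS.matDeriv (fun ζ => (S ζ)⁻¹) ξ * Δ ξ).mulVec (g ξ))
    -- (d) `x ↦ S' P₁ H x` is well-defined
    (hd : ∀ x : PHS.L2 H, ∃ g : PHS.L2 (PHS.absDiag Δ), ∀ᵐ ξ ∂PHS.halfLine,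
      g ξ = (PHS.matDeriv S ξ * P₁ * H ξ).mulVec (x ξ))
    -- (e) `W_B` has full rank
    (he : WB.rank = nm) :
    List.TFAE
      [ -- (i)
        PHS.GeneratesC0Semigroup (PHS.phsOperator P₁ H WB),
        -- (ii) `U₂` is invertible
        ∃ V : Matrix {i : Fin n // (Δ 0 i i).re < 0} (Fin nm) ℂ,
          PHS.negBlock (Δ 0) (WB * H 0 * (S 0)⁻¹) * V = 1 ∧
            V * PHS.negBlock (Δ 0) (WB * H 0 * (S 0)⁻¹) = 1,
        -- (iii)
        (PHS.negEigenspan (P₁ * H 0)).map (Matrix.toLin' (WB * H 0)) = ⊤ ] ∧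
    -- if `P₁` acts on `L²_H`, then `P₁ (H x)' ∈ L²_H` in the domain means `(H x)' ∈ L²_H`
    ((∀ x : PHS.L2 H, ∃ z : PHS.L2 H, ∀ᵐ ξ ∂PHS.halfLine, z ξ = P₁.mulVec (x ξ)) →
      ∀ x : PHS.L2 H, x ∈ (PHS.phsOperator P₁ H WB).domain ↔
        ∃ u : ℝ → Fin n → ℂ, PHS.LocAC u ∧
          (∀ᵐ ξ ∂PHS.halfLine, u ξ = (H ξ).mulVec (x ξ)) ∧
          (∃ z : PHS.L2 H, ∀ᵐ ξ ∂PHS.halfLine, HasDerivAt u (z ξ) ξ) ∧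
          WB.mulVec (u 0) = 0) := by
  have hw := PHS.isWeight_absDiag hP₁u hHpos hΔ hΔd hdiag
  obtain ⟨M, hM⟩ := ha
  obtain ⟨Φ, hΦ⟩ := hb
  obtain ⟨B, hB⟩ := hc
  have hlin := fun ξ (hξ : 0 ≤ ξ) => PHS.eigenvalues_mul_posDef hP₁ (hHpos ξ hξ) (hSu ξ hξ)
    (hΔd ξ hξ) (hdiag ξ hξ)
  -- The law of inertia makes `U₂` square, so that injectivity, surjectivity and invertibility
  -- coincide.
  have hcard : Fintype.card {i // (Δ 0 i i).re < 0} = nm := (hlin 0 le_rfl).2.trans hnm.symm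
  have h12 := PHS.generatesC0Semigroup_phsOperator_iff.trans
    ((PHS.exists_semigroup_iff_injective (WB := WB) hP₁u hS hSu hdiag hΔ hΔd
      (fun ξ hξ => (hlin ξ hξ).1) hw hM hΦ hB hcard).trans
        (PHS.exists_inverse_iff_injective hcard _).symm)
  have h23 := (PHS.exists_inverse_iff_injective hcard _).trans
    ((PHS.injective_mulVec_iff_surjective hcard _).trans
      (PHS.map_negEigenspan_eq_top_iff (hSu 0 le_rfl) (hΔd 0 le_rfl) (hlin 0 le_rfl).1
        (hdiag 0 le_rfl) (WB * H 0)).symm)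
  refine ⟨?_, fun hm x => PHS.mem_phsOperator_domain_iff hP₁u hm x⟩
  tfae_have 1 ↔ 2 := h12
  tfae_have 2 ↔ 3 := h23
  tfae_finish
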